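/- Let $K$ be an algebraically closed field of characteristic $0$ (for instance $\overline{\mathbb C(\xi)}$ for indeterminates $\xi$), let $W[x]=K[x]\langle\partial\rangle$, $W(x)=K(x)\langle\partial\rangle$, $\partial=d/dx$, and write $P\sim Q$ if $P=gQ$ with $g\in K(x)^\times$. For $0\ne P\in W(x)$ let $\mathrm RP$ be a nonzero element of $K(x)P\cap W[x]$ of minimal degree in $x$ (unique up to a constant). Let $\mathcal L$ be the automorphism $x\mapsto-\partial$, $\partial\mapsto x$ of $W[x]$. For a polynomial $p$ let $\mathrm{Ade}(p)$ be the substitution $\partial\mapsto\partial-p'(x)$, and for $c,f\in K$ let $\mathrm{RAd}((x-c)^f)$ be the substitution $\partial\mapsto\partial-\frac f{x-c}$ followed by $\mathrm R$. The twisted Euler transforms are $$E(a,f)=\mathcal L\circ\mathrm{RAd}((x+a)^{-f})\circ\mathcal L^{-1}\circ\mathrm R,\qquad E(p;a,f)=\mathrm{Ade}(p)\circ E(a,f)\circ\mathrm{Ade}(-p).$$ Exponents. Put $[\mu]_m=\{\mu,\mu+1,\dots,\mu+m-1\}$; blocks with $m=0$ are empty and may be omitted. In a set of exponents $\{[\mu_1]_{m_1},\dots,[\mu_l]_{m_l}\}$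 it is always required that $\mu_a-\mu_b\notin\mathbb Z$ for distinct nonempty blocks. An operator $P\in W[x]$ of order $n$ has these semi-simple exponents at a regular singular (or ordinary) point $x=c$ if $\sum_a m_a=n$, $P\sim\sum_{j=0}^n(x-c)^{n-j}a_j(x)\partial^{n-j}$ with polynomials $a_j$, $a_0(c)\neq0$, and, writing $\sum_j\frac{a_j(x)}{a_0(x)}\nu(\nu-1)\cdots(\nu-(n-j)+1)=\sum_k f_k(\nu)(x-c)^k$, one has $f_k(\mu_a+j)=0$ for $0\le j<m_a$, $0\le k<m_a-j$. It has these semi-simple exponents at $x=\infty$ if, with $m=\sum_a m_a$ and $P=\sum_{s\ge0}x^{\rho-s}P_s(\partial)$, $\rho=\deg P$, one has $P_s^{(j)}(0)=0$ for $s+j<m$, $P_0^{(m)}(0)\ne0$, and $p_k(-\mu_a-j-k)=0$ for $0\le j<m_a$, $m\le k<m+m_a-j$, where $p_k(\lambda)=\sum_{s=0}^k(\lambda+s+1)(\lambda+s+2)\cdots(\lambda+k)\,\frac{P_s^{(k-s)}(0)}{(k-s)!}$. It has them as $e^{p(x)}$-twisted exponents if $P(x,\partial+p'(x))$ has them. Tables.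 A table of local data consists of distinct points $c_i\in K$ ($1\le i\le p$) with blocks $[\mu^i;m^i]=\{[\mu^i_1]_{m^i_1},\dots,[\mu^i_{s_i}]_{m^i_{s_i}}\}$, distinct $\alpha_i\in K$ ($1\le i\le r$), for each $i$ distinct $\beta^i_j\in K$ ($1\le j\le l_i$), and blocks $[\nu^{ij};n^{ij}]=\{[\nu^{ij}_1]_{n^{ij}_1},\dots,[\nu^{ij}_{t_{ij}}]_{n^{ij}_{t_{ij}}}\}$. Put $n^i_j=\sum_kn^{ij}_k$, $n_i=\sum_jn^i_j$. It is the table of local data of $P\in W[x]$ if $n:=\mathrm{ord}\,P>0$, $\sum_in_i=n$, and: * every point of $K$ other than $c_1,\dots,c_p$ is an ordinary point of $P$ (up to $\sim$ the leading coefficient of $P$ does not vanish there), and at $c_i$ the operator $P$ has the semi-simple exponents $\{[0]_{m^i_0},[\mu^i;m^i]\}$ with $m^i_0=n-\sum_{j\ge1}m^i_j\ge0$; * the rank of irregularity of $P$ at $\infty$ is at most $2$, and $P$ is normal at $\infty$: the Newton polygon at $\infty$ of $P(x,\partial+\alpha_ix+\beta^i_j)$ has slopes $0,1,2$ with lengths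 $n^i_j,\ n_i-n^i_j,\ n-n_i$, and that of $P(x,\partial+\alpha_ix)$ has slope $2$ with length $n-n_i$ and slopes $0,1$ with total length $n_i$ (segments of length $0$ being absent); * $P$ has the $e^{\frac{\alpha_i}2x^2+\beta^i_jx}$-twisted semi-simple exponents $[\nu^{ij};n^{ij}]$ at $\infty$, for all $i,j$. Theorem. Let $P\in W[x]$ have the table of local data above. 1. For every $f\in K$ and $1\le i\le p$, the table of local data of $\mathrm{RAd}((x-c_i)^f)P$ is obtained by replacing all exponents $\{[0]_{m^i_0},[\mu^i;m^i]\}$ at $c_i$ by $\{[f]_{m^i_0},[\mu^i_1+f]_{m^i_1},\dots,[\mu^i_{s_i}+f]_{m^i_{s_i}}\}$ and every $\nu^{xy}_z$ by $\nu^{xy}_z-f$; everything else, including the order, is unchanged. 2. Fix $i,j,k$ with $n^{ij}_k>0$ and put $N_i=\sum_{x=1}^p\sum_{y=1}^{s_x}m^x_y+(n-n_i)$. Assume that none of the numbers $\mu^x_y$, $\nu^{iy}_z$, $\mu^x_y+\nu^{ij}_k$ (all $x,y,z$) is an integer. (If the exponents are indeterminates subject only to the Fuchs relation and the order given below is positive,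 this is automatic.) Then $N_i\ge n^i_j$, and $$Q=E\bigl(\tfrac{\alpha_i}2x^2;\ \beta^i_j,\ \nu^{ij}_k-1\bigr)P$$ has order $n-n^{ij}_k+N_i-n^i_j$, and its table of local data has the same $c_x$, $\alpha_x$, $\beta^x_y$ and the blocks $[\tilde\mu^x;m^x]$, $[\tilde\nu^{xy};\tilde n^{xy}]$ with $$\tilde\mu^x=(\mu^x_1+\nu^{ij}_k-1,\dots,\mu^x_{s_x}+\nu^{ij}_k-1),$$ $$\tilde\nu^{xy}=\begin{cases}(\nu^{ij}_1-(\nu^{ij}_k-1),\dots,\nu^{ij}_{k-1}-(\nu^{ij}_k-1),\ 2-\nu^{ij}_k,\ \nu^{ij}_{k+1}-(\nu^{ij}_k-1),\dots)&(x,y)=(i,j),\\ \nu^{iy}&x=i,\ y\ne j,\\ (\nu^{xy}_1+\nu^{ij}_k-1,\dots,\nu^{xy}_{t_{xy}}+\nu^{ij}_k-1)&x\neq i,\end{cases}$$ $$\tilde n^{xy}=\begin{cases}(n^{ij}_1,\dots,n^{ij}_{k-1},\ N_i-n^i_j,\ n^{ij}_{k+1},\dots)&(x,y)=(i,j),\\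 n^{xy}&\text{otherwise.}\end{cases}$$ -/

import Mathlib

open Polynomial

noncomputable section

namespace TwistedEuler

/-! ### Differential operators

An operator `∑ aᵢ ∂ⁱ` (functions to the left of the powers of `∂`) is stored as the polynomial
`∑ aᵢ Xⁱ`, whose variable stands for `∂`.  Thus `K[X][X]` stores the Weyl algebra over `K` and
`(RatFunc K)[X]` its localization.  Of the product of polynomials only the left multiplication by
a function, `C a * P`, and the symbol shift inside `dLeft` are used: they agree with the products
of operators.  The order of an operator is `natDegree`. -/

/-- The product `∂ P` in normal form, `∂ ∑ aᵢ ∂ⁱ = ∑ aᵢ ∂ⁱ⁺¹ + ∑ aᵢ' ∂ⁱ`, where `δ` is the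
derivation of the coefficients. -/
def dLeft {A : Type*} [CommRing A] (δ : A → A) (P : A[X]) : A[X] :=
  X * P + P.sum fun i a => monomial i (δ a)

/-- The operator `P(x, ∂ + h)`, that is `∑ aᵢ (∂ + h)ⁱ`. -/
def substD {A : Type*} [CommRing A] (δ : A → A) (h : A) (P : A[X]) : A[X] :=
  P.sum fun i a => C a * ((fun Q => dLeft δ Q + C h * Q)^[i] 1)

variable {K : Type*} [Field K]

/-- The derivative of a rational function. -/
def ratDeriv (f : RatFunc K) : RatFunc K :=
  (algebraMap K[X] (RatFunc K) (derivative f.num) * algebraMap K[X] (RatFunc K) f.denom -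
    algebraMap K[X] (RatFunc K) f.num * algebraMap K[X] (RatFunc K) (derivative f.denom)) /
    algebraMap K[X] (RatFunc K) f.denom ^ 2

/-- The inclusion of the Weyl algebra in its localization. -/
def toRat (P : K[X][X]) : (RatFunc K)[X] := P.map (algebraMap K[X] (RatFunc K))

/-- The degree of `P` in `x`: the maximum of the degrees of its coefficients. -/
def degX (P : K[X][X]) : ℕ := P.support.sup fun i => (P.coeff i).natDegree

/-- `P ∼ Q`: the operators differ by left multiplication by a nonzero rational function. -/
def Equivalent (P Q : K[X][X]) : Prop :=
  ∃ g : RatFunc K, g ≠ 0 ∧ toRat P = C g * toRat Q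

/-- `Q` is a nonzero element of minimal degree of the intersection of `K(x) P` with the Weyl
algebra. -/
def IsReduced (P : (RatFunc K)[X]) (Q : K[X][X]) : Prop :=
  Q ≠ 0 ∧ (∃ g : RatFunc K, toRat Q = C g * P) ∧
    ∀ Q' : K[X][X], Q' ≠ 0 → (∃ g : RatFunc K, toRat Q' = C g * P) → degX Q ≤ degX Q'

open Classical in
/-- The reduced representative `R P` (it is unique up to a nonzero constant; `0` if `P = 0`). -/
def reduced (P : (RatFunc K)[X]) : K[X][X] :=
  if h : ∃ Q, IsReduced P Q then h.choose else 0

/-- The Fourier-Laplace transform, `x ↦ -∂`, `∂ ↦ x`; it sends `xʲ ∂ⁱ` to `(-∂)ʲ xⁱ`. -/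
def fourier (P : K[X][X]) : K[X][X] :=
  P.sum fun i a => a.sum fun j r =>
    C (C r) * ((fun Q => -dLeft (fun b : K[X] => derivative b) Q)^[j] (C (X ^ i)))

/-- The inverse Fourier-Laplace transform, `x ↦ ∂`, `∂ ↦ -x`; it sends `xʲ ∂ⁱ` to `∂ʲ (-x)ⁱ`. -/
def fourierInv (P : K[X][X]) : K[X][X] :=
  P.sum fun i a => a.sum fun j r =>
    C (C r) * ((dLeft (fun b : K[X] => derivative b))^[j] (C ((-X) ^ i)))

/-- `Adei(h)`: the substitution `∂ ↦ ∂ - h`. -/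
def Adei (h : RatFunc K) (P : (RatFunc K)[X]) : (RatFunc K)[X] := substD ratDeriv (-h) P

/-- `Ade(p)`: the substitution `∂ ↦ ∂ - p'`, for a polynomial `p`. -/
def Ade (p : K[X]) (P : K[X][X]) : K[X][X] :=
  substD (fun b : K[X] => derivative b) (-derivative p) P

/-- `RAd((x - c)^f)`: the addition at `c`, `∂ ↦ ∂ - f / (x - c)`, followed by `R`. -/
def RAd (c f : K) (P : K[X][X]) : K[X][X] :=
  reduced (Adei (RatFunc.C f / (RatFunc.X - RatFunc.C c)) (toRat P))

/-- `E(a, f) = L ∘ RAd((x + a)^(-f)) ∘ L⁻¹ ∘ R`. -/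
def euler (a f : K) (P : K[X][X]) : K[X][X] :=
  fourier (RAd (-a) (-f) (fourierInv (reduced (toRat P))))

/-- The twisted Euler transform `E(p; a, f) = Ade(p) ∘ E(a, f) ∘ Ade(-p)`. -/
def twistedEuler (p : K[X]) (a f : K) (P : K[X][X]) : K[X][X] :=
  Ade p (euler a f (Ade (-p) P))

/-- `P(x, ∂ + α x + β)`. -/
def twist (α β : K) (P : K[X][X]) : K[X][X] :=
  substD (fun b : K[X] => derivative b) (C α * X + C β) P

/-! ### Semi-simple characteristic exponents

A list `[(μ₁, m₁), …, (μₗ, mₗ)]` stands for the set of exponents `{[μ₁]_{m₁}, …, [μₗ]_{mₗ}}`,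
where `[μ]_m = {μ, μ + 1, …, μ + m - 1}`.  A block of multiplicity `0` is empty, and writing it or
leaving it out makes no difference. -/

/-- `z` is not an integer. -/
def NotInt (z : K) : Prop := ∀ k : ℤ, z ≠ (k : K)

/-- The number of exponents, `m₁ + … + mₗ`. -/
def size (L : List (K × ℕ)) : ℕ := (L.map Prod.snd).sum

/-- The blocks `[μᵢ + f]_{mᵢ}`. -/
def shift (f : K) (L : List (K × ℕ)) : List (K × ℕ) := L.map fun b => (b.1 + f, b.2)

/-- `μᵢ - μⱼ ∉ ℤ` for distinct nonempty blocks. -/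
def Nonresonant (L : List (K × ℕ)) : Prop :=
  L.Pairwise fun a b => 0 < a.2 → 0 < b.2 → NotInt (a.1 - b.1)

/-- `x = z` is an ordinary point of `P`: up to `∼`, the leading coefficient does not vanish. -/
def IsOrdinaryAt (P : K[X][X]) (z : K) : Prop :=
  ∃ Q : K[X][X], Equivalent P Q ∧ Q.leadingCoeff.eval z ≠ 0

/-- The form of `P` at a regular singular point `c` (up to `∼`):
`P ∼ ∑ⱼ (x - c)ⁿ⁻ʲ aⱼ(x) ∂ⁿ⁻ʲ` with `a₀(c) ≠ 0`, where `n` is the order of `P`. -/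
def IsLocalForm (P : K[X][X]) (c : K) (a : ℕ → K[X]) : Prop :=
  (a 0).eval c ≠ 0 ∧
    Equivalent P (∑ j ∈ Finset.range (P.natDegree + 1),
      monomial (P.natDegree - j) ((X - C c) ^ (P.natDegree - j) * a j))

/-- The coefficient `f_k(ν)` of `(x - c)ᵏ` in the Taylor expansion at `c` of
`∑ⱼ (aⱼ / a₀) ν (ν - 1) ⋯ (ν - (n - j) + 1)`. -/
def charCoeff (n : ℕ) (c : K) (a : ℕ → K[X]) (k : ℕ) (ν : K) : K :=
  PowerSeries.coeff k (∑ j ∈ Finset.range (n + 1),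
    PowerSeries.C ((descPochhammer K (n - j)).eval ν) *
      ((taylor c (a j) : K[X]) : PowerSeries K) *
        ((taylor c (a 0) : K[X]) : PowerSeries K)⁻¹)

/-- `P` has a regular singular (or ordinary) point at `x = c`, with semi-simple characteristic
exponents `L`: the `n = ord P` exponents are nonresonant and `f_k(μ + j) = 0` for each block
`[μ]_m`, `0 ≤ j < m` and `0 ≤ k < m - j`. -/
def HasExponentsAt (P : K[X][X]) (c : K) (L : List (K × ℕ)) : Prop :=
  Nonresonant L ∧ size L = P.natDegree ∧
    ∃ a : ℕ → K[X], IsLocalForm P c a ∧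
      ∀ b ∈ L, ∀ j < b.2, ∀ k < b.2 - j, charCoeff P.natDegree c a k (b.1 + j) = 0

/-- The polynomial `P_s` in the expansion `P = ∑ₛ x^(ρ - s) P_s(∂)`, with `ρ = deg P`. -/
def xPart (P : K[X][X]) (s : ℕ) : K[X] :=
  if s ≤ degX P then P.sum fun i a => monomial i (a.coeff (degX P - s)) else 0

/-- `p_k(λ) = ∑_{i ≤ k} (λ + i + 1)_{k-i} P_i^{(k-i)}(0) / (k-i)!`, where `(λ)_l` is the rising
factorial; `P_i^{(l)}(0) / l!` is the coefficient of degree `l` of `P_i`. -/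
def inftyPoly (P : K[X][X]) (k : ℕ) (lam : K) : K :=
  ∑ i ∈ Finset.range (k + 1),
    (ascPochhammer K (k - i)).eval (lam + i + 1) * (xPart P i).coeff (k - i)

/-- `P` has the semi-simple characteristic exponents `L` at `x = ∞`: with `m` the number of
exponents, they are nonresonant, `P_i^{(j)}(0) = 0` for `i + j < m`, `P_0^{(m)}(0) ≠ 0`, and
`p_k(-μ - j - k) = 0` for each block `[μ]_{m'}`, `0 ≤ j < m'` and `m ≤ k < m + m' - j`. -/
def HasExponentsAtInfty (P : K[X][X]) (L : List (K × ℕ)) : Prop :=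
  Nonresonant L ∧
    (∀ i j : ℕ, i + j < size L → (xPart P i).coeff j = 0) ∧
    (xPart P 0).coeff (size L) ≠ 0 ∧
    ∀ b ∈ L, ∀ j < b.2, ∀ k, size L ≤ k → k < size L + (b.2 - j) →
      inftyPoly P k (-b.1 - j - k) = 0

/-! ### Irregularity at infinity and Newton polygons -/

/-- The rank of irregularity of `P` at `∞` is at most `q`: in
`xⁿ ∂ⁿ + ∑ᵢ bᵢ(x) xⁿ⁻ⁱ ∂ⁿ⁻ⁱ`, obtained from `P` by dividing by the leading coefficient, the
degree of each nonzero `bᵢ` at infinity is at most `q i`. -/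
def RankAtInftyLE (P : K[X][X]) (q : ℚ) : Prop :=
  ∀ i, 1 ≤ i → i ≤ P.natDegree → P.coeff (P.natDegree - i) ≠ 0 →
    ((P.coeff (P.natDegree - i)).natDegree : ℚ) - (P.leadingCoeff.natDegree : ℚ) + (i : ℚ)
      ≤ q * i

/-- The set `{(x, y) | x ≤ u, y ≥ v}`. -/
def quadrant (u v : ℝ) : Set (ℝ × ℝ) := {z | z.1 ≤ u ∧ v ≤ z.2}

/-- The Newton polygon of `P = ∑ aᵢ ∂ⁱ` at infinity: the convex hull of the quadrants with corners
`(i, i - deg aᵢ)`, for `aᵢ ≠ 0`. -/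
def newtonPolygon (P : K[X][X]) : Set (ℝ × ℝ) :=
  convexHull ℝ (⋃ i ∈ P.support, quadrant (i : ℝ) ((i : ℝ) - ((P.coeff i).natDegree : ℝ)))

/-- In the half-plane `x ≥ 0`, the lower boundary of the Newton polygon of `P` consists of segments
of slopes `0`, `1`, `2` and of lengths (measured on the `x`-axis) `l₀`, `l₁`, `l₂`, in this order. A
segment of length `0` is absent. -/
def HasSlopes (P : K[X][X]) (l₀ l₁ l₂ : ℕ) : Prop :=
  ∃ v : ℝ, newtonPolygon P = convexHull ℝ
    (quadrant (l₀ : ℝ) v ∪ quadrant ((l₀ : ℝ) + l₁) (v + l₁) ∪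
      quadrant ((l₀ : ℝ) + l₁ + l₂) (v + l₁ + 2 * l₂))

/-! ### Tables of local data -/

/-- The data of a table: finite points `c i` with the blocks `[μⁱ; mⁱ]` (the block `[0]_{m₀}` is not
written), and for each `α i` the numbers `β i j` with the blocks `[νⁱʲ; nⁱʲ]`. -/
structure LocalTable (K : Type*) where
  p : ℕ
  c : Fin p → K
  μ : Fin p → List (K × ℕ)
  r : ℕ
  α : Fin r → K
  l : Fin r → ℕ
  β : (i : Fin r) → Fin (l i) → K
  ν : (i : Fin r) → Fin (l i) → List (K × ℕ)

namespace LocalTable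

variable (T : LocalTable K)

/-- `nⁱⱼ`, the number of exponents belonging to `(α i, β i j)`. -/
def nn (i : Fin T.r) (j : Fin (T.l i)) : ℕ := size (T.ν i j)

/-- `nᵢ = ∑ⱼ nⁱⱼ`. -/
def n (i : Fin T.r) : ℕ := ∑ j, T.nn i j

/-- `n = ∑ᵢ nᵢ`. -/
def order : ℕ := ∑ i, T.n i

/-- `Nᵢ = ∑ₖ ∑ₗ mᵏₗ + (n - nᵢ)`. -/
def N (i : Fin T.r) : ℕ := (∑ k, size (T.μ k)) + (T.order - T.n i)

/-- `P` is normal at infinity, with the numbers `α i`, `β i j` of the table. In the first condition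
the slope `0` occurs exactly if some `β i j` with `nⁱⱼ ≠ 0` vanishes; the part of slope at most `1`
has length `nᵢ`. -/
def IsNormalAtInfty (P : K[X][X]) : Prop :=
  (∀ i, ∃ e ≤ T.n i, HasSlopes (twist (T.α i) 0 P) e (T.n i - e) (T.order - T.n i)) ∧
  ∀ i j, HasSlopes (twist (T.α i) (T.β i j) P) (T.nn i j) (T.n i - T.nn i j) (T.order - T.n i)

/-- `T` is the table of local data of `P`. -/
structure IsTableOf (P : K[X][X]) : Prop where
  c_injective : Function.Injective T.c
  α_injective : Function.Injective T.α
  β_injective : ∀ i, Function.Injective (T.β i)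
  order_pos : 0 < P.natDegree
  order_eq : T.order = P.natDegree
  ordinary : ∀ z, (∀ i, z ≠ T.c i) → IsOrdinaryAt P z
  finite_exponents : ∀ i, ∃ m₀ : ℕ, HasExponentsAt P (T.c i) ((0, m₀) :: T.μ i)
  rank_le : RankAtInftyLE P 2
  normal : T.IsNormalAtInfty P
  infinite_exponents : ∀ i j, HasExponentsAtInfty (twist (T.α i) (T.β i j) P) (T.ν i j)

/-- The table after the addition `(x - c i)^f`: the exponents at `c i`, those of the block
`[0]_{m₀}` (where `m₀ = n - ∑ⱼ mⁱⱼ`) included, are shifted by `f`, those at infinity by `-f`. -/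
def addition (i : Fin T.p) (f : K) : LocalTable K where
  p := T.p
  c := T.c
  μ := Function.update T.μ i ((f, T.order - size (T.μ i)) :: shift f (T.μ i))
  r := T.r
  α := T.α
  l := T.l
  β := T.β
  ν := fun x y => shift (-f) (T.ν x y)

/-- The exponent `νⁱʲₖ`. -/
def exponent (i : Fin T.r) (j : Fin (T.l i)) (k : Fin (T.ν i j).length) : K :=
  ((T.ν i j).get k).1

/-- The multiplicity `nⁱʲₖ`. -/
def mult (i : Fin T.r) (j : Fin (T.l i)) (k : Fin (T.ν i j).length) : ℕ :=
  ((T.ν i j).get k).2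

/-- The table after the twisted Euler transform belonging to `νⁱʲₖ`. -/
def euler (i : Fin T.r) (j : Fin (T.l i)) (k : Fin (T.ν i j).length) : LocalTable K where
  p := T.p
  c := T.c
  μ := fun x => shift (T.exponent i j k - 1) (T.μ x)
  r := T.r
  α := T.α
  l := T.l
  β := T.β
  ν := fun x y =>
    if (⟨x, y⟩ : Σ x, Fin (T.l x)) = ⟨i, j⟩ then
      (shift (-(T.exponent i j k - 1)) (T.ν i j)).set k
        (2 - T.exponent i j k, T.N i - T.nn i j)
    else if x = i then T.ν x y
    else shift (T.exponent i j k - 1) (T.ν x y)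

end LocalTable

end TwistedEuler

end

/-!
The transform `E(p; a, f)` is a composition of twists `∂ ↦ ∂ + h`, of the Fourier–Laplace transform
`L` and its inverse, and of the addition `RAd`, so it is enough to follow the local data through each
of these operations. The general case reduces to `αᵢ = 0` by the twist with `αᵢ x² / 2`
(`HasLocalData.twist`), and this case is `HasLocalData.euler`.

*Exponents.* Operators act on the space with basis `eₙ`, `n ∈ ℤ`, and its filtration `F k`; the vector
`eₙ` stands for `x ^ (ρ + n)` at the origin and for `x ^ (-μ - n)` at infinity. The conditions that
define a semi-simple block `[μ]_m` say that the operator maps `F 0` into a step of the filtration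
which is deeper by `m` than the one prescribed by its leading terms (`FinExp`, `InfExp`,
`hasExponentsAt_iff`, `hasExponentsAtInfty_iff`). In this form the exponents are easy to transport.

* A substitution of `∂ + h` for `∂`, with `h` regular at the point, replaces the operator by a linear
  combination of its Hasse derivatives in `∂`; these are iterated commutators with `x`, which
  preserve mapping properties (`ev_hasseDeriv_mem`, `substD_eq_sum`). Multiplication of the solutions
  by a power of `x` changes the exponents in the obvious way (`ev_additionOp`). This gives the addition
  at finite points and at infinity, and with it the first part of the theorem (`HasLocalData.rAd`).
* The formal Borel transform `x^(-μ-n) ↦ x^(μ-1+n) / Γ(μ+n)` intertwines the actions of `P` and of its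
  Fourier–Laplace transform, so the exponent `μ` at infinity with the twist `β x` corresponds to the
  exponent `μ - 1` at a finite point, provided that `μ` is not an integer (`ev_four_iff`).
* For the twists by `α x² / 2 + β x` with `α ≠ 0`, the transform is, up to a shear
  `x ↦ a x + b ∂ + c`, `∂ ↦ a⁻¹ ∂`, the identity on the twisted operators (`twist_four`), and shears
  preserve the exponents at infinity, again by iterated commutators (`ev_add_mem`).

*Multiplicities.* If the coefficients of `P` have no common zero, then the order of vanishing of the
leading coefficient of `P` at a point with exponents `{[0]_{m₀}, …}` is the number of the other
exponents, when these are not integers: the indicial polynomial cannot have more roots than its degree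
allows (`FinExp.order_eq`). Hence the leading coefficient of `P` has degree `∑ mˣ_y`, the degree of `P`
in `x` is `Nᵢ` (`HasLocalData.degX_eq`), and this is the order of `L⁻¹ P`, whose exponents at `-βⁱⱼ`
are `{[0]_{Nᵢ - nⁱⱼ}, [νⁱʲ - 1; nⁱʲ]}`. The addition at this point moves the block `k` to `0`, so the
block of `0` and the block `k` change their roles. The order of the result is its degree in `x` before
the last transform, and normality expresses this degree by the degree of the leading coefficient,
which is counted in the same way.

*Normality.* For an operator of rank at most `2`, the conditions on Newton polygons amount to the
value of two degrees: that of the polynomial `P₀` and that of the leading coefficient (`hasSlopes_iff`,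
`NormalAt`, `RankLETwo`). The transform interchanges these two degrees for the twist `αᵢ = 0`
(`NormalAt.four_zero`), and the other twists are treated by shears (`NormalAt.four`).
-/

noncomputable section

namespace TwistedEuler

/-! ### Evaluation of operators in an algebra -/

section

lemma coeff_dLeft {A : Type*} [CommRing A] {δ : A → A} (h0 : δ 0 = 0) (P : A[X]) (m : ℕ) :
    (dLeft δ P).coeff m = (X * P).coeff m + δ (P.coeff m) := by
  rw [dLeft, coeff_add, Polynomial.sum_def, finsetSum_coeff]
  congr 1
  simp only [coeff_monomial]
  rw [Finset.sum_ite_eq']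
  split_ifs with h
  · rfl
  · rw [notMem_support_iff.1 h, h0]

variable {K : Type*} [Field K] {E : Type*} [Ring E] [Algebra K E]

/-- The value of the operator `P`, in normal form `∑ aᵢ ∂ⁱ`, at elements `x` and `d` of an algebra
that take the places of `x` and `∂`. -/
def ev (x d : E) : K[X][X] →ₗ[K] E where
  toFun P := P.eval₂ (aeval x).toRingHom d
  map_add' P Q := eval₂_add _ _
  map_smul' r P := by
    induction P using Polynomial.induction_on' with
    | add P Q hP hQ => simp only [smul_add, eval₂_add, hP, hQ]
    | monomial n a =>
      rw [smul_monomial, eval₂_monomial, eval₂_monomial]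
      simp

lemma ev_monomial (x d : E) (i : ℕ) (a : K[X]) : ev x d (monomial i a) = aeval x a * d ^ i :=
  eval₂_monomial _ _

lemma ev_C_mul (x d : E) (a : K[X]) (P : K[X][X]) : ev x d (C a * P) = aeval x a * ev x d P := by
  induction P using Polynomial.induction_on' with
  | add P Q hP hQ => rw [mul_add, map_add, map_add, mul_add, hP, hQ]
  | monomial n b => rw [C_mul_monomial, ev_monomial, ev_monomial, map_mul, mul_assoc]

lemma ev_one (x d : E) : ev x d (1 : K[X][X]) = 1 := by
  rw [← monomial_zero_one, ev_monomial]; simp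

lemma ev_X_mul (x d : E) (P : K[X][X]) : ev x d (X * P) = ev x d P * d := by
  rw [mul_comm]; exact eval₂_mul_X _ _

/-- The full expansion of `ev` in monomials. -/
lemma ev_expand (x d : E) (P : K[X][X]) : ev x d P =
    ∑ b ∈ P.support, ∑ a ∈ (P.coeff b).support, (P.coeff b).coeff a • (x ^ a * d ^ b) := by
  conv_lhs => rw [P.as_sum_support]
  rw [map_sum]
  refine Finset.sum_congr rfl fun b _ => ?_
  rw [ev_monomial, aeval_eq_sum_range, Finset.sum_mul]
  conv_lhs => simp only [smul_mul_assoc]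
  symm
  refine Finset.sum_subset (supp_subset_range_natDegree_succ) fun a _ h => ?_
  rw [notMem_support_iff.1 h, zero_smul]

lemma commutator_aeval {x d : E} (h : d * x = x * d + 1) (a : K[X]) :
    d * aeval x a = aeval x a * d + aeval x (derivative a) := by
  induction a using Polynomial.induction_on with
  | C r => simp [Algebra.commutes]
  | add p q hp hq => simp only [map_add, mul_add, add_mul, hp, hq]; abel
  | monomial n r ih =>
    have e : C r * X ^ (n + 1) = C r * X ^ n * X := by rw [pow_succ, mul_assoc]
    rw [e, derivative_mul, map_add, map_mul _ _ X, map_mul _ _ X, derivative_X, mul_one, aeval_X,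
      ← mul_assoc, ih, add_mul, mul_assoc, h, mul_add, ← mul_assoc, mul_one]
    abel

/-- Left multiplication by `∂`, as an endomorphism of the Weyl algebra. -/
def dOp : Module.End K K[X][X] where
  toFun := dLeft fun b : K[X] => derivative b
  map_add' P Q := by
    ext1 m; simp only [coeff_dLeft (map_zero _), coeff_add, mul_add, map_add]; ring
  map_smul' r P := by
    ext1 m
    simp only [coeff_dLeft (map_zero _), coeff_smul, mul_smul_comm, derivative_smul, smul_add,
      RingHom.id_apply]

/-- Left multiplication by `x`, as an endomorphism of the Weyl algebra. -/
def xOp : Module.End K K[X][X] := LinearMap.mulLeft K (C X)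

lemma coeff_dOp (P : K[X][X]) (m : ℕ) :
    (dOp P).coeff m = (X * P).coeff m + derivative (P.coeff m) :=
  coeff_dLeft (map_zero _) P m

lemma smul_eq_C_C_mul (r : K) (P : K[X][X]) : r • P = C (C r) * P := by
  ext1 m; rw [coeff_smul, coeff_C_mul, smul_eq_C_mul]

lemma aeval_xOp (a : K[X]) : aeval (xOp (K := K)) a = LinearMap.mulLeft K (C a) := by
  induction a using Polynomial.induction_on with
  | C r => ext P : 1; simp [Algebra.algebraMap_eq_smul_one, smul_eq_C_C_mul]
  | add p q hp hq => rw [map_add, hp, hq, C_add]; ext P : 1; simp [add_mul]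
  | monomial n r ih =>
    rw [pow_succ, ← mul_assoc, map_mul, ih, aeval_X, xOp]
    ext P : 1; simp [mul_assoc]

lemma dOp_mul_xOp : dOp * xOp = xOp * dOp + (1 : Module.End K K[X][X]) := by
  ext P : 1
  simp only [Module.End.mul_apply, LinearMap.add_apply, Module.End.one_apply, xOp,
    LinearMap.mulLeft_apply]
  ext1 m
  simp only [coeff_dOp, coeff_C_mul, coeff_add, derivative_mul, derivative_X]
  rcases m with _ | m <;> simp [coeff_X_mul, mul_add] <;> ring

lemma dOp_pow_one (i : ℕ) : ((dOp (K := K)) ^ i) 1 = X ^ i := by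
  induction i with
  | zero => rfl
  | succ i ih =>
    rw [pow_succ', Module.End.mul_apply, ih]
    ext1 m
    rw [coeff_dOp, ← pow_succ', coeff_X_pow (n := m)]
    simp only [coeff_X_pow]
    split_ifs <;> simp

lemma ev_xOp_dOp_one (P : K[X][X]) : ev xOp dOp P 1 = P := by
  induction P using Polynomial.induction_on' with
  | add P Q hP hQ => rw [map_add, LinearMap.add_apply, hP, hQ]
  | monomial n b =>
    rw [ev_monomial, Module.End.mul_apply, dOp_pow_one, aeval_xOp, LinearMap.mulLeft_apply,
      C_mul_X_pow_eq_monomial]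

/-- A linear map that intertwines two pairs of endomorphisms intertwines the operators. -/
lemma ev_intertwine {M N : Type*} [AddCommGroup M] [Module K M] [AddCommGroup N] [Module K N]
    (T : M →ₗ[K] N) {x d : Module.End K M} {x' d' : Module.End K N}
    (hx : ∀ m, T (x m) = x' (T m)) (hd : ∀ m, T (d m) = d' (T m)) (P : K[X][X]) (m : M) :
    T (ev x d P m) = ev x' d' P (T m) := by
  have hdp : ∀ (i : ℕ) m, T ((d ^ i) m) = (d' ^ i) (T m) := by
    intro i; induction i with
    | zero => intro m; rfl
    | succ i ih => intro m; rw [pow_succ, pow_succ, Module.End.mul_apply, ih, hd]; rfl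
  have hxp : ∀ (i : ℕ) m, T ((x ^ i) m) = (x' ^ i) (T m) := by
    intro i; induction i with
    | zero => intro m; rfl
    | succ i ih => intro m; rw [pow_succ, pow_succ, Module.End.mul_apply, ih, hx]; rfl
  simp only [ev_expand, LinearMap.sum_apply, map_sum, LinearMap.smul_apply, map_smul,
    Module.End.mul_apply, hxp, hdp]

lemma ev_dOp {x d : E} (h : d * x = x * d + 1) (P : K[X][X]) :
    ev x d (dOp P) = d * ev x d P := by
  induction P using Polynomial.induction_on' with
  | add P Q hP hQ => rw [map_add, map_add, map_add, mul_add, hP, hQ]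
  | monomial n b =>
    have : dOp (monomial n b) = X * monomial n b + monomial n (derivative b) := by
      ext1 m; rw [coeff_dOp, coeff_add]; simp only [coeff_monomial]; split_ifs <;> simp
    rw [this, map_add, ev_X_mul, ev_monomial, ev_monomial, ← mul_assoc, commutator_aeval h,
      add_mul, mul_assoc, mul_assoc, pow_mul_comm']

lemma ev_xOp (x d : E) (P : K[X][X]) : ev x d (xOp P) = x * ev x d P := by
  rw [xOp, LinearMap.mulLeft_apply, ev_C_mul, aeval_X]

lemma ev_mulLeft (x d : E) (P : K[X][X]) (y : E) :
    ev (LinearMap.mulLeft K x) (LinearMap.mulLeft K d) P y = ev x d P * y := by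
  simp only [ev_expand, LinearMap.sum_apply, LinearMap.smul_apply,
    Module.End.mul_apply, LinearMap.pow_mulLeft, LinearMap.mulLeft_apply, Finset.sum_mul,
    smul_mul_assoc, mul_assoc]

/-- If `A` and `B` act on the Weyl algebra, through `ev x d`, as left multiplications by `x'` and
`d'`, then the operator `P(A, B) · 1` has the value `P(x', d')`. -/
lemma ev_apply_one {x d : E} {A B : Module.End K K[X][X]} {x' d' : E}
    (hA : ∀ Z, ev x d (A Z) = x' * ev x d Z) (hB : ∀ Z, ev x d (B Z) = d' * ev x d Z)
    (P : K[X][X]) : ev x d (ev A B P 1) = ev x' d' P := by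
  rw [ev_intertwine (ev x d) (x' := LinearMap.mulLeft K x') (d' := LinearMap.mulLeft K d') hA hB,
    ev_one, ev_mulLeft, mul_one]

/-! ### The substitutions as evaluations -/

lemma substD_eq (h : K[X]) (P : K[X][X]) :
    substD (fun b : K[X] => derivative b) h P =
      ev xOp (dOp + LinearMap.mulLeft K (C h)) P 1 := by
  rw [substD, Polynomial.sum_def]
  conv_rhs => rw [P.as_sum_support]
  rw [map_sum, LinearMap.sum_apply]
  refine Finset.sum_congr rfl fun i _ => ?_
  rw [ev_monomial, Module.End.mul_apply, aeval_xOp, LinearMap.mulLeft_apply]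
  congr 1
  rw [Module.End.pow_apply]
  rfl

/-- The substitution `x ↦ ε ∂`, `∂ ↦ -ε x`. For `ε = 1` it is the inverse Fourier-Laplace
transform, for `ε = -1` the Fourier-Laplace transform. -/
def four (ε : K) (P : K[X][X]) : K[X][X] := ev (ε • dOp) (-(ε • xOp)) P 1

/-- The translation `P(x + c, ∂)`. -/
def translate (c : K) (P : K[X][X]) : K[X][X] := P.map (taylorAlgHom c).toRingHom

lemma fourierInv_eq (P : K[X][X]) : fourierInv P = four 1 P := by
  rw [fourierInv, four, ev_expand, Polynomial.sum_def, LinearMap.sum_apply]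
  refine Finset.sum_congr rfl fun i _ => ?_
  rw [Polynomial.sum_def, LinearMap.sum_apply]
  refine Finset.sum_congr rfl fun j _ => ?_
  have h : ((-xOp) ^ i) (1 : K[X][X]) = C ((-X) ^ i) := by
    have : (-xOp : Module.End K K[X][X]) = LinearMap.mulLeft K (C (-X)) := by
      ext P : 1; simp only [xOp, LinearMap.neg_apply, LinearMap.mulLeft_apply, C_neg]
      exact (neg_mul _ _).symm
    rw [this, LinearMap.pow_mulLeft]; simp
  rw [one_smul, one_smul, LinearMap.smul_apply, Module.End.mul_apply, h, Module.End.pow_apply,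
    smul_eq_C_C_mul]
  rfl

lemma fourier_eq (P : K[X][X]) : fourier P = four (-1) P := by
  rw [fourier, four, ev_expand, Polynomial.sum_def, LinearMap.sum_apply]
  refine Finset.sum_congr rfl fun i _ => ?_
  rw [Polynomial.sum_def, LinearMap.sum_apply]
  refine Finset.sum_congr rfl fun j _ => ?_
  have h : (xOp ^ i) (1 : K[X][X]) = C (X ^ i) := by
    rw [xOp, LinearMap.pow_mulLeft]; simp
  have e1 : (-1 : K) • dOp (K := K) = -dOp := by module
  have e2 : -((-1 : K) • xOp (K := K)) = xOp := by module
  rw [e1, e2, LinearMap.smul_apply, Module.End.mul_apply, h, Module.End.pow_apply, smul_eq_C_C_mul]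
  rfl

/-- A pair of elements satisfying the commutation relation of `x` and `∂`. -/
def IsWeyl (x d : E) : Prop := d * x = x * d + 1

lemma isWeyl_op : IsWeyl (xOp (K := K)) dOp := dOp_mul_xOp

lemma ev_four {x d : E} (h : IsWeyl x d) (ε : K) (P : K[X][X]) :
    ev x d (four ε P) = ev (ε • d) (-(ε • x)) P := by
  refine ev_apply_one (fun Z => ?_) (fun Z => ?_) P
  · rw [LinearMap.smul_apply, map_smul, ev_dOp h, smul_mul_assoc]
  · rw [LinearMap.neg_apply, LinearMap.smul_apply, map_neg, map_smul, ev_xOp, neg_mul,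
      smul_mul_assoc]

lemma ev_substD {x d : E} (h : IsWeyl x d) (p : K[X]) (P : K[X][X]) :
    ev x d (substD (fun b : K[X] => derivative b) p P) = ev x (d + aeval x p) P := by
  rw [substD_eq]
  refine ev_apply_one (fun Z => ev_xOp x d Z) (fun Z => ?_) P
  rw [LinearMap.add_apply, map_add, ev_dOp h, LinearMap.mulLeft_apply, ev_C_mul, add_mul]

lemma ev_translate (x d : E) (c : K) (P : K[X][X]) :
    ev x d (translate c P) = ev (x + algebraMap K E c) d P := by
  induction P using Polynomial.induction_on' with
  | add P Q hP hQ => rw [map_add, ← hP, ← hQ, ← map_add, translate, Polynomial.map_add]; rfl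
  | monomial n b =>
    rw [translate, Polynomial.map_monomial, ev_monomial, ev_monomial]
    congr 1
    change aeval x (taylor c b) = _
    rw [taylor_apply, aeval_comp]; simp

/-- Two operators with the same values in all Weyl pairs agree. -/
lemma ext_ev {P Q : K[X][X]}
    (h : ev (xOp (K := K)) dOp P = ev (xOp (K := K)) dOp Q) : P = Q := by
  rw [← ev_xOp_dOp_one P, h, ev_xOp_dOp_one]

lemma IsWeyl.add_right {x d : E} (h : IsWeyl x d) {z : E} (hz : z * x = x * z) :
    IsWeyl x (d + z) := by
  rw [IsWeyl] at *; rw [add_mul, mul_add, h, hz]; abel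

lemma IsWeyl.add_left {x d : E} (h : IsWeyl x d) {z : E} (hz : d * z = z * d) :
    IsWeyl (x + z) d := by
  rw [IsWeyl] at *; rw [add_mul, mul_add, h, hz]; abel

lemma aeval_comm_self (x : E) (p : K[X]) : aeval x p * x = x * aeval x p := by
  have h : aeval x (p * X) = aeval x (X * p) := by rw [mul_comm]
  simpa only [map_mul, aeval_X] using h

lemma IsWeyl.four {x d : E} (h : IsWeyl x d) {ε : K} (hε : ε * ε = 1) :
    IsWeyl (ε • d) (-(ε • x)) := by
  rw [IsWeyl] at *
  simp only [neg_mul, mul_neg, smul_mul_smul_comm, hε, one_smul, h]; abel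

lemma four_four {ε : K} (hε : ε * ε = 1) (P : K[X][X]) : four (-ε) (four ε P) = P := by
  refine ext_ev ?_
  have h := isWeyl_op (K := K)
  have h' : IsWeyl (-ε • dOp (K := K)) (-(-ε • xOp)) := h.four (by simpa using hε)
  have e1 : -(-ε • dOp (K := K)) = ε • dOp := by module
  have e2 : ε • -(-ε • xOp (K := K)) = (ε * ε) • xOp := by module
  have e3 : -(ε • -ε • dOp (K := K)) = (ε * ε) • dOp := by module
  rw [ev_four h, ev_four h', e2, e3, hε, one_smul, one_smul]

lemma substD_substD (p q : K[X]) (P : K[X][X]) :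
    substD (fun b : K[X] => derivative b) p (substD (fun b : K[X] => derivative b) q P) =
      substD (fun b : K[X] => derivative b) (p + q) P := by
  refine ext_ev ?_
  have h := isWeyl_op (K := K)
  rw [ev_substD h, ev_substD (h.add_right (aeval_comm_self _ _)), ev_substD h, map_add, add_assoc]

lemma substD_zero (P : K[X][X]) : substD (fun b : K[X] => derivative b) 0 P = P := by
  refine ext_ev ?_
  rw [ev_substD isWeyl_op]; simp

lemma substD_C_mul (p a : K[X]) (P : K[X][X]) :
    substD (fun b : K[X] => derivative b) p (C a * P) =
      C a * substD (fun b : K[X] => derivative b) p P := by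
  refine ext_ev ?_
  have h := isWeyl_op (K := K)
  rw [ev_substD h, ev_C_mul, ev_C_mul, ev_substD h]

lemma twist_twist (α β α' β' : K) (P : K[X][X]) :
    twist α β (twist α' β' P) = twist (α + α') (β + β') P := by
  rw [twist, twist, twist, substD_substD]; congr 1; simp only [C_add]; ring

lemma twist_zero (P : K[X][X]) : twist 0 0 P = P := by
  rw [twist]; convert substD_zero P using 2; simp

lemma ev_twist {x d : E} (h : IsWeyl x d) (α β : K) (P : K[X][X]) :
    ev x d (twist α β P) = ev x (d + (α • x + algebraMap K E β)) P := by
  rw [twist, ev_substD h]; simp [Algebra.smul_def]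

lemma translate_translate (c c' : K) (P : K[X][X]) :
    translate c (translate c' P) = translate (c' + c) P := by
  refine ext_ev ?_
  rw [ev_translate, ev_translate, ev_translate, map_add, add_assoc, add_comm (algebraMap _ _ c)]

lemma translate_C_mul (c : K) (a : K[X]) (P : K[X][X]) :
    translate c (C a * P) = C (taylor c a) * translate c P := by
  rw [translate, Polynomial.map_mul, map_C]; rfl

lemma coeff_translate (c : K) (P : K[X][X]) (i : ℕ) :
    (translate c P).coeff i = taylor c (P.coeff i) := by
  rw [translate, coeff_map]; rfl

/-- The transform turns a translation of `∂` into a translation of `x`. -/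
lemma translate_four {ε : K} (hε : ε * ε = 1) (c : K) (P : K[X][X]) :
    translate c (four ε P) = four ε (twist 0 (-(ε * c)) P) := by
  refine ext_ev ?_
  have h := isWeyl_op (K := K)
  have h1 : IsWeyl (xOp + algebraMap K (Module.End K K[X][X]) c) dOp :=
    h.add_left (Algebra.commutes _ _).symm
  rw [ev_translate, ev_four h1, ev_four h, ev_twist (h.four hε)]
  congr 2
  rw [Algebra.algebraMap_eq_smul_one, Algebra.algebraMap_eq_smul_one]
  module

end

/-! ### Weight filtrations of the Weyl algebra -/

section

variable {K : Type*} [Field K]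

/-- The operators whose monomials `xᵃ ∂ᵇ` have weight `p a + q b ≤ k`. -/
def filt (p q k : ℤ) : Submodule K K[X][X] where
  carrier := {P | ∀ a b : ℕ, k < p * a + q * b → (P.coeff b).coeff a = 0}
  add_mem' := by
    intro P Q hP hQ a b h; rw [coeff_add, coeff_add, hP a b h, hQ a b h, add_zero]
  zero_mem' := by intro a b _; simp
  smul_mem' := by intro r P hP a b h; rw [coeff_smul, coeff_smul, hP a b h, smul_zero]

lemma filt_mono (p q : ℤ) : Monotone (filt (K := K) p q) :=
  fun _ _ h _ hP a b h' => hP a b (h.trans_lt h')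

/-- An operator of bounded weight respects an increasing filtration of a module, if `x` and `∂`
raise the filtration by at most their weights. -/
lemma ev_mem_of_filt {M : Type*} [AddCommGroup M] [Module K M] {F : ℤ → Submodule K M}
    (hF : Monotone F) {x d : Module.End K M} {p q k : ℤ}
    (hx : ∀ j, ∀ m ∈ F j, x m ∈ F (j + p)) (hd : ∀ j, ∀ m ∈ F j, d m ∈ F (j + q))
    {P : K[X][X]} (hP : P ∈ filt p q k) {j : ℤ} {m : M} (hm : m ∈ F j) :
    ev x d P m ∈ F (j + k) := by
  have hdp : ∀ i : ℕ, (d ^ i) m ∈ F (j + q * i) := by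
    intro i; induction i with
    | zero => simpa using hm
    | succ i ih =>
      rw [pow_succ', Module.End.mul_apply]
      convert hd _ _ ih using 2; push_cast; ring
  have hxp : ∀ (a : ℕ) (l : ℤ) (v : M), v ∈ F l → (x ^ a) v ∈ F (l + p * a) := by
    intro a; induction a with
    | zero => intro l v hv; simpa using hv
    | succ a ih =>
      intro l v hv
      rw [pow_succ', Module.End.mul_apply]
      convert hx _ _ (ih _ _ hv) using 2; push_cast; ring
  rw [ev_expand]
  simp only [LinearMap.sum_apply]
  refine Submodule.sum_mem _ fun b _ => Submodule.sum_mem _ fun a ha => ?_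
  rw [LinearMap.smul_apply, Module.End.mul_apply]
  refine Submodule.smul_mem _ _ (hF ?_ (hxp a _ _ (hdp b)))
  by_contra h
  exact (mem_support_iff.1 ha) (hP a b (by linarith))

lemma xOp_mem {p q k : ℤ} {P : K[X][X]} (hP : P ∈ filt p q k) : xOp P ∈ filt p q (k + p) := by
  intro a b h
  rw [xOp, LinearMap.mulLeft_apply, coeff_C_mul]
  rcases a with _ | a
  · simp
  · rw [coeff_X_mul]; exact hP a b (by push_cast at h; linarith)

lemma dOp_mem {p q k : ℤ} (hpq : 0 ≤ p + q) {P : K[X][X]} (hP : P ∈ filt p q k) :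
    dOp P ∈ filt p q (k + q) := by
  intro a b h
  rw [coeff_dOp, coeff_add, coeff_derivative, hP (a + 1) b (by push_cast; linarith), zero_mul,
    add_zero]
  rcases b with _ | b
  · simp
  · rw [coeff_X_mul]; exact hP a b (by push_cast at h; linarith)

lemma one_mem_filt (p q : ℤ) : (1 : K[X][X]) ∈ filt p q 0 := by
  intro a b h
  rw [coeff_one]
  split_ifs with hb
  · rw [coeff_one, if_neg]; rintro rfl; simp [hb] at h
  · simp

lemma mem_filt_one {q k : ℤ} {P : K[X][X]} :
    P ∈ filt 1 q k ↔ ∀ b, P.coeff b ≠ 0 → ((P.coeff b).natDegree : ℤ) + q * b ≤ k := by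
  constructor
  · intro h b hb
    by_contra hlt
    exact hb (leadingCoeff_eq_zero.1 (h (P.coeff b).natDegree b (by linarith)))
  · intro h a b hlt
    by_cases hb : P.coeff b = 0
    · rw [hb, coeff_zero]
    · refine coeff_eq_zero_of_natDegree_lt ?_
      have := h b hb
      zify; linarith

lemma mem_filt_degX {P : K[X][X]} {D : ℕ} : P ∈ filt 1 0 (D : ℤ) ↔ degX P ≤ D := by
  rw [mem_filt_one, degX, Finset.sup_le_iff]
  refine forall_congr' fun b => ?_
  rw [mem_support_iff]
  refine imp_congr_right fun _ => ?_
  zify; simp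

lemma mem_filt_self (P : K[X][X]) : P ∈ filt 1 0 (degX P : ℤ) := mem_filt_degX.2 le_rfl

lemma mem_filt_natDegree {P : K[X][X]} {n : ℕ} : P ∈ filt 0 1 (n : ℤ) ↔ P.natDegree ≤ n := by
  rw [natDegree_le_iff_coeff_eq_zero]
  constructor
  · intro h b hb
    ext a; rw [coeff_zero]; exact h a b (by simpa using hb)
  · intro h a b hlt
    rw [h b (by simpa using hlt), coeff_zero]

lemma natDegree_eq_of_mem {P : K[X][X]} {n : ℕ} (h : P ∈ filt 0 1 (n : ℤ))
    {a : ℕ} (ha : (P.coeff n).coeff a ≠ 0) : P.natDegree = n :=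
  le_antisymm (mem_filt_natDegree.1 h)
    (le_natDegree_of_ne_zero fun h0 => ha (by rw [h0, coeff_zero]))

lemma degX_eq_of_mem {P : K[X][X]} {D : ℕ} (h : P ∈ filt 1 0 (D : ℤ))
    {b : ℕ} (hb : (P.coeff b).coeff D ≠ 0) : degX P = D := by
  refine le_antisymm (mem_filt_degX.1 h) ?_
  by_contra hlt
  exact hb (mem_filt_self P D b (by push Not at hlt; simpa using hlt))

lemma exists_coeff_degX {P : K[X][X]} (hP : P ≠ 0) : ∃ b, (P.coeff b).coeff (degX P) ≠ 0 := by
  by_contra! h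
  rcases Nat.eq_zero_or_pos (degX P) with h0 | h0
  · refine hP (Polynomial.ext fun b => ?_)
    have h1 : (P.coeff b).natDegree ≤ 0 := by
      by_cases hb : P.coeff b = 0
      · simp [hb]
      · rw [← h0]; exact Finset.le_sup (f := fun i => (P.coeff i).natDegree) (mem_support_iff.2 hb)
    rw [eq_C_of_natDegree_le_zero h1, ← h0, h b]; simp
  · have : P ∈ filt 1 0 ((degX P - 1 : ℕ) : ℤ) := by
      intro a b hab
      have hle : degX P ≤ a := by
        have : ((degX P - 1 : ℕ) : ℤ) < a := by simpa using hab
        omega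
      rcases hle.eq_or_lt with e | e
      · rw [← e]; exact h b
      · exact mem_filt_self P a b (by simpa using e)
    have := mem_filt_degX.1 this
    omega

lemma C_mul_mem_filt_one {q k : ℤ} {u : K[X]} (hu : u ≠ 0) {P : K[X][X]} :
    C u * P ∈ filt 1 q (u.natDegree + k) ↔ P ∈ filt 1 q k := by
  simp only [mem_filt_one, coeff_C_mul]
  refine forall_congr' fun b => ?_
  by_cases hb : P.coeff b = 0
  · simp [hb]
  · simp only [ne_eq, mul_eq_zero, hu, hb, or_self, not_false_eq_true, forall_const,
      natDegree_mul hu hb]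
    push_cast
    constructor <;> intro h <;> linarith

lemma coeff_coeff_C_mul {u : K[X]} {P : K[X][X]} {D : ℕ} (hP : P ∈ filt 1 0 (D : ℤ)) (b : ℕ) :
    ((C u * P).coeff b).coeff (u.natDegree + D) = u.leadingCoeff * (P.coeff b).coeff D := by
  rw [coeff_C_mul]
  refine coeff_mul_add_eq_of_natDegree_le le_rfl ?_
  exact natDegree_le_iff_coeff_eq_zero.2 fun a ha => hP a b (by simpa using ha)

lemma degX_C_mul {u : K[X]} (hu : u ≠ 0) {P : K[X][X]} (hP : P ≠ 0) :
    degX (C u * P) = u.natDegree + degX P := by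
  obtain ⟨b, hb⟩ := exists_coeff_degX hP
  refine degX_eq_of_mem (b := b) ?_ ?_
  · push_cast; exact (C_mul_mem_filt_one hu).2 (mem_filt_self P)
  · rw [coeff_coeff_C_mul (mem_filt_self P)]
    exact mul_ne_zero (leadingCoeff_ne_zero.2 hu) hb

/-! ### Leading terms of the transforms -/

lemma four_mem {p q k : ℤ} (hpq : 0 ≤ p + q) (ε : K) {P : K[X][X]} (hP : P ∈ filt p q k) :
    four ε P ∈ filt q p k := by
  have hx : ∀ j, ∀ m ∈ filt (K := K) q p j, (ε • dOp) m ∈ filt (K := K) q p (j + p) :=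
    fun j m hm => Submodule.smul_mem _ ε (dOp_mem (by omega) hm)
  have hd : ∀ j, ∀ m ∈ filt (K := K) q p j, (-(ε • xOp)) m ∈ filt (K := K) q p (j + q) :=
    fun j m hm => Submodule.neg_mem _ (Submodule.smul_mem _ ε (xOp_mem hm))
  have := ev_mem_of_filt (filt_mono q p) hx hd hP (one_mem_filt q p)
  rwa [zero_add] at this

lemma dOp_pow_C (g : K[X]) (i : ℕ) :
    ((dOp ^ i) (C g)).natDegree ≤ i ∧ ((dOp ^ i) (C g)).coeff i = g := by
  induction i with
  | zero => simp
  | succ i ih =>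
    rw [pow_succ', Module.End.mul_apply]
    refine ⟨natDegree_le_iff_coeff_eq_zero.2 fun m hm => ?_, ?_⟩
    · rcases m with _ | m
      · omega
      · rw [coeff_dOp, coeff_X_mul, coeff_eq_zero_of_natDegree_lt (by omega : _ < m),
          coeff_eq_zero_of_natDegree_lt (by omega : _ < m + 1)]; simp
    · rw [coeff_dOp, coeff_X_mul, ih.2, coeff_eq_zero_of_natDegree_lt (by omega : _ < i + 1)]; simp

/-- The leading coefficient of the transform of `P` is given by the terms of `P` of highest degree
in `x`. -/
lemma coeff_four (ε : K) {P : K[X][X]} {D : ℕ} (hP : P ∈ filt 1 0 (D : ℤ)) (b : ℕ) :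
    ((four ε P).coeff D).coeff b = ε ^ D * (-ε) ^ b * (P.coeff b).coeff D := by
  have h1 : ∀ i : ℕ, ((-(ε • xOp)) ^ i) (1 : K[X][X]) = C (C ((-ε) ^ i) * X ^ i) := by
    intro i
    have : (-(ε • xOp) : Module.End K K[X][X]) = LinearMap.mulLeft K (C (C (-ε) * X)) := by
      ext P : 1
      simp only [xOp, LinearMap.neg_apply, LinearMap.smul_apply, LinearMap.mulLeft_apply]
      rw [← neg_smul, smul_eq_C_C_mul, C_mul, mul_assoc]
    rw [this, LinearMap.pow_mulLeft, LinearMap.mulLeft_apply, mul_one, ← C_pow, mul_pow, ← C_pow]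
  have h2 : ∀ a i : ℕ, a ≤ D →
      ((((ε • dOp) ^ a) (C (C ((-ε) ^ i) * X ^ i))).coeff D).coeff b =
        if a = D then ε ^ D * (if b = i then (-ε) ^ i else 0) else 0 := by
    intro a i ha
    rw [_root_.smul_pow, LinearMap.smul_apply, coeff_smul, coeff_smul]
    obtain ⟨h3, h4⟩ := dOp_pow_C (C ((-ε) ^ i) * X ^ i : K[X]) a
    split_ifs with h h'
    · subst h; rw [h4, coeff_C_mul_X_pow, if_pos h', smul_eq_mul]
    · subst h; rw [h4, coeff_C_mul_X_pow, if_neg h', smul_eq_mul]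
    · rw [coeff_eq_zero_of_natDegree_lt (lt_of_le_of_lt h3 (by omega))]; simp
  rw [four, ev_expand]
  simp only [LinearMap.sum_apply, finsetSum_coeff, LinearMap.smul_apply, coeff_smul,
    Module.End.mul_apply, h1]
  rw [Finset.sum_eq_single b, Finset.sum_eq_single D]
  · rw [h2 D b le_rfl, if_pos rfl, if_pos rfl, smul_eq_mul]; ring
  · intro a ha haD
    have : a ≤ D := by
      by_contra hlt
      exact mem_support_iff.1 ha (hP a b (by push Not at hlt; simpa using hlt))
    rw [h2 a b this, if_neg haD, smul_zero]
  · intro h; rw [notMem_support_iff.1 h, zero_smul]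
  · intro i _ hi
    refine Finset.sum_eq_zero fun a ha => ?_
    have : a ≤ D := by
      by_contra hlt
      exact mem_support_iff.1 ha (hP a i (by push Not at hlt; simpa using hlt))
    rw [h2 a i this, if_neg (Ne.symm hi), mul_zero, ite_self, smul_zero]
  · intro h; rw [notMem_support_iff.1 h]; simp

lemma natDegree_four {ε : K} (hε : ε ≠ 0) {P : K[X][X]} (hP : P ≠ 0) :
    (four ε P).natDegree = degX P := by
  obtain ⟨b, hb⟩ := exists_coeff_degX hP
  refine natDegree_eq_of_mem (a := b) (four_mem (by norm_num) ε (mem_filt_self P)) ?_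
  rw [coeff_four ε (mem_filt_self P)]
  exact mul_ne_zero (mul_ne_zero (pow_ne_zero _ hε) (pow_ne_zero _ (neg_ne_zero.2 hε))) hb

lemma four_ne_zero {ε : K} (hε : ε * ε = 1) {P : K[X][X]} (hP : P ≠ 0) : four ε P ≠ 0 := by
  intro h
  apply hP
  rw [← four_four hε P, h, four, map_zero, LinearMap.zero_apply]

lemma ne_zero_of_mul_self_eq_one {ε : K} (hε : ε * ε = 1) : ε ≠ 0 := by
  rintro rfl; simp at hε

lemma degX_four {ε : K} (hε : ε * ε = 1) {P : K[X][X]} (hP : P ≠ 0) :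
    degX (four ε P) = P.natDegree := by
  rw [← natDegree_four (neg_ne_zero.2 (ne_zero_of_mul_self_eq_one hε)) (four_ne_zero hε hP), four_four hε]

/-- The terms of highest degree in `x` of the transform come from the leading coefficient. -/
lemma coeff_four' {ε : K} (hε : ε * ε = 1) {P : K[X][X]} (b : ℕ) :
    ((four ε P).coeff b).coeff P.natDegree =
      (-ε) ^ P.natDegree * ε ^ b * (P.coeff P.natDegree).coeff b := by
  have h := coeff_four (-ε) (P := four ε P) (D := P.natDegree)
    (four_mem (by norm_num) ε (mem_filt_natDegree.2 le_rfl)) b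
  rw [four_four hε, neg_neg] at h
  have h2 : (-ε) ^ P.natDegree * (-ε) ^ P.natDegree = 1 := by
    rw [← mul_pow, neg_mul_neg, hε, one_pow]
  have h5 : ε ^ b * ε ^ b = 1 := by rw [← mul_pow, hε, one_pow]
  rw [h]
  linear_combination (-((four ε P).coeff b).coeff P.natDegree) * (ε ^ b * ε ^ b * h2 + h5)

/-- The operator `P(a x + b ∂ + c, a⁻¹ ∂)`. -/
def shear (a b c : K) (P : K[X][X]) : K[X][X] :=
  ev (a • xOp + (b • dOp + c • 1)) (a⁻¹ • dOp) P 1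

lemma shear_mem {q k : ℤ} (h1 : -1 ≤ q) (h2 : q ≤ 1) (a b c : K) {P : K[X][X]}
    (hP : P ∈ filt 1 q k) : shear a b c P ∈ filt 1 q k := by
  have := ev_mem_of_filt (F := filt (K := K) 1 q) (filt_mono 1 q)
    (x := a • xOp + (b • dOp + c • 1))
    (d := a⁻¹ • dOp) (p := 1) (q := q) (fun j m hm => ?_)
    (fun j m hm => Submodule.smul_mem _ _ (dOp_mem (by linarith) hm)) hP (one_mem_filt 1 q)
  · rwa [zero_add] at this
  · refine Submodule.add_mem _ (Submodule.smul_mem _ _ (xOp_mem hm)) (Submodule.add_mem _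
      (Submodule.smul_mem _ _ (filt_mono 1 q ?_ (dOp_mem (by linarith) hm))) ?_)
    · linarith
    · exact Submodule.smul_mem _ _ (filt_mono 1 q (by linarith) hm)

/-- A shear rescales the terms of highest degree in `x`. -/
lemma coeff_shear (a b c : K) {P : K[X][X]} {D : ℕ} (hP : P ∈ filt 1 0 (D : ℤ)) (i : ℕ) :
    ((shear a b c P).coeff i).coeff D = a ^ D * a⁻¹ ^ i * (P.coeff i).coeff D := by
  set A : Module.End K K[X][X] := a • xOp + (b • dOp + c • 1) with hA
  have h0 : ∀ j : ℕ, ∀ m ∈ filt (K := K) 1 0 (j : ℤ), ∀ i,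
      A m ∈ filt 1 0 ((j + 1 : ℕ) : ℤ) ∧
      ((A m).coeff i).coeff (j + 1) = a * (m.coeff i).coeff j := by
    intro j m hm i
    have hd : dOp m ∈ filt 1 0 (j : ℤ) := by simpa using dOp_mem (by norm_num) hm
    have hmono := filt_mono (K := K) 1 0 (show (j : ℤ) ≤ ((j + 1 : ℕ) : ℤ) by push_cast; linarith)
    constructor
    · refine Submodule.add_mem _ (Submodule.smul_mem _ _ (by push_cast; exact xOp_mem hm))
        (Submodule.add_mem _ (Submodule.smul_mem _ _ (hmono hd)) ?_)
      exact Submodule.smul_mem _ _ (hmono hm)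
    · rw [hA]
      simp only [LinearMap.add_apply, LinearMap.smul_apply, Module.End.one_apply, coeff_add,
        coeff_smul, smul_eq_mul]
      rw [hd (j + 1) i (by push_cast; linarith), hm (j + 1) i (by push_cast; linarith), xOp,
        LinearMap.mulLeft_apply, coeff_C_mul, coeff_X_mul]
      ring
  have h1 : ∀ (j l i : ℕ), (A ^ j) (X ^ l) ∈ filt 1 0 (j : ℤ) ∧
      (((A ^ j) (X ^ l)).coeff i).coeff j = a ^ j * if i = l then 1 else 0 := by
    intro j l i
    induction j with
    | zero =>
      rw [pow_zero, Module.End.one_apply, coeff_X_pow]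
      refine ⟨?_, by split_ifs <;> simp⟩
      intro a' b' h
      rw [coeff_X_pow]
      have : a' ≠ 0 := by rintro rfl; simp at h
      split_ifs
      · rw [coeff_one, if_neg this]
      · simp
    | succ j ih =>
      rw [pow_succ', Module.End.mul_apply]
      refine ⟨(h0 j _ ih.1 i).1, ?_⟩
      rw [(h0 j _ ih.1 i).2, ih.2]; ring
  have h2 : ∀ l : ℕ, ((a⁻¹ • dOp) ^ l) (1 : K[X][X]) = a⁻¹ ^ l • X ^ l := by
    intro l; rw [_root_.smul_pow, LinearMap.smul_apply, dOp_pow_one]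
  rw [shear, ev_expand]
  simp only [LinearMap.sum_apply, finsetSum_coeff, LinearMap.smul_apply, coeff_smul,
    Module.End.mul_apply, h2, map_smul]
  have hsupp : ∀ a l, a ∈ (P.coeff l).support → a ≤ D := by
    intro a l ha
    by_contra hlt
    exact mem_support_iff.1 ha (hP a l (by push Not at hlt; simpa using hlt))
  rw [Finset.sum_eq_single i, Finset.sum_eq_single D]
  · rw [(h1 D i i).2, if_pos rfl]; simp only [smul_eq_mul]; ring
  · intro j hj hjD
    have : j < D := lt_of_le_of_ne (hsupp j i hj) hjD
    rw [(h1 j i i).1 D i (by simpa using this)]; simp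
  · intro h; rw [notMem_support_iff.1 h, zero_smul]
  · intro l _ hl
    refine Finset.sum_eq_zero fun j hj => ?_
    rcases (hsupp j l hj).eq_or_lt with rfl | hlt
    · rw [(h1 j l i).2, if_neg (Ne.symm hl)]; simp
    · rw [(h1 j l i).1 D i (by simpa using hlt)]; simp
  · intro h; rw [notMem_support_iff.1 h]; simp

lemma degX_shear {a : K} (ha : a ≠ 0) (b c : K) {P : K[X][X]} (hP : P ≠ 0) :
    degX (shear a b c P) = degX P := by
  obtain ⟨i, hi⟩ := exists_coeff_degX hP
  refine degX_eq_of_mem (b := i) (shear_mem (by norm_num) (by norm_num) a b c (mem_filt_self P)) ?_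
  rw [coeff_shear a b c (mem_filt_self P)]
  exact mul_ne_zero (mul_ne_zero (pow_ne_zero _ ha) (pow_ne_zero _ (inv_ne_zero ha))) hi

lemma ev_shear {E : Type*} [Ring E] [Algebra K E] {x d : E} (h : IsWeyl x d) (a b c : K)
    (P : K[X][X]) : ev x d (shear a b c P) = ev (a • x + (b • d + c • 1)) (a⁻¹ • d) P := by
  refine ev_apply_one (fun Z => ?_) (fun Z => ?_) P
  · simp only [LinearMap.add_apply, LinearMap.smul_apply, Module.End.one_apply, map_add, map_smul,
      ev_dOp h, ev_xOp, add_mul, smul_mul_assoc, one_mul]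
  · rw [LinearMap.smul_apply, map_smul, ev_dOp h, smul_mul_assoc]

/-- Up to a shear, the transform does not change the operator twisted by a nondegenerate quadratic
exponential. This is the method of stationary phase: the transform of `exp(α x² / 2)` is, up to a
constant, `exp(-x² / (2 α))`. -/
lemma twist_four {ε : K} (hε : ε * ε = 1) {α : K} (hα : α ≠ 0) (β : K) (P : K[X][X]) :
    twist (-α⁻¹) (-(ε * β * α⁻¹)) (four ε P) =
      shear (-(ε * α⁻¹)) ε (-(β * α⁻¹)) (twist α β P) := by
  refine ext_ev ?_
  have h := isWeyl_op (K := K)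
  have hinv : (-(ε * α⁻¹))⁻¹ = -(ε * α) := by
    refine inv_eq_of_mul_eq_one_left ?_
    field_simp; linear_combination hε
  have hw : IsWeyl (-(ε * α⁻¹) • xOp + (ε • dOp + (-(β * α⁻¹)) • (1 : Module.End K K[X][X])))
      ((-(ε * α⁻¹))⁻¹ • dOp) := by
    rw [hinv, IsWeyl] at *
    simp only [mul_add, add_mul, smul_mul_smul_comm, h, mul_one, one_mul]
    have e1 : -(ε * α) * -(ε * α⁻¹) = 1 := by field_simp; linear_combination hε
    rw [e1, mul_comm (-(ε * α⁻¹)), e1]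
    module
  have hw2 : IsWeyl (xOp (K := K)) (dOp + ((-α⁻¹) • xOp + algebraMap K _ (-(ε * β * α⁻¹)))) := by
    refine h.add_right ?_
    rw [add_mul, mul_add, Algebra.commutes]; simp
  rw [ev_twist h, ev_four hw2, ev_shear h, ev_twist hw, hinv]
  rw [Algebra.algebraMap_eq_smul_one, Algebra.algebraMap_eq_smul_one]
  have e1 : ε * (ε * β * α⁻¹) = β * α⁻¹ := by linear_combination β * α⁻¹ * hε
  have e2 : α * (ε * α⁻¹) = ε := by field_simp
  have e3 : α * (β * α⁻¹) = β := by field_simp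
  congr 2
  · simp only [smul_add, smul_smul, mul_neg, e1]; module
  · simp only [smul_add, smul_smul, mul_neg, e2, e3]; module

end

/-! ### Substitutions and Hasse derivatives -/

section

/-- The binomial theorem for `(d + h)ⁱ`, where `φ k` plays the part of `u⁻¹ u⁽ᵏ⁾` for a solution
`u` of `u' = h u`. -/
lemma add_pow_eq_sum {E : Type*} [Ring E] {d h : E} {φ : ℕ → E} (h0 : φ 0 = 1)
    (hφ : ∀ k, (d + h) * φ k = φ k * d + φ (k + 1)) (i : ℕ) :
    (d + h) ^ i = ∑ k ∈ Finset.range (i + 1), i.choose k • (φ k * d ^ (i - k)) := by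
  induction i with
  | zero => simp [h0]
  | succ i ih =>
    rw [pow_succ', ih, Finset.mul_sum]
    have e1 : ∀ k ∈ Finset.range (i + 1), (d + h) * (i.choose k • (φ k * d ^ (i - k))) =
        i.choose k • (φ k * d ^ (i + 1 - k)) + i.choose k • (φ (k + 1) * d ^ (i - k)) := by
      intro k hk
      have hk' : i + 1 - k = (i - k) + 1 := by have := Finset.mem_range.1 hk; omega
      rw [mul_smul_comm, ← mul_assoc, hφ, add_mul, smul_add, mul_assoc, ← pow_succ', ← hk']
    rw [Finset.sum_congr rfl e1, Finset.sum_add_distrib,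
      Finset.sum_range_succ' (fun k => (i + 1).choose k • (φ k * d ^ (i + 1 - k))) (i + 1)]
    have e2 : ∑ k ∈ Finset.range (i + 1), i.choose k • (φ k * d ^ (i + 1 - k)) =
        ∑ k ∈ Finset.range (i + 1), i.choose (k + 1) • (φ (k + 1) * d ^ (i - k)) +
          φ 0 * d ^ (i + 1) := by
      rw [Finset.sum_range_succ', Finset.sum_range_succ (fun k => i.choose (k + 1) • _)]
      simp
    rw [e2]
    simp only [Nat.choose_succ_succ, add_smul, Finset.sum_add_distrib, Nat.add_sub_add_right,
      Nat.choose_zero_right, one_smul, Nat.sub_zero]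
    abel

section Ring

variable {A : Type*} [CommRing A]

lemma hasseDeriv_eq_sum (k : ℕ) (P : A[X]) :
    hasseDeriv k P = P.sum fun i a => C a * (i.choose k • X ^ (i - k)) := by
  rw [hasseDeriv_apply]
  refine Finset.sum_congr rfl fun i _ => ?_
  change monomial (i - k) ((i.choose k : A) * P.coeff i) = C (P.coeff i) * (i.choose k • X ^ (i - k))
  rw [← C_mul_X_pow_eq_monomial, nsmul_eq_mul, C_mul, map_natCast]
  ring

/-- The substitution of `∂ + h` for `∂` as a combination of Hasse derivatives in `∂`; here
`φ k` plays the part of `u⁻¹ u⁽ᵏ⁾` for a solution `u` of `u' = h u`. -/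
lemma substD_eq_sum {δ : A →+ A} (hδ : ∀ a b, δ (a * b) = δ a * b + a * δ b) {h : A} {φ : ℕ → A}
    (h0 : φ 0 = 1) (hφ : ∀ k, φ (k + 1) = δ (φ k) + h * φ k) {P : A[X]} {n : ℕ}
    (hn : P.natDegree ≤ n) :
    substD δ h P = ∑ k ∈ Finset.range (n + 1), C (φ k) * hasseDeriv k P := by
  let d : AddMonoid.End A[X] :=
    { toFun := dLeft δ
      map_zero' := by ext1 m; simp [coeff_dLeft (map_zero δ)]
      map_add' := fun P Q => by
        ext1 m; simp only [coeff_dLeft (map_zero δ), coeff_add, mul_add, map_add]; ring }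
  let l : A → AddMonoid.End A[X] := fun a => AddMonoidHom.mulLeft (C a)
  have hd : ∀ P, d P = dLeft δ P := fun _ => rfl
  have hl : ∀ a P, l a P = C a * P := fun _ _ => rfl
  have e1 := add_pow_eq_sum (d := d) (h := l h) (φ := fun k => l (φ k))
    (by ext P : 1; rw [hl, h0]; simp) (by
      intro k; ext P : 1
      change d (C (φ k) * P) + C h * (C (φ k) * P) = C (φ k) * d P + C (φ (k + 1)) * P
      ext1 m
      simp only [hd, coeff_add, coeff_dLeft (map_zero δ), coeff_C_mul, hδ, hφ]
      have : (X * (C (φ k) * P)).coeff m = φ k * (X * P).coeff m := by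
        rw [← coeff_C_mul]; congr 1; ring
      rw [this]; ring)
  have hX : ∀ i : ℕ, (d ^ i) 1 = X ^ i := by
    intro i; induction i with
    | zero => rfl
    | succ i ih =>
      rw [pow_succ']
      change d ((d ^ i) 1) = _
      rw [ih, hd]
      ext1 m
      have h1 : δ 1 = 0 := by have := hδ 1 1; simpa using this
      rw [coeff_dLeft (map_zero δ), ← pow_succ', coeff_X_pow (n := m)]
      simp only [coeff_X_pow]
      split_ifs <;> simp [h1]
  have e2 : ∀ i ≤ n, (fun Q => dLeft δ Q + C h * Q)^[i] 1 =
      ∑ k ∈ Finset.range (n + 1), C (φ k) * (i.choose k • X ^ (i - k)) := by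
    intro i hi
    have : (fun Q => dLeft δ Q + C h * Q)^[i] 1 = ((d + l h) ^ i) 1 := by
      rw [AddMonoid.End.coe_pow]; rfl
    rw [this, e1 i]
    refine (map_sum (AddMonoidHom.eval (1 : A[X]) : AddMonoid.End A[X] →+ A[X]) _ _).trans ?_
    symm
    rw [← Finset.sum_subset (Finset.range_mono (by omega : i + 1 ≤ n + 1))]
    · refine Finset.sum_congr rfl fun k _ => ?_
      change _ = i.choose k • (C (φ k) * (d ^ (i - k)) 1)
      rw [hX, mul_smul_comm]
    · intro k _ hk
      rw [Nat.choose_eq_zero_of_lt (by simpa using hk), zero_smul, mul_zero]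
  simp only [hasseDeriv_eq_sum, Polynomial.sum_def, Finset.mul_sum, substD]
  rw [Finset.sum_comm]
  refine Finset.sum_congr rfl fun i hi => ?_
  rw [e2 i ((le_natDegree_of_mem_supp i hi).trans hn), Finset.mul_sum]
  refine Finset.sum_congr rfl fun k _ => ?_
  ring

lemma coeff_sum_hasseDeriv (φ : ℕ → A) {P : A[X]} {n : ℕ} (hn : P.natDegree ≤ n) :
    (∑ k ∈ Finset.range (n + 1), C (φ k) * hasseDeriv k P).natDegree ≤ n ∧
    (∑ k ∈ Finset.range (n + 1), C (φ k) * hasseDeriv k P).coeff n = φ 0 * P.coeff n := by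
  constructor
  · refine natDegree_sum_le_of_forall_le _ _ fun k _ => ?_
    refine (natDegree_C_mul_le _ _).trans ((natDegree_hasseDeriv_le P k).trans (by omega))
  · rw [finsetSum_coeff, Finset.sum_eq_single 0]
    · simp
    · intro k _ hk
      rw [coeff_C_mul, hasseDeriv_coeff, coeff_eq_zero_of_natDegree_lt (by omega), mul_zero, mul_zero]
    · simp

end Ring

variable {K : Type*} [Field K]

/-- The twist by a polynomial as a combination of Hasse derivatives in `∂`, with coefficient `1`
at the operator itself. -/
lemma exists_substD_eq_sum (h : K[X]) : ∃ φ : ℕ → K[X], φ 0 = 1 ∧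
    ∀ {P : K[X][X]} {n : ℕ}, P.natDegree ≤ n → substD (fun b : K[X] => derivative b) h P =
      ∑ k ∈ Finset.range (n + 1), C (φ k) * hasseDeriv k P := by
  let φ : ℕ → K[X] := fun k => Nat.rec 1 (fun _ p => derivative p + h * p) k
  exact ⟨φ, rfl, fun hn => substD_eq_sum (δ := (derivative (R := K)).toAddMonoidHom)
    (fun a b => derivative_mul) (φ := φ) rfl (fun _ => rfl) hn⟩

lemma natDegree_substD (h : K[X]) (P : K[X][X]) :
    (substD (fun b : K[X] => derivative b) h P).natDegree = P.natDegree ∧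
    (substD (fun b : K[X] => derivative b) h P).leadingCoeff = P.leadingCoeff := by
  have key : ∀ (h : K[X]) (P : K[X][X]),
      (substD (fun b : K[X] => derivative b) h P).natDegree ≤ P.natDegree ∧
      (substD (fun b : K[X] => derivative b) h P).coeff P.natDegree = P.coeff P.natDegree := by
    intro h P
    obtain ⟨φ, h0, hφ⟩ := exists_substD_eq_sum h
    rw [hφ le_rfl]
    have := coeff_sum_hasseDeriv φ (le_refl P.natDegree)
    rwa [h0, one_mul] at this
  have e : (substD (fun b : K[X] => derivative b) h P).natDegree = P.natDegree := by
    refine le_antisymm (key h P).1 ?_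
    have := (key (-h) (substD (fun b : K[X] => derivative b) h P)).1
    rwa [substD_substD, neg_add_cancel, substD_zero] at this
  exact ⟨e, by rw [leadingCoeff, e, (key h P).2, leadingCoeff]⟩

lemma substD_hasseDeriv (h : K[X]) (k : ℕ) (P : K[X][X]) :
    substD (fun b : K[X] => derivative b) h (hasseDeriv k P) =
      hasseDeriv k (substD (fun b : K[X] => derivative b) h P) := by
  obtain ⟨φ, -, hφ⟩ := exists_substD_eq_sum h
  have hn : (hasseDeriv k P).natDegree ≤ P.natDegree :=
    (natDegree_hasseDeriv_le P k).trans (Nat.sub_le _ _)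
  have hc : ∀ (a : K[X]) (Q : K[X][X]), hasseDeriv k (C a * Q) = C a * hasseDeriv k Q := by
    intro a Q; ext1 m; simp only [hasseDeriv_coeff, coeff_C_mul]; ring
  rw [hφ hn, hφ le_rfl, map_sum]
  refine Finset.sum_congr rfl fun j _ => ?_
  rw [hc]
  have e1 := LinearMap.congr_fun (hasseDeriv_comp (R := K[X]) j k) P
  have e2 := LinearMap.congr_fun (hasseDeriv_comp (R := K[X]) k j) P
  rw [LinearMap.comp_apply] at e1 e2
  rw [e1, e2, LinearMap.smul_apply, LinearMap.smul_apply, add_comm k j, Nat.choose_symm_add]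

section Ev

variable {E : Type*} [Ring E] [Algebra K E]

lemma ev_derivative {x d : E} (h : IsWeyl x d) (P : K[X][X]) :
    ev x d (derivative P) = ev x d P * x - x * ev x d P := by
  have hp : ∀ i : ℕ, d ^ i * x = x * d ^ i + (i : E) * d ^ (i - 1) := by
    intro i; induction i with
    | zero => simp
    | succ i ih =>
      rw [pow_succ, mul_assoc, h, mul_add, ← mul_assoc, ih, mul_one, add_mul, mul_assoc]
      rcases i with _ | i
      · simp
      · simp only [Nat.add_sub_cancel, mul_assoc, ← pow_succ]; push_cast; noncomm_ring
  induction P using Polynomial.induction_on' with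
  | add P Q hP hQ => rw [map_add, map_add, hP, hQ, map_add]; noncomm_ring
  | monomial n a =>
    rw [derivative_monomial, ev_monomial, ev_monomial, mul_assoc, hp, map_mul, map_natCast, mul_add,
      ← mul_assoc, aeval_comm_self, mul_assoc, mul_assoc, add_sub_cancel_left]

/-- The values of the Hasse derivatives in `∂` are iterated commutators with `x`. -/
lemma ev_hasseDeriv_mem [CharZero K] {M : Type*} [AddCommGroup M] [Module K M]
    {x d : Module.End K M} (h : IsWeyl x d) {F G : Submodule K M} (hF : ∀ m ∈ F, x m ∈ F)
    (hG : ∀ m ∈ G, x m ∈ G) {P : K[X][X]} (hP : ∀ m ∈ F, ev x d P m ∈ G) (k : ℕ) :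
    ∀ m ∈ F, ev x d (hasseDeriv k P) m ∈ G := by
  induction k with
  | zero => simpa using hP
  | succ k ih =>
    intro m hm
    have e := LinearMap.congr_fun (hasseDeriv_comp (R := K[X]) 1 k) P
    rw [LinearMap.comp_apply, hasseDeriv_one, LinearMap.smul_apply, Nat.choose_one_right,
      add_comm 1 k] at e
    have e2 : ((k + 1 : ℕ) : K) • ev x d (hasseDeriv (k + 1) P) m ∈ G := by
      have e3 := congrArg (ev x d) e
      rw [ev_derivative h, map_nsmul] at e3
      have e4 := LinearMap.congr_fun e3 m
      rw [LinearMap.smul_apply] at e4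
      rw [Nat.cast_smul_eq_nsmul, ← e4, LinearMap.sub_apply, Module.End.mul_apply,
        Module.End.mul_apply]
      exact Submodule.sub_mem _ (ih _ (hF _ hm)) (hG _ (ih _ hm))
    exact (Submodule.smul_mem_iff _ (Nat.cast_ne_zero.2 (Nat.succ_ne_zero k))).1 e2

/-- A combination of Hasse derivatives acts as the operator with `∂` replaced by a shifted `∂`. -/
lemma ev_sum_hasseDeriv {x d D : E} {φ : ℕ → E} (hφ : ∀ k, φ k * x = x * φ k)
    (hd : ∀ i, d ^ i = ∑ k ∈ Finset.range (i + 1), i.choose k • (φ k * D ^ (i - k)))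
    {P : K[X][X]} {n : ℕ} (hn : P.natDegree ≤ n) :
    ev x d P = ∑ k ∈ Finset.range (n + 1), φ k * ev x D (hasseDeriv k P) := by
  have hc : ∀ k (a : K[X]), aeval x a * φ k = φ k * aeval x a := by
    intro k a
    induction a using Polynomial.induction_on with
    | C r => rw [aeval_C, Algebra.commutes]
    | add p q hp hq => rw [map_add, add_mul, mul_add, hp, hq]
    | monomial n r ih =>
      rw [pow_succ, ← mul_assoc, map_mul, aeval_X, mul_assoc, ← hφ, ← mul_assoc, ih, mul_assoc]
  conv_lhs => rw [P.as_sum_support]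
  simp only [hasseDeriv_apply, Polynomial.sum_def, map_sum, ev_monomial, Finset.mul_sum]
  rw [Finset.sum_comm]
  refine Finset.sum_congr rfl fun i hi => ?_
  have hi' := (le_natDegree_of_mem_supp i hi).trans hn
  rw [hd, Finset.mul_sum, Finset.sum_subset (Finset.range_mono (by omega : i + 1 ≤ n + 1))]
  · refine Finset.sum_congr rfl fun k _ => ?_
    rw [map_mul, map_natCast, mul_smul_comm, ← mul_assoc, hc, nsmul_eq_mul, ← mul_assoc,
      ← mul_assoc, (Nat.cast_commute (i.choose k) (φ k)).eq, mul_assoc (φ k), mul_assoc (φ k),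
      mul_assoc]
  · intro k _ hk
    rw [Nat.choose_eq_zero_of_lt (by simpa using hk), zero_smul, mul_zero]

end Ev

/-! ### The addition -/

/-- The operator `(x - c)ⁿ P(x, ∂ - f / (x - c))`, where `n` is the order of `P`. -/
def additionOp (c f : K) (P : K[X][X]) : K[X][X] :=
  ∑ k ∈ Finset.range (P.natDegree + 1),
    C (C ((descPochhammer K k).eval (-f)) * (X - C c) ^ (P.natDegree - k)) * hasseDeriv k P

/-- The addition multiplies the solutions by `(x - c)^f`, that is, it undoes the shift of `∂` by
`f / (x - c)`. -/
lemma ev_additionOp {E : Type*} [Ring E] [Algebra K E] {x d t τ : E} {c : K} (h : IsWeyl x d)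
    (hx : x = t + algebraMap K E c) (h1 : t * τ = 1) (h2 : τ * t = 1) (f : K) (P : K[X][X]) :
    ev x (d + f • τ) (additionOp c f P) = t ^ P.natDegree * ev x d P := by
  have ht : t = x - algebraMap K E c := by rw [hx]; abel
  have hdt : d * t = t * d + 1 := by
    rw [ht, mul_sub, sub_mul, h, Algebra.commutes]; noncomm_ring
  have hdτ : d * τ = τ * d - τ * τ := by
    have e1 : τ * (d * t) * τ = τ * (t * d + 1) * τ := by rw [hdt]
    have e2 : τ * (d * t) * τ = τ * d := by rw [mul_assoc, mul_assoc, h1, mul_one]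
    have e3 : τ * (t * d + 1) * τ = d * τ + τ * τ := by
      rw [mul_add, ← mul_assoc, h2, one_mul, mul_one, add_mul]
    rw [← e2, e1, e3]; abel
  have hτp : ∀ k : ℕ, d * τ ^ k = τ ^ k * d - (k : E) * τ ^ (k + 1) := by
    intro k; induction k with
    | zero => simp
    | succ k ih =>
      have e : τ ^ k * (τ * τ) = τ ^ (k + 1 + 1) := by rw [pow_succ, pow_succ, mul_assoc]
      rw [pow_succ, ← mul_assoc, ih, sub_mul, mul_assoc, hdτ, mul_sub, e, mul_assoc ((k : E)),
        ← pow_succ, ← mul_assoc]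
      push_cast; noncomm_ring
  have hxτ : τ * x = x * τ := by
    rw [hx, mul_add, add_mul, h1, h2, Algebra.commutes]
  have hp := add_pow_eq_sum (d := d + f • τ) (h := -(f • τ))
    (φ := fun k => (descPochhammer K k).eval (-f) • τ ^ k) (by simp) (by
      intro k
      have e : d + f • τ + -(f • τ) = d := by abel
      rw [e, mul_smul_comm, hτp, descPochhammer_succ_eval, smul_mul_assoc, mul_add, mul_smul_comm,
        ← pow_succ, ← nsmul_eq_mul, ← Nat.cast_smul_eq_nsmul K]
      module)
  have e : d + f • τ + -(f • τ) = d := by abel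
  rw [e] at hp
  rw [ev_sum_hasseDeriv (φ := fun k => (descPochhammer K k).eval (-f) • τ ^ k) (fun k => by
    rw [smul_mul_assoc, mul_smul_comm]; congr 1
    exact ((show Commute τ x from hxτ).pow_left k).eq) hp (le_refl P.natDegree), additionOp,
    map_sum, Finset.mul_sum]
  refine Finset.sum_congr rfl fun k hk => ?_
  have hk' : P.natDegree = (P.natDegree - k) + k := by have := Finset.mem_range.1 hk; omega
  have e3 : t ^ P.natDegree * τ ^ k = t ^ (P.natDegree - k) := by
    have hc : Commute t τ := by rw [Commute, SemiconjBy, h1, h2]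
    conv_lhs => rw [hk', pow_add, mul_assoc, ← hc.mul_pow, h1, one_pow, mul_one]
  rw [ev_C_mul, map_mul, aeval_C, map_pow, map_sub, aeval_X, aeval_C, ← ht, ← mul_assoc,
    mul_smul_comm, e3, ← Algebra.smul_def, smul_mul_assoc]

lemma coeff_additionOp (c f : K) (P : K[X][X]) :
    (additionOp c f P).natDegree ≤ P.natDegree ∧
    (additionOp c f P).coeff P.natDegree = (X - C c) ^ P.natDegree * P.coeff P.natDegree := by
  have := coeff_sum_hasseDeriv (fun k => C ((descPochhammer K k).eval (-f)) *
    (X - C c) ^ (P.natDegree - k)) (le_refl P.natDegree)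
  simpa [additionOp] using this

lemma natDegree_additionOp (c f : K) (P : K[X][X]) :
    (additionOp c f P).natDegree = P.natDegree := by
  by_cases hP : P = 0
  · subst hP; simp [additionOp]
  refine le_antisymm (coeff_additionOp c f P).1 (le_natDegree_of_ne_zero ?_)
  rw [(coeff_additionOp c f P).2]
  exact mul_ne_zero (pow_ne_zero _ (X_sub_C_ne_zero c)) (leadingCoeff_ne_zero.2 hP)

lemma leadingCoeff_additionOp (c f : K) (P : K[X][X]) :
    (additionOp c f P).leadingCoeff = (X - C c) ^ P.natDegree * P.leadingCoeff := by
  rw [leadingCoeff, natDegree_additionOp, (coeff_additionOp c f P).2, leadingCoeff]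

lemma additionOp_ne_zero (c f : K) {P : K[X][X]} (hP : P ≠ 0) : additionOp c f P ≠ 0 := by
  rw [← leadingCoeff_ne_zero, leadingCoeff_additionOp]
  exact mul_ne_zero (pow_ne_zero _ (X_sub_C_ne_zero c)) (leadingCoeff_ne_zero.2 hP)

lemma substD_additionOp (h : K[X]) (c f : K) (P : K[X][X]) :
    substD (fun b : K[X] => derivative b) h (additionOp c f P) =
      additionOp c f (substD (fun b : K[X] => derivative b) h P) := by
  rw [additionOp, additionOp, (natDegree_substD h P).1, substD_eq, map_sum, LinearMap.sum_apply]
  refine Finset.sum_congr rfl fun k _ => ?_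
  rw [← substD_eq, substD_C_mul, substD_hasseDeriv]

end

/-! ### Rational coefficients and reduced representatives -/

section

variable {K : Type*} [Field K]

local notation "ι" => algebraMap K[X] (RatFunc K)

lemma ι_ne_zero {p : K[X]} (hp : p ≠ 0) : ι p ≠ 0 :=
  (map_ne_zero_iff _ (RatFunc.algebraMap_injective K)).2 hp

/-- The quotient rule for arbitrary representatives. -/
lemma ratDeriv_div {p q : K[X]} (hq : q ≠ 0) :
    ratDeriv (ι p / ι q) = (ι (derivative p) * ι q - ι p * ι (derivative q)) / ι q ^ 2 := by
  set f := ι p / ι q with hf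
  have hD : ι f.denom ≠ 0 := ι_ne_zero f.denom_ne_zero
  have hq' := ι_ne_zero hq
  have h1 : f.num * q = p * f.denom := by
    apply RatFunc.algebraMap_injective K
    have := RatFunc.num_div_denom f
    rw [hf, div_eq_div_iff hD hq', ← hf] at this
    rw [map_mul, map_mul, this]
  have h2 := congrArg derivative h1
  rw [derivative_mul, derivative_mul] at h2
  have h1' := congrArg ι h1
  have h2' := congrArg ι h2
  simp only [map_mul, map_add] at h1' h2'
  rw [ratDeriv, div_eq_div_iff (pow_ne_zero _ hD) (pow_ne_zero _ hq')]
  linear_combination ι f.denom * ι q * h2' -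
    (ι (derivative f.denom) * ι q + ι (derivative q) * ι f.denom) * h1'

lemma ratDeriv_algebraMap (p : K[X]) : ratDeriv (ι p) = ι (derivative p) := by
  have := ratDeriv_div (p := p) (q := 1) one_ne_zero
  simpa using this

lemma ratDeriv_add (f g : RatFunc K) : ratDeriv (f + g) = ratDeriv f + ratDeriv g := by
  have hf := ι_ne_zero f.denom_ne_zero
  have hg := ι_ne_zero g.denom_ne_zero
  have h : f + g = ι (f.num * g.denom + g.num * f.denom) / ι (f.denom * g.denom) := by
    conv_lhs => rw [← RatFunc.num_div_denom f, ← RatFunc.num_div_denom g]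
    rw [map_add, map_mul, map_mul, map_mul]; field_simp
  rw [h, ratDeriv_div (mul_ne_zero f.denom_ne_zero g.denom_ne_zero), ratDeriv, ratDeriv]
  simp only [derivative_mul, map_add, map_mul]
  field_simp; ring

lemma ratDeriv_mul (f g : RatFunc K) : ratDeriv (f * g) = ratDeriv f * g + f * ratDeriv g := by
  have hf := ι_ne_zero f.denom_ne_zero
  have hg := ι_ne_zero g.denom_ne_zero
  have h : f * g = ι (f.num * g.num) / ι (f.denom * g.denom) := by
    conv_lhs => rw [← RatFunc.num_div_denom f, ← RatFunc.num_div_denom g]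
    rw [map_mul, map_mul]; field_simp
  conv_rhs => rw [← RatFunc.num_div_denom f, ← RatFunc.num_div_denom g]
  rw [h, ratDeriv_div (mul_ne_zero f.denom_ne_zero g.denom_ne_zero),
    ratDeriv_div f.denom_ne_zero, ratDeriv_div g.denom_ne_zero]
  simp only [derivative_mul, map_add, map_mul]
  field_simp; ring

/-- The derivation of the field of rational functions, as an additive map. -/
def ratDerivHom : RatFunc K →+ RatFunc K where
  toFun := ratDeriv
  map_zero' := by simpa using ratDeriv_algebraMap (0 : K[X])
  map_add' := ratDeriv_add

lemma toRat_injective : Function.Injective (toRat (K := K)) :=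
  map_injective _ (RatFunc.algebraMap_injective K)

lemma toRat_C_mul (a : K[X]) (P : K[X][X]) : toRat (C a * P) = C (ι a) * toRat P := by
  rw [toRat, Polynomial.map_mul, map_C]; rfl

lemma toRat_ne_zero {P : K[X][X]} (hP : P ≠ 0) : toRat P ≠ 0 := by
  intro h; exact hP (toRat_injective (by rw [h, toRat, Polynomial.map_zero]))

lemma natDegree_toRat (P : K[X][X]) : (toRat P).natDegree = P.natDegree :=
  natDegree_map_eq_of_injective (RatFunc.algebraMap_injective K) P

lemma toRat_hasseDeriv (k : ℕ) (P : K[X][X]) : toRat (hasseDeriv k P) = hasseDeriv k (toRat P) := by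
  ext1 m; simp [toRat, hasseDeriv_coeff]

lemma toRat_additionOp (c f : K) (P : K[X][X]) : toRat (additionOp c f P) =
    C (ι (X - C c) ^ P.natDegree) *
      Adei (RatFunc.C f / (RatFunc.X - RatFunc.C c)) (toRat P) := by
  set t : RatFunc K := ι (X - C c) with ht
  have ht' : (RatFunc.X - RatFunc.C c : RatFunc K) = t := by
    rw [ht, map_sub, RatFunc.algebraMap_X, RatFunc.algebraMap_C]
  have ht0 : t ≠ 0 := ι_ne_zero (X_sub_C_ne_zero c)
  have hδ : ∀ k : ℕ, ratDeriv (t⁻¹ ^ k) = -(k : RatFunc K) * t⁻¹ ^ (k + 1) := by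
    intro k
    have e : t⁻¹ ^ k = ι 1 / ι ((X - C c) ^ k) := by rw [map_one, map_pow, ← ht, inv_pow, one_div]
    rw [e, ratDeriv_div (pow_ne_zero _ (X_sub_C_ne_zero c)), derivative_one, map_zero, zero_mul,
      map_one, one_mul, derivative_X_sub_C_pow, map_mul, map_natCast, map_pow, map_pow, ← ht]
    rcases k with _ | k
    · simp
    · rw [Nat.add_sub_cancel, inv_pow]; field_simp; push_cast; ring
  have hC : ∀ a : K, ratDeriv (RatFunc.C a) = 0 := by
    intro a; rw [← RatFunc.algebraMap_C, ratDeriv_algebraMap, derivative_C, map_zero]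
  rw [ht', Adei]
  have key := substD_eq_sum (A := RatFunc K) (δ := ratDerivHom) ratDeriv_mul
    (h := -(RatFunc.C f / t))
    (φ := fun k => RatFunc.C ((descPochhammer K k).eval (-f)) * t⁻¹ ^ k) (by simp) (by
      intro k
      change _ = ratDeriv _ + _
      rw [ratDeriv_mul, hC, hδ, descPochhammer_succ_eval, RatFunc.C.map_mul, map_sub, map_neg, map_natCast,
        div_eq_mul_inv]
      ring) (P := toRat P) (n := P.natDegree) (natDegree_toRat P).le
  refine Eq.trans ?_ (congrArg _ key.symm)
  rw [additionOp, Finset.mul_sum, toRat, Polynomial.map_sum]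
  refine Finset.sum_congr rfl fun k hk => ?_
  have hk' : P.natDegree = (P.natDegree - k) + k := by have := Finset.mem_range.1 hk; omega
  change toRat _ = _
  rw [toRat_C_mul, toRat_hasseDeriv, ← mul_assoc, ← C_mul]
  congr 2
  have e3 : t ^ P.natDegree * t⁻¹ ^ k = t ^ (P.natDegree - k) := by
    conv_lhs => rw [hk', pow_add, mul_assoc, ← mul_pow, mul_inv_cancel₀ ht0, one_pow, mul_one]
  rw [map_mul, map_pow, ← ht, RatFunc.algebraMap_C, mul_left_comm, e3]

/-- The operators `P` and `Q` differ by left multiplication by a nonzero rational function, with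
the denominator cleared. -/
def Sim (P Q : K[X][X]) : Prop := ∃ u v : K[X], u ≠ 0 ∧ v ≠ 0 ∧ C u * P = C v * Q

lemma Sim.refl (P : K[X][X]) : Sim P P := ⟨1, 1, one_ne_zero, one_ne_zero, rfl⟩

lemma Sim.symm {P Q : K[X][X]} : Sim P Q → Sim Q P := fun ⟨u, v, hu, hv, h⟩ => ⟨v, u, hv, hu, h.symm⟩

lemma Sim.trans {P Q R : K[X][X]} : Sim P Q → Sim Q R → Sim P R :=
  fun ⟨u, v, hu, hv, h⟩ ⟨u', v', hu', hv', h'⟩ => ⟨u' * u, v * v', mul_ne_zero hu' hu,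
    mul_ne_zero hv hv', by
      rw [C_mul, C_mul, mul_assoc, h, mul_left_comm, h', mul_assoc]⟩

lemma sim_of_toRat {P Q : K[X][X]} {g : RatFunc K} (hP : P ≠ 0) (h : toRat P = C g * toRat Q) :
    Sim P Q := by
  have hg : g ≠ 0 := by
    rintro rfl; rw [C_0, zero_mul] at h; exact toRat_ne_zero hP h
  refine ⟨g.denom, g.num, g.denom_ne_zero, RatFunc.num_ne_zero hg, toRat_injective ?_⟩
  rw [toRat_C_mul, toRat_C_mul, h, ← mul_assoc, ← C_mul]
  congr 2
  have := RatFunc.num_div_denom g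
  rw [div_eq_iff (ι_ne_zero g.denom_ne_zero)] at this
  rw [this, mul_comm]

lemma equivalent_iff_sim {P Q : K[X][X]} (hP : P ≠ 0) : Equivalent P Q ↔ Sim P Q := by
  constructor
  · rintro ⟨g, _, h⟩; exact sim_of_toRat hP h
  · rintro ⟨u, v, hu, hv, h⟩
    refine ⟨ι v / ι u, div_ne_zero (ι_ne_zero hv) (ι_ne_zero hu), ?_⟩
    have h' := congrArg toRat h
    rw [toRat_C_mul, toRat_C_mul] at h'
    calc toRat P = C (ι u)⁻¹ * (C (ι u) * toRat P) := by
          rw [← mul_assoc, ← C_mul, inv_mul_cancel₀ (ι_ne_zero hu), C_1, one_mul]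
      _ = _ := by rw [h', ← mul_assoc, ← C_mul, div_eq_inv_mul]

lemma Sim.ne_zero {P Q : K[X][X]} (h : Sim P Q) (hQ : Q ≠ 0) : P ≠ 0 := by
  obtain ⟨u, v, hu, hv, h⟩ := h
  rintro rfl
  rw [mul_zero] at h
  exact mul_ne_zero (C_ne_zero.2 hv) hQ h.symm

lemma Sim.natDegree_eq {P Q : K[X][X]} (h : Sim P Q) : P.natDegree = Q.natDegree := by
  obtain ⟨u, v, hu, hv, h⟩ := h
  rw [← natDegree_C_mul hu, h, natDegree_C_mul hv]

lemma Sim.substD {P Q : K[X][X]} (h : Sim P Q) (p : K[X]) :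
    Sim (substD (fun b : K[X] => derivative b) p P) (substD (fun b : K[X] => derivative b) p Q) := by
  obtain ⟨u, v, hu, hv, h⟩ := h
  exact ⟨u, v, hu, hv, by rw [← substD_C_mul, h, substD_C_mul]⟩

/-- The coefficients of `P` have no common zero. -/
def Primitive (P : K[X][X]) : Prop := ∀ z, ∃ b, (P.coeff b).eval z ≠ 0

lemma IsReduced.primitive {R : (RatFunc K)[X]} {Q : K[X][X]} (h : IsReduced R Q) :
    Primitive Q := by
  intro z
  by_contra! hz
  obtain ⟨hQ, ⟨g, hg⟩, hmin⟩ := h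
  have hdvd : C (X - C z) ∣ Q := (C_dvd_iff_dvd_coeff _ _).2 fun b => dvd_iff_isRoot.2 (hz b)
  obtain ⟨Q', rfl⟩ := hdvd
  have hQ' : Q' ≠ 0 := right_ne_zero_of_mul hQ
  have := hmin Q' hQ' ⟨(ι (X - C z))⁻¹ * g, by
    rw [C_mul, mul_assoc, ← hg, toRat_C_mul, ← mul_assoc, ← C_mul,
      inv_mul_cancel₀ (ι_ne_zero (X_sub_C_ne_zero z)), C_1, one_mul]⟩
  rw [degX_C_mul (X_sub_C_ne_zero z) hQ', natDegree_X_sub_C] at this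
  omega

lemma reduced_spec {R : (RatFunc K)[X]} {Q : K[X][X]} {g : RatFunc K} (hQ : Q ≠ 0)
    (h : toRat Q = C g * R) : IsReduced R (reduced R) := by
  have hex : ∃ Q, IsReduced R Q := by
    obtain ⟨Q', hQ', hmin⟩ := (measure (degX (K := K))).wf.has_min
      {Q : K[X][X] | Q ≠ 0 ∧ ∃ g : RatFunc K, toRat Q = C g * R} ⟨Q, hQ, g, h⟩
    exact ⟨Q', hQ'.1, hQ'.2, fun Q'' h0 h1 => not_lt.1 (hmin Q'' ⟨h0, h1⟩)⟩
  rw [reduced, dif_pos hex]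
  exact hex.choose_spec

lemma reduced_toRat {P : K[X][X]} (hP : P ≠ 0) :
    Sim (reduced (toRat P)) P ∧ Primitive (reduced (toRat P)) := by
  have h := reduced_spec (g := 1) hP (by rw [C_1, one_mul] : toRat P = C 1 * toRat P)
  exact ⟨sim_of_toRat h.1 h.2.1.choose_spec, h.primitive⟩

/-- Up to the normalization, `RAd` is the polynomial operator `additionOp`. -/
lemma rAd_spec (c f : K) {P : K[X][X]} (hP : P ≠ 0) :
    Sim (RAd c f P) (additionOp c f P) ∧ Primitive (RAd c f P) := by
  have h0 := toRat_additionOp c f P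
  have h := reduced_spec (additionOp_ne_zero c f hP) h0
  refine ⟨?_, h.primitive⟩
  obtain ⟨g, hg⟩ := h.2.1
  have ht : (ι (X - C c) ^ P.natDegree : RatFunc K) ≠ 0 := pow_ne_zero _ (ι_ne_zero (X_sub_C_ne_zero c))
  refine sim_of_toRat (g := g * (ι (X - C c) ^ P.natDegree)⁻¹) h.1 ?_
  rw [RAd, hg, h0, ← mul_assoc, ← C_mul, mul_assoc, inv_mul_cancel₀ ht, mul_one]

end

/-! ### Formal series at finite points and at infinity -/

section

variable {K : Type*} [Field K]

/-- The weighted shift `eₙ ↦ w n eₙ₊ₛ` of the space with basis `eₙ`, `n ∈ ℤ`. -/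
def wshift (s : ℤ) (w : ℤ → K) : Module.End K (ℤ →₀ K) :=
  Finsupp.linearCombination K fun n => Finsupp.single (n + s) (w n)

lemma wshift_single (s : ℤ) (w : ℤ → K) (n : ℤ) (r : K) :
    wshift s w (Finsupp.single n r) = Finsupp.single (n + s) (r * w n) := by
  rw [wshift, Finsupp.linearCombination_single, Finsupp.smul_single, smul_eq_mul]

lemma end_ext {A B : Module.End K (ℤ →₀ K)}
    (h : ∀ n r, A (Finsupp.single n r) = B (Finsupp.single n r)) : A = B :=
  Finsupp.lhom_ext h

lemma wshift_mul (s t : ℤ) (w u : ℤ → K) :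
    wshift s w * wshift t u = wshift (s + t) fun n => u n * w (n + t) := by
  refine end_ext fun n r => ?_
  rw [Module.End.mul_apply, wshift_single, wshift_single, wshift_single, mul_assoc, add_assoc,
    add_comm t s]

lemma wshift_one : wshift 0 (fun _ => (1 : K)) = 1 :=
  end_ext fun n r => by rw [wshift_single, add_zero, mul_one]; rfl

lemma wshift_add (s : ℤ) (w u : ℤ → K) :
    wshift s w + wshift s u = wshift s fun n => w n + u n :=
  end_ext fun n r => by
    rw [LinearMap.add_apply, wshift_single, wshift_single, wshift_single, ← Finsupp.single_add,
      mul_add]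

lemma smul_wshift (a : K) (s : ℤ) (w : ℤ → K) : a • wshift s w = wshift s fun n => a * w n :=
  end_ext fun n r => by
    rw [LinearMap.smul_apply, wshift_single, wshift_single, Finsupp.smul_single, smul_eq_mul]
    congr 1; ring

lemma wshift_apply (s : ℤ) (w : ℤ → K) (f : ℤ →₀ K) (n : ℤ) :
    wshift s w f n = f (n - s) * w (n - s) := by
  induction f using Finsupp.induction_linear with
  | zero => simp
  | add f g hf hg => rw [map_add, Finsupp.add_apply, hf, hg, Finsupp.add_apply, add_mul]
  | single m r =>
    rw [wshift_single, Finsupp.single_apply, Finsupp.single_apply]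
    by_cases h : m = n - s
    · rw [if_pos h, if_pos (by omega), h]
    · rw [if_neg h, if_neg (by omega), zero_mul]

/-- The span of the basis vectors `eₙ` with `k ≤ n`. Finite sums suffice in place of power series, as
only the mapping properties of operators with respect to this filtration matter. -/
def F (k : ℤ) : Submodule K (ℤ →₀ K) := Finsupp.supported K K (Set.Ici k)

lemma mem_F {k : ℤ} {f : ℤ →₀ K} : f ∈ F k ↔ ∀ n < k, f n = 0 := by
  rw [F, Finsupp.mem_supported']; simp

lemma F_anti {k l : ℤ} (h : k ≤ l) : (F l : Submodule K (ℤ →₀ K)) ≤ F k :=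
  fun _ hf => mem_F.2 fun n hn => mem_F.1 hf n (hn.trans_le h)

lemma single_mem_F {k n : ℤ} (h : k ≤ n) (r : K) : Finsupp.single n r ∈ F (K := K) k :=
  mem_F.2 fun m hm => Finsupp.single_eq_of_ne (by omega)

lemma exists_mem_F (f : ℤ →₀ K) : ∃ k, f ∈ F k := by
  induction f using Finsupp.induction_linear with
  | zero => exact ⟨0, Submodule.zero_mem _⟩
  | add f g hf hg =>
    obtain ⟨k, hk⟩ := hf
    obtain ⟨l, hl⟩ := hg
    exact ⟨min k l, Submodule.add_mem _ (F_anti (min_le_left _ _) hk) (F_anti (min_le_right _ _) hl)⟩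
  | single n r => exact ⟨n, single_mem_F le_rfl r⟩

lemma map_F_le {A : Module.End K (ℤ →₀ K)} {k : ℤ} {N : Submodule K (ℤ →₀ K)}
    (h : ∀ n, k ≤ n → A (Finsupp.single n 1) ∈ N) {f : ℤ →₀ K} (hf : f ∈ F k) : A f ∈ N := by
  rw [← Finsupp.sum_single f, Finsupp.sum, map_sum]
  refine Submodule.sum_mem _ fun n hn => ?_
  have hkn : k ≤ n := by
    by_contra hlt
    exact Finsupp.mem_support_iff.1 hn (mem_F.1 hf n (by omega))
  have : Finsupp.single n (f n) = f n • Finsupp.single n (1 : K) := by simp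
  rw [this, map_smul]
  exact Submodule.smul_mem _ _ (h n hkn)

lemma wshift_mem {s : ℤ} {w : ℤ → K} {k : ℤ} {f : ℤ →₀ K} (hf : f ∈ F k) :
    wshift s w f ∈ F (k + s) :=
  mem_F.2 fun n hn => by rw [wshift_apply, mem_F.1 hf _ (by omega), zero_mul]

/-- The shift `eₙ ↦ eₙ₊₁`: multiplication by a local coordinate. -/
def S : Module.End K (ℤ →₀ K) := wshift 1 fun _ => 1

/-- The inverse shift `eₙ ↦ eₙ₋₁`. -/
def S' : Module.End K (ℤ →₀ K) := wshift (-1) fun _ => 1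

/-- The derivation `∂` at a finite point; the basis vector `eₙ` stands for `x ^ (ρ + n)`, and `x`
acts as `S`. -/
def Y (ρ : K) : Module.End K (ℤ →₀ K) := wshift (-1) fun n => ρ + n

/-- The derivation `∂` at infinity; the basis vector `eₙ` stands for `x ^ (-μ - n)`, and `x` acts as
`S'`. -/
def D (μ : K) : Module.End K (ℤ →₀ K) := wshift 1 fun n => -(μ + n)

lemma S_mul_S' : S * S' = (1 : Module.End K (ℤ →₀ K)) := by
  rw [S, S', wshift_mul, ← wshift_one]; simp

lemma S'_mul_S : S' * S = (1 : Module.End K (ℤ →₀ K)) := by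
  rw [S, S', wshift_mul, ← wshift_one]; simp

lemma isWeyl_fin (ρ : K) : IsWeyl S (Y ρ) := by
  rw [IsWeyl, S, Y, wshift_mul, wshift_mul, ← wshift_one]
  norm_num only
  rw [wshift_add]; congr 1; funext n; push_cast; ring

lemma isWeyl_inf (μ : K) : IsWeyl S' (D μ) := by
  rw [IsWeyl, S', D, wshift_mul, wshift_mul, ← wshift_one]
  norm_num only
  rw [wshift_add]; congr 1; funext n; push_cast; ring

lemma S_mem {k : ℤ} {f : ℤ →₀ K} (hf : f ∈ F k) : S f ∈ F (k + 1) := wshift_mem hf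

lemma S'_mem {k : ℤ} {f : ℤ →₀ K} (hf : f ∈ F k) : S' f ∈ F (k - 1) := wshift_mem hf

lemma Y_mem {ρ : K} {k : ℤ} {f : ℤ →₀ K} (hf : f ∈ F k) : Y ρ f ∈ F (k - 1) := wshift_mem hf

lemma D_mem {μ : K} {k : ℤ} {f : ℤ →₀ K} (hf : f ∈ F k) : D μ f ∈ F (k + 1) := wshift_mem hf

lemma F_neg_mono : Monotone fun j : ℤ => F (K := K) (-j) := fun _ _ h => F_anti (by omega)

lemma ev_fin_mem {ρ : K} {k j : ℤ} {P : K[X][X]} (hP : P ∈ filt (-1) 1 k) {f : ℤ →₀ K}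
    (hf : f ∈ F j) : ev S (Y ρ) P f ∈ F (j - k) := by
  have := ev_mem_of_filt (F := fun j : ℤ => F (K := K) (-j)) F_neg_mono (x := S) (d := Y ρ) (p := -1)
    (q := 1) (fun j m hm => F_anti (by omega) (S_mem hm)) (fun j m hm => F_anti (by omega) (Y_mem hm))
    hP (j := -j) (m := f) (by simpa using hf)
  exact F_anti (by omega) this

lemma ev_inf_mem {μ : K} {k j : ℤ} {P : K[X][X]} (hP : P ∈ filt 1 (-1) k) {f : ℤ →₀ K}
    (hf : f ∈ F j) : ev S' (D μ) P f ∈ F (j - k) := by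
  have := ev_mem_of_filt (F := fun j : ℤ => F (K := K) (-j)) F_neg_mono (x := S') (d := D μ) (p := 1)
    (q := -1) (fun j m hm => F_anti (by omega) (S'_mem hm))
    (fun j m hm => F_anti (by omega) (D_mem hm)) hP (j := -j) (m := f) (by simpa using hf)
  exact F_anti (by omega) this

/-- `P` has at infinity `s` exponents of slope `0`, among them those of the blocks `L`: `P` maps
`x^(-μ) K[[1/x]]` to `x^(D - s - m - μ) K[[1/x]]` for each block `[μ]_m`, where `D` is the degree of
`P` in `x`. -/
structure InfExp (s : ℕ) (R : K[X][X]) (L : List (K × ℕ)) : Prop where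
  diag : R ∈ filt 1 (-1) ((degX R : ℤ) - s)
  lead : (R.coeff s).coeff (degX R) ≠ 0
  blocks : ∀ b ∈ L, 0 < b.2 → ∀ f ∈ F 0, ev S' (D b.1) R f ∈ F ((b.2 : ℤ) + s - degX R)

/-- `P` has a regular singularity at `0` with the exponents of the blocks `L`, and its leading
coefficient vanishes there to the order `v`: `P` maps `x^ρ K[[x]]` to `x^(ρ + m + v - n) K[[x]]` for
each block `[ρ]_m`, where `n` is the order of `P`. -/
structure FinExp (v : ℕ) (P : K[X][X]) (L : List (K × ℕ)) : Prop where
  diag : P ∈ filt (-1) 1 ((P.natDegree : ℤ) - v)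
  lead : (P.coeff P.natDegree).coeff v ≠ 0
  blocks : ∀ b ∈ L, 0 < b.2 → ∀ f ∈ F 0, ev S (Y b.1) P f ∈ F ((b.2 : ℤ) + v - P.natDegree)

lemma ne_zero_of_coeff {P : K[X][X]} {a b : ℕ} (h : (P.coeff b).coeff a ≠ 0) : P ≠ 0 := by
  rintro rfl; simp at h

/-! ### The transform interchanges the exponents at infinity and at the origin -/

lemma exists_mul_recursion (a : ℤ → K) (ha : ∀ n, a n ≠ 0) :
    ∃ g : ℤ → K, (∀ n, g n ≠ 0) ∧ ∀ n, g (n + 1) = a n * g n := by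
  refine ⟨fun n => (∏ i ∈ Finset.range n.toNat, a i) *
    ∏ i ∈ Finset.range (-n).toNat, (a (-(i + 1)))⁻¹, fun n => mul_ne_zero ?_ ?_, fun n => ?_⟩
  · exact Finset.prod_ne_zero_iff.2 fun i _ => ha _
  · exact Finset.prod_ne_zero_iff.2 fun i _ => inv_ne_zero (ha _)
  · rcases le_or_gt 0 n with h | h
    · have e1 : (n + 1).toNat = n.toNat + 1 := by omega
      have e2 : (-n).toNat = 0 := by omega
      have e3 : (-(n + 1)).toNat = 0 := by omega
      have e4 : ((n.toNat : ℕ) : ℤ) = n := by omega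
      beta_reduce
      rw [e1, e2, e3, Finset.prod_range_succ, e4]; ring
    · have e1 : (-n).toNat = (-(n + 1)).toNat + 1 := by omega
      have e2 : n.toNat = 0 := by omega
      have e3 : (n + 1).toNat = 0 := by omega
      have e4 : -((((-(n + 1)).toNat : ℕ) : ℤ) + 1) = n := by omega
      beta_reduce
      rw [e1, e2, e3, Finset.prod_range_succ, e4]
      have := ha n
      field_simp

/-- Conjugation by an invertible diagonal map respects the mapping properties of operators. -/
lemma ev_diag_iff {g : ℤ → K} (hg : ∀ n, g n ≠ 0) {x d x' d' : Module.End K (ℤ →₀ K)}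
    (hx : wshift 0 g * x = x' * wshift 0 g) (hd : wshift 0 g * d = d' * wshift 0 g)
    (P : K[X][X]) (k e : ℤ) :
    (∀ f ∈ F k, ev x d P f ∈ F e) ↔ ∀ f ∈ F k, ev x' d' P f ∈ F e := by
  set G : Module.End K (ℤ →₀ K) := wshift 0 g
  set G' : Module.End K (ℤ →₀ K) := wshift 0 fun n => (g n)⁻¹
  have hG1 : ∀ f, G (G' f) = f := by
    intro f
    have : G * G' = 1 := by
      rw [wshift_mul, ← wshift_one]; congr 1; funext n; simp [hg]
    exact LinearMap.congr_fun this f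
  have hG2 : ∀ f, G' (G f) = f := by
    intro f
    have : G' * G = 1 := by
      rw [wshift_mul, ← wshift_one]; congr 1; funext n; simp [hg]
    exact LinearMap.congr_fun this f
  have hG : ∀ {l : ℤ} {f}, f ∈ F l → G f ∈ F l := fun h => by simpa using wshift_mem (s := 0) h
  have hG' : ∀ {l : ℤ} {f}, f ∈ F l → G' f ∈ F l := fun h => by simpa using wshift_mem (s := 0) h
  have key : ∀ f, G (ev x d P f) = ev x' d' P (G f) :=
    ev_intertwine G (fun m => LinearMap.congr_fun hx m) (fun m => LinearMap.congr_fun hd m) P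
  constructor
  · intro h f hf
    rw [← hG1 f, ← key]; exact hG (h _ (hG' hf))
  · intro h f hf
    rw [← hG2 (ev x d P f), key]; exact hG' (h _ (hG hf))

/-- The formal Borel transform `x^(-μ-n) ↦ x^(μ-1+n) / Γ(μ+n)`, which makes sense for `μ` not an
integer, carries the exponent `μ` at infinity to the exponent `μ - 1` at the origin. -/
lemma ev_four_iff {ε : K} (hε : ε * ε = 1) {μ : K} (hμ : NotInt μ) (R : K[X][X]) (e : ℤ) :
    (∀ f ∈ F 0, ev S' (D μ) R f ∈ F e) ↔ ∀ f ∈ F 0, ev S (Y (μ - 1)) (four ε R) f ∈ F e := by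
  have hμ' : ∀ n : ℤ, μ + n ≠ 0 := fun n h => hμ (-n) (by
    push_cast; exact eq_neg_of_add_eq_zero_left h)
  have hε0 : ε ≠ 0 := ne_zero_of_mul_self_eq_one hε
  obtain ⟨g, hg, hrec⟩ := exists_mul_recursion (fun n : ℤ => ε * (μ + n)⁻¹)
    fun n => mul_ne_zero hε0 (inv_ne_zero (hμ' n))
  rw [ev_four (isWeyl_fin (μ - 1))]
  refine ev_diag_iff hg ?_ ?_ R 0 e
  · rw [S', Y, smul_wshift, wshift_mul, wshift_mul]
    norm_num only
    congr 1; funext n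
    have h1 := hrec (n + (-1))
    rw [neg_add_cancel_right] at h1
    have h2 := hμ' (n + (-1))
    rw [h1]
    push_cast at h2 ⊢
    field_simp
    linear_combination (-(μ + n - 1) * g (n + -1)) * hε
  · have : -(ε • (S : Module.End K (ℤ →₀ K))) = wshift 1 fun _ => -ε := by
      refine end_ext fun n r => ?_
      rw [LinearMap.neg_apply, LinearMap.smul_apply, S, wshift_single, wshift_single,
        Finsupp.smul_single, ← Finsupp.single_neg, smul_eq_mul]
      congr 1; ring
    rw [this, D, wshift_mul, wshift_mul]
    norm_num only
    congr 1; funext n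
    rw [hrec]
    have h2 := hμ' n
    field_simp

lemma filt_four_iff {ε : K} (hε : ε * ε = 1) {p q k : ℤ} (hpq : 0 ≤ p + q) {R : K[X][X]} :
    four ε R ∈ filt q p k ↔ R ∈ filt p q k := by
  refine ⟨fun h => ?_, four_mem hpq ε⟩
  have := four_mem (p := q) (q := p) (by omega) (-ε) h
  rwa [four_four hε] at this

lemma infExp_iff_finExp {ε : K} (hε : ε * ε = 1) {s : ℕ} {R : K[X][X]} (hR : R ≠ 0)
    {L : List (K × ℕ)} (hL : ∀ b ∈ L, 0 < b.2 → NotInt b.1) :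
    InfExp s R L ↔ FinExp s (four ε R) (shift (-1) L) := by
  have hn := natDegree_four (ne_zero_of_mul_self_eq_one hε) hR
  have h1 := filt_four_iff hε (p := 1) (q := -1) (k := (degX R : ℤ) - s) (by norm_num) (R := R)
  have h2 := coeff_four ε (mem_filt_self R) s
  have hε0 := ne_zero_of_mul_self_eq_one hε
  have h3 : ε ^ degX R * (-ε) ^ s ≠ 0 :=
    mul_ne_zero (pow_ne_zero _ hε0) (pow_ne_zero _ (neg_ne_zero.2 hε0))
  constructor
  · intro h
    refine ⟨by rw [hn]; exact h1.2 h.diag, by rw [hn, h2]; exact mul_ne_zero h3 h.lead, ?_⟩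
    intro b hb hpos
    obtain ⟨b', hb', rfl⟩ := List.mem_map.1 hb
    rw [hn]
    have := (ev_four_iff hε (hL b' hb' hpos) R _).1 (h.blocks b' hb' hpos)
    rwa [sub_eq_add_neg b'.1] at this
  · intro h
    refine ⟨h1.1 (by rw [← hn]; exact h.diag), ?_, ?_⟩
    · have := h.lead
      rw [hn, h2] at this
      exact right_ne_zero_of_mul this
    · intro b hb hpos
      have := h.blocks (b.1 + -1, b.2) (List.mem_map.2 ⟨b, hb, rfl⟩) hpos
      rw [hn, ← sub_eq_add_neg] at this
      exact (ev_four_iff hε (hL b hb hpos) R _).2 this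

end

/-! ### Substitutions `x ↦ x + b ∂ + c` -/

section

variable {K : Type*} [Field K]

section Shear

variable {E E' : Type*} [Ring E] [Algebra K E] [Ring E'] [Algebra K E']

lemma map_ev (φ : E →+* E') (hφ : ∀ k : K, φ (algebraMap K E k) = algebraMap K E' k) (x d : E)
    (P : K[X][X]) : φ (ev x d P) = ev (φ x) (φ d) P := by
  simp only [ev_expand, map_sum, Algebra.smul_def, map_mul, map_pow, hφ]

/-- A derivation that vanishes at `x` and `d` vanishes at the operators in `x` and `d`. -/
lemma derivation_ev_eq_zero {δ : E →+ E} (hδ : ∀ u v, δ (u * v) = δ u * v + u * δ v)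
    (hK : ∀ k : K, δ (algebraMap K E k) = 0) {x d : E} (hx : δ x = 0) (hd : δ d = 0)
    (P : K[X][X]) : δ (ev x d P) = 0 := by
  have h1 : ∀ u : E, δ u = 0 → ∀ n : ℕ, δ (u ^ n) = 0 := by
    intro u hu n
    induction n with
    | zero => rw [pow_zero, ← map_one (algebraMap K E), hK]
    | succ n ih => rw [pow_succ, hδ, ih, hu, zero_mul, mul_zero, add_zero]
  simp only [ev_expand, map_sum, Algebra.smul_def, hδ, hK, h1 x hx, h1 d hd, zero_mul, mul_zero,
    add_zero, Finset.sum_const_zero]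

/-- The coefficients of the family `P(x + t z, ∂)`, where `z = [Z, x]` and `Z` commutes with `z` and
`∂`, are iterated commutators of `P(x, ∂)` with `Z`, up to factorials. -/
lemma exists_coeff_family {x d z Z : E} (hZx : Z * x = x * Z + z) (hZz : Z * z = z * Z)
    (hZd : Z * d = d * Z) (P : K[X][X]) :
    ∃ f : E[X], f.coeff 0 = ev x d P ∧ f.eval 1 = ev (x + z) d P ∧
      ∀ k, f.coeff (k + 1) * (k + 1) = Z * f.coeff k - f.coeff k * Z := by
  have hA : ∀ k : K, algebraMap K E[X] k = C (algebraMap K E k) := fun _ => rfl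
  refine ⟨ev (C x + X * C z) (C d) P, ?_, ?_, fun k => ?_⟩
  · rw [← constantCoeff_apply, map_ev (constantCoeff : E[X] →+* E)
      (fun k => by rw [hA, constantCoeff_apply, coeff_C_zero])]
    simp
  · let φ : E[X] →+* E := eval₂RingHom' (RingHom.id E) 1 fun a => Commute.one_right a
    have hφ : ∀ f : E[X], φ f = f.eval 1 := fun f => rfl
    rw [← hφ, map_ev φ (fun k => by rw [hA, hφ, eval_C]), hφ, hφ, eval_C]
    congr 2
    rw [X_mul, eval_add, eval_C, eval_mul_X, eval_C, mul_one]
  · let δ : E[X] →+ E[X] := (derivative (R := E)).toAddMonoidHom -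
      (AddMonoidHom.mulLeft (C Z) - AddMonoidHom.mulRight (C Z))
    have hδ : ∀ u, δ u = derivative u - (C Z * u - u * C Z) := fun _ => rfl
    have h0 := derivation_ev_eq_zero (K := K) (δ := δ) (fun u v => by
        simp only [hδ, derivative_mul]; noncomm_ring)
      (fun k => by
        rw [hδ, hA, derivative_C, ← C_mul, ← C_mul, Algebra.commutes]; simp)
      (x := C x + X * C z) (d := C d) (by
        simp only [hδ, derivative_add, derivative_mul, derivative_C, derivative_X, mul_add, add_mul]
        rw [← C_mul, hZx, ← mul_assoc, ← X_mul, mul_assoc, ← C_mul, hZz, mul_assoc, ← C_mul]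
        simp)
      (by rw [hδ, derivative_C, ← C_mul, ← C_mul, hZd]; simp) P
    rw [hδ, sub_eq_zero] at h0
    have h1 := congrArg (fun f => f.coeff k) h0
    simpa only [coeff_derivative, coeff_sub, coeff_C_mul, coeff_mul_C] using h1

end Shear

/-- The substitution `x ↦ x + b ∂ + c` preserves the mapping properties of operators. -/
lemma ev_add_mem [CharZero K] {M : Type*} [AddCommGroup M] [Module K M] {x d : Module.End K M}
    (h : IsWeyl x d) (b c : K) {U G : Submodule K M} (hU : ∀ m ∈ U, d m ∈ U) (hG : ∀ m ∈ G, d m ∈ G)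
    {P : K[X][X]} (hP : ∀ m ∈ U, ev x d P m ∈ G) :
    ∀ m ∈ U, ev (x + (b • d + c • 1)) d P m ∈ G := by
  set Z : Module.End K M := (b / 2) • (d * d) + c • d with hZ
  have h2 : (2 : K) ≠ 0 := two_ne_zero
  have hddx : d * d * x = x * (d * d) + (2 : K) • d := by
    rw [mul_assoc, h, mul_add, ← mul_assoc, h, add_mul, mul_one, mul_assoc, one_mul]
    module
  obtain ⟨f, h0, h1, hf⟩ := exists_coeff_family (K := K) (x := x) (d := d) (z := b • d + c • 1) (Z := Z)
    (by
      rw [hZ, add_mul, mul_add, smul_mul_assoc, smul_mul_assoc, hddx, h, mul_smul_comm,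
        mul_smul_comm, smul_add, smul_smul, div_mul_cancel₀ _ h2, smul_add]
      module)
    (by
      rw [hZ]
      simp only [add_mul, mul_add, smul_mul_smul_comm, mul_one, one_mul, mul_assoc]
      module)
    (by
      rw [hZ]
      simp only [add_mul, mul_add, smul_mul_assoc, mul_smul_comm, mul_assoc]) P
  have hZm : ∀ N : Submodule K M, (∀ m ∈ N, d m ∈ N) → ∀ m ∈ N, Z m ∈ N := by
    intro N hN m hm
    rw [hZ, LinearMap.add_apply, LinearMap.smul_apply, LinearMap.smul_apply, Module.End.mul_apply]
    exact N.add_mem (N.smul_mem _ (hN _ (hN _ hm))) (N.smul_mem _ (hN _ hm))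
  have hk : ∀ k, ∀ m ∈ U, f.coeff k m ∈ G := by
    intro k
    induction k with
    | zero => rw [h0]; exact hP
    | succ k ih =>
      intro m hm
      have e : ((k + 1 : ℕ) : K) • f.coeff (k + 1) m ∈ G := by
        have e1 := LinearMap.congr_fun (hf k) m
        have e2 : (f.coeff (k + 1) * (k + 1)) m = ((k + 1 : ℕ) : K) • f.coeff (k + 1) m := by
          have : ((k : Module.End K M) + 1) = ((k + 1 : ℕ) : K) • 1 := by
            rw [Nat.cast_smul_eq_nsmul, nsmul_eq_mul]; simp
          rw [this, mul_smul_comm, mul_one, LinearMap.smul_apply]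
        rw [← e2, e1, LinearMap.sub_apply, Module.End.mul_apply, Module.End.mul_apply]
        exact G.sub_mem (hZm G hG _ (ih _ hm)) (ih _ (hZm U hU _ hm))
      exact (Submodule.smul_mem_iff _ (Nat.cast_ne_zero.2 (Nat.succ_ne_zero k))).1 e
  intro m hm
  rw [← h1, eval_eq_sum_range, LinearMap.sum_apply]
  refine Submodule.sum_mem _ fun k _ => ?_
  rw [one_pow, mul_one]
  exact hk k m hm

/-! ### Operations that preserve exponents -/

section Exponents

/-- Shears preserve the exponents at infinity: the dilation acts diagonally on the series, and the
substitution `x ↦ x + b ∂ + c` is covered by `ev_add_mem`. -/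
lemma InfExp.shear [CharZero K] {s : ℕ} {R : K[X][X]} {L : List (K × ℕ)}
    (h : InfExp s R L) {a : K} (ha : a ≠ 0) (b c : K) : InfExp s (shear a b c R) L := by
  have hR := ne_zero_of_coeff h.lead
  have hD := degX_shear ha b c hR
  refine ⟨by rw [hD]; exact shear_mem le_rfl (by norm_num) a b c h.diag, ?_, ?_⟩
  · rw [hD, coeff_shear a b c (mem_filt_self R)]
    exact mul_ne_zero (mul_ne_zero (pow_ne_zero _ ha) (pow_ne_zero _ (inv_ne_zero ha))) h.lead
  · intro β hβ hpos
    have hw : IsWeyl (a • S') (a⁻¹ • D β.1) := by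
      have := isWeyl_inf β.1
      rw [IsWeyl] at this ⊢
      rw [smul_mul_smul_comm, smul_mul_smul_comm, this, inv_mul_cancel₀ ha, mul_inv_cancel₀ ha,
        one_smul, one_smul]
    have h1 : ∀ f ∈ F 0, ev (a • S') (a⁻¹ • D β.1) R f ∈ F ((β.2 : ℤ) + s - degX R) := by
      refine (ev_diag_iff (g := fun n => a ^ (-n)) (fun n => zpow_ne_zero _ ha) ?_ ?_ R 0 _).1
        (h.blocks β hβ hpos)
      · rw [S', smul_wshift, wshift_mul, wshift_mul]
        norm_num only
        congr 1; funext n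
        rw [one_mul, mul_one, neg_add, neg_neg, zpow_add₀ ha, zpow_one]
      · rw [D, smul_wshift, wshift_mul, wshift_mul]
        norm_num only
        congr 1; funext n
        rw [show -(n + 1) = -n + -1 by ring, zpow_add₀ ha, zpow_neg_one, add_zero]; ring
    rw [hD, ev_shear (isWeyl_inf β.1)]
    have h2 := ev_add_mem hw (b * a) c
      (fun m hm => Submodule.smul_mem _ _ (F_anti (by omega) (D_mem hm)))
      (fun m hm => Submodule.smul_mem _ _ (F_anti (by omega) (D_mem hm))) h1
    rwa [smul_smul, mul_assoc, mul_inv_cancel₀ ha, mul_one] at h2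

lemma filt_hasseDeriv {p q k : ℤ} {P : K[X][X]} (hP : P ∈ filt p q k) (j : ℕ) :
    hasseDeriv j P ∈ filt p q (k - q * j) := by
  intro a b h
  rw [hasseDeriv_coeff, ← C_eq_natCast, coeff_C_mul,
    hP a (b + j) (by push_cast; linarith), mul_zero]

lemma C_mul_mem_filt {q k l : ℤ} {u : K[X]} (hu : (u.natDegree : ℤ) ≤ l) {P : K[X][X]}
    (hP : P ∈ filt 1 q k) : C u * P ∈ filt 1 q (l + k) := by
  rw [mem_filt_one] at *
  intro b hb
  rw [coeff_C_mul] at hb ⊢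
  have h1 := hP b (right_ne_zero_of_mul hb)
  have h2 := natDegree_mul_le (p := u) (q := P.coeff b)
  zify at h2; linarith

lemma C_mul_mem_filt_neg {k : ℤ} (u : K[X]) {P : K[X][X]} (hP : P ∈ filt (-1) 1 k) :
    C u * P ∈ filt (-1) 1 k := by
  intro a b h
  rw [coeff_C_mul, coeff_mul]
  refine Finset.sum_eq_zero fun ij hij => ?_
  have := Finset.HasAntidiagonal.mem_antidiagonal.1 hij
  rw [hP ij.2 b (by omega), mul_zero]

lemma C_mul_X_pow_mem_filt_neg {k : ℤ} (u : K[X]) (j : ℕ) {P : K[X][X]}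
    (hP : P ∈ filt (-1) 1 k) : C (u * X ^ j) * P ∈ filt (-1) 1 (k - j) := by
  rw [C_mul, mul_assoc]
  refine C_mul_mem_filt_neg u ?_
  intro a b h
  rw [coeff_C_mul, coeff_X_pow_mul']
  split_ifs with hj
  · exact hP _ _ (by push_cast [Nat.cast_sub hj]; omega)
  · rfl

lemma additionOp_mem_filt {q k : ℤ} (hq : -1 ≤ q) (c f : K) {P : K[X][X]} (hP : P ∈ filt 1 q k) :
    additionOp c f P ∈ filt 1 q (P.natDegree + k) := by
  refine Submodule.sum_mem _ fun j hj => ?_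
  have hj' := Finset.mem_range.1 hj
  have h1 := filt_hasseDeriv hP j
  have h2 := C_mul_mem_filt (u := C ((descPochhammer K j).eval (-f)) * (X - C c) ^ (P.natDegree - j))
    (l := P.natDegree - j) (by
      have := natDegree_C_mul_le ((descPochhammer K j).eval (-f)) ((X - C c) ^ (P.natDegree - j))
      rw [natDegree_pow, natDegree_X_sub_C, mul_one] at this
      omega) h1
  refine filt_mono 1 q ?_ h2
  have : 0 ≤ (1 + q) * j := mul_nonneg (by omega) (by omega)
  linarith

/-- The addition multiplies the terms of highest degree in `x` by `xⁿ`. -/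
lemma coeff_additionOp_degX (c f : K) (P : K[X][X]) (b : ℕ) :
    ((additionOp c f P).coeff b).coeff (P.natDegree + degX P) = (P.coeff b).coeff (degX P) := by
  rw [additionOp, finsetSum_coeff, finsetSum_coeff, Finset.sum_eq_single 0]
  · have h1 : ((X - C c) ^ P.natDegree).natDegree = P.natDegree := by
      rw [natDegree_pow, natDegree_X_sub_C, mul_one]
    have := coeff_coeff_C_mul (u := (X - C c) ^ P.natDegree) (mem_filt_self P) b
    rw [h1, (monic_X_sub_C c).pow _, one_mul] at this
    simpa using this
  · intro j hj h0
    have hj' := Finset.mem_range.1 hj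
    refine C_mul_mem_filt (u := C ((descPochhammer K j).eval (-f)) * (X - C c) ^ (P.natDegree - j))
      (l := P.natDegree - j) ?_ (filt_hasseDeriv (mem_filt_self P) j) _ _ ?_
    · have := natDegree_C_mul_le ((descPochhammer K j).eval (-f)) ((X - C c) ^ (P.natDegree - j))
      rw [natDegree_pow, natDegree_X_sub_C, mul_one] at this
      omega
    · push_cast; omega
  · simp

lemma degX_additionOp (c f : K) {P : K[X][X]} (hP : P ≠ 0) :
    degX (additionOp c f P) = P.natDegree + degX P := by
  obtain ⟨b, hb⟩ := exists_coeff_degX hP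
  refine degX_eq_of_mem (b := b) ?_ (by rwa [coeff_additionOp_degX])
  exact_mod_cast additionOp_mem_filt (by norm_num) c f (mem_filt_self P)

lemma S'_pow_mem {k : ℤ} {f : ℤ →₀ K} (n : ℕ) (hf : f ∈ F k) : (S' ^ n) f ∈ F (k - n) := by
  induction n with
  | zero => simpa using hf
  | succ n ih =>
    rw [pow_succ', Module.End.mul_apply]
    exact F_anti (by push_cast; omega) (S'_mem ih)

lemma S_pow_mem {k : ℤ} {f : ℤ →₀ K} (n : ℕ) (hf : f ∈ F k) : (S ^ n) f ∈ F (k + n) := by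
  induction n with
  | zero => simpa using hf
  | succ n ih =>
    rw [pow_succ', Module.End.mul_apply]
    exact F_anti (by push_cast; omega) (S_mem ih)

/-- The addition shifts the exponents at infinity by `-f`. -/
lemma InfExp.additionOp [CharZero K] {s : ℕ} {R : K[X][X]} {L : List (K × ℕ)} (h : InfExp s R L)
    (c f : K) : InfExp s (additionOp c f R) (shift (-f) L) := by
  have hR := ne_zero_of_coeff h.lead
  have hD := degX_additionOp c f hR
  refine ⟨?_, by rw [hD, coeff_additionOp_degX]; exact h.lead, ?_⟩
  · rw [hD]
    refine filt_mono _ _ ?_ (additionOp_mem_filt le_rfl c f h.diag)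
    push_cast; omega
  · intro b hb hpos
    obtain ⟨b, hb', rfl⟩ := List.mem_map.1 hb
    have hDf : D b.1 + f • S = D (b.1 + -f) := by
      rw [D, D, S, smul_wshift, wshift_add]; congr 1; funext n; ring
    have hDF : ∀ (μ : K) (k : ℤ), ∀ m ∈ F k, D μ m ∈ F k := fun μ k m hm => F_anti (by omega) (D_mem hm)
    have h1 := ev_add_mem (isWeyl_inf b.1) 0 c (hDF b.1 0) (hDF b.1 _) (h.blocks b hb' hpos)
    rw [zero_smul, zero_add, ← Algebra.algebraMap_eq_smul_one] at h1
    have hw : IsWeyl (S' + algebraMap K _ c) (D b.1) :=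
      (isWeyl_inf b.1).add_left (Algebra.commutes _ _).symm
    have hw' : IsWeyl (S' + algebraMap K _ c) (D (b.1 + -f)) :=
      (isWeyl_inf _).add_left (Algebra.commutes _ _).symm
    have h2 : ∀ m ∈ F 0, ev (S' + algebraMap K _ c) (D (b.1 + -f)) (TwistedEuler.additionOp c f R) m ∈
        F ((b.2 : ℤ) + s - degX R - R.natDegree) := by
      intro m hm
      rw [← hDf, ev_additionOp hw rfl S'_mul_S S_mul_S', Module.End.mul_apply]
      exact S'_pow_mem _ (h1 m hm)
    have h3 := ev_add_mem hw' 0 (-c) (hDF _ 0) (hDF _ _) h2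
    rw [hD]
    intro m hm
    have h4 := h3 m hm
    rw [zero_smul, zero_add, Algebra.algebraMap_eq_smul_one, add_assoc, ← add_smul, add_neg_cancel,
      zero_smul, add_zero] at h4
    exact F_anti (by push_cast; omega) h4

/-- The addition at the origin shifts the exponents there by `f`. -/
lemma FinExp.additionOp {v : ℕ} {P : K[X][X]} {L : List (K × ℕ)} (h : FinExp v P L) (f : K) :
    FinExp (P.natDegree + v) (additionOp 0 f P) (shift f L) := by
  have hn := natDegree_additionOp 0 f P
  refine ⟨?_, ?_, ?_⟩
  · rw [hn]
    refine Submodule.sum_mem _ fun j hj => ?_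
    have hj' := Finset.mem_range.1 hj
    have h1 := C_mul_X_pow_mem_filt_neg (C ((descPochhammer K j).eval (-f))) (P.natDegree - j)
      (filt_hasseDeriv h.diag j)
    rw [C_0, sub_zero]
    refine filt_mono _ _ ?_ h1
    push_cast [Nat.cast_sub (Nat.lt_succ_iff.1 hj')]; omega
  · rw [hn, (coeff_additionOp 0 f P).2, C_0, sub_zero, add_comm, coeff_X_pow_mul]
    exact h.lead
  · intro b hb hpos
    obtain ⟨b, hb', rfl⟩ := List.mem_map.1 hb
    have hYf : Y b.1 + f • S' = Y (b.1 + f) := by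
      rw [Y, Y, S', smul_wshift, wshift_add]; congr 1; funext n; ring
    intro m hm
    rw [hn, ← hYf, ev_additionOp (t := S) (isWeyl_fin b.1) (by rw [map_zero, add_zero]) S_mul_S' S'_mul_S,
      Module.End.mul_apply]
    refine F_anti ?_ (S_pow_mem _ (h.blocks b hb' hpos m hm))
    push_cast; omega

lemma aeval_S_mem (u : K[X]) {k : ℤ} {f : ℤ →₀ K} (hf : f ∈ F k) : aeval S u f ∈ F k := by
  rw [aeval_eq_sum_range, LinearMap.sum_apply]
  refine Submodule.sum_mem _ fun i _ => Submodule.smul_mem _ _ (F_anti (by omega) (S_pow_mem i hf))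

/-- Substitutions of `∂ + h` for `∂`, where `h` is regular at the origin, preserve the exponents
there. -/
lemma FinExp.sum_hasseDeriv [CharZero K] {v : ℕ} {P : K[X][X]} {L : List (K × ℕ)} (h : FinExp v P L)
    {φ : ℕ → K[X]} (h0 : (φ 0).coeff 0 ≠ 0) :
    FinExp v (∑ k ∈ Finset.range (P.natDegree + 1), C (φ k) * hasseDeriv k P) L := by
  obtain ⟨hle, hco⟩ := coeff_sum_hasseDeriv φ (le_refl P.natDegree)
  have hvan : ∀ a < v, (P.coeff P.natDegree).coeff a = 0 := fun a ha => h.diag a _ (by omega)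
  have hl : (φ 0 * P.coeff P.natDegree).coeff v = (φ 0).coeff 0 * (P.coeff P.natDegree).coeff v := by
    rw [coeff_mul, Finset.sum_eq_single (0, v)]
    · rintro ⟨i, j⟩ hij hne
      have := Finset.HasAntidiagonal.mem_antidiagonal.1 hij
      simp only at this
      have hj : j < v := by
        by_contra hj
        exact hne (by ext <;> simp <;> omega)
      rw [hvan j hj, mul_zero]
    · simp
  have hne : (φ 0).coeff 0 * (P.coeff P.natDegree).coeff v ≠ 0 := mul_ne_zero h0 h.lead
  have hn : (∑ k ∈ Finset.range (P.natDegree + 1), C (φ k) * hasseDeriv k P).natDegree =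
      P.natDegree := by
    refine natDegree_eq_of_mem (a := v) (mem_filt_natDegree.2 hle) ?_
    rwa [hco, hl]
  refine ⟨?_, by rwa [hn, hco, hl], ?_⟩
  · rw [hn]
    refine Submodule.sum_mem _ fun j _ => C_mul_mem_filt_neg _ ?_
    exact filt_mono _ _ (by omega) (filt_hasseDeriv h.diag j)
  · intro b hb hpos m hm
    rw [hn, map_sum, LinearMap.sum_apply]
    refine Submodule.sum_mem _ fun j _ => ?_
    rw [ev_C_mul, Module.End.mul_apply]
    exact aeval_S_mem _ (ev_hasseDeriv_mem (isWeyl_fin b.1) (fun m hm => F_anti (by omega) (S_mem hm))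
      (fun m hm => F_anti (by omega) (S_mem hm)) (h.blocks b hb hpos) j m hm)

/-- A map that acts on leading terms as a shift by `s` detects the filtration. -/
lemma mem_F_of_leading {A : Module.End K (ℤ →₀ K)} {s : ℤ} {κ : K} (hκ : κ ≠ 0)
    (hA : ∀ (j : ℤ) (f : ℤ →₀ K), f ∈ F j → A f (j + s) = κ * f j) {e : ℤ} {f : ℤ →₀ K}
    (h : A f ∈ F (e + s)) : f ∈ F e := by
  obtain ⟨k, hk⟩ := exists_mem_F f
  have key : ∀ j : ℕ, k + j ≤ e → f ∈ F (k + j) := by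
    intro j
    induction j with
    | zero => intro _; simpa using hk
    | succ j ih =>
      intro hj
      have hf := ih (by push_cast at hj; omega)
      refine mem_F.2 fun n hn => ?_
      rcases eq_or_ne n (k + j) with rfl | hne
      · have h1 := hA _ _ hf
        rw [mem_F.1 h _ (by push_cast at hj; omega)] at h1
        exact (mul_eq_zero.1 h1.symm).resolve_left hκ
      · exact mem_F.1 hf n (by push_cast at hn; omega)
  rcases le_total k e with h1 | h1
  · have := key (e - k).toNat (by omega)
    rwa [show k + ((e - k).toNat : ℤ) = e by omega] at this
  · exact F_anti h1 hk

lemma S_pow_apply (i : ℕ) (f : ℤ →₀ K) (n : ℤ) : (S ^ i) f n = f (n - i) := by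
  induction i generalizing n with
  | zero => simp
  | succ i ih =>
    rw [pow_succ', Module.End.mul_apply, S, wshift_apply, mul_one, ← S, ih]
    congr 1; push_cast; ring

lemma S'_pow_apply (i : ℕ) (f : ℤ →₀ K) (n : ℤ) : (S' ^ i) f n = f (n + i) := by
  induction i generalizing n with
  | zero => simp
  | succ i ih =>
    rw [pow_succ', Module.End.mul_apply, S', wshift_apply, mul_one, ← S', ih]
    congr 1; push_cast; ring

lemma aeval_S_leading {u : K[X]} {s : ℕ} (hs : ∀ i < s, u.coeff i = 0) (j : ℤ) (f : ℤ →₀ K)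
    (hf : f ∈ F j) : aeval S u f (j + s) = u.coeff s * f j := by
  rw [aeval_eq_sum_range' (n := u.natDegree + s + 1) (by omega), LinearMap.sum_apply,
    Finsupp.finsetSum_apply, Finset.sum_eq_single s]
  · rw [LinearMap.smul_apply, Finsupp.smul_apply, S_pow_apply, smul_eq_mul, add_sub_cancel_right]
  · intro i _ hi
    rw [LinearMap.smul_apply, Finsupp.smul_apply, S_pow_apply, smul_eq_mul]
    rcases lt_or_gt_of_ne hi with h | h
    · rw [hs i h, zero_mul]
    · rw [mem_F.1 hf _ (by omega), mul_zero]
  · intro h; exact absurd (Finset.mem_range.2 (by omega)) h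

lemma aeval_S'_leading (u : K[X]) (j : ℤ) (f : ℤ →₀ K) (hf : f ∈ F j) :
    aeval S' u f (j + -(u.natDegree : ℤ)) = u.leadingCoeff * f j := by
  rw [aeval_eq_sum_range, LinearMap.sum_apply, Finsupp.finsetSum_apply,
    Finset.sum_eq_single u.natDegree]
  · rw [LinearMap.smul_apply, Finsupp.smul_apply, S'_pow_apply, smul_eq_mul, neg_add_cancel_right]
    rfl
  · intro i hi h
    have := Finset.mem_range.1 hi
    rw [LinearMap.smul_apply, Finsupp.smul_apply, S'_pow_apply, mem_F.1 hf _ (by omega), smul_zero]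
  · intro h; exact absurd (Finset.mem_range.2 (by omega)) h

lemma aeval_S'_mem (u : K[X]) {k : ℤ} {f : ℤ →₀ K} (hf : f ∈ F k) :
    aeval S' u f ∈ F (k + -(u.natDegree : ℤ)) := by
  rw [aeval_eq_sum_range, LinearMap.sum_apply]
  refine Submodule.sum_mem _ fun i hi => Submodule.smul_mem _ _ (F_anti ?_ (S'_pow_mem i hf))
  have := Finset.mem_range.1 hi
  omega

lemma infExp_C_mul_iff {u : K[X]} (hu : u ≠ 0) {s : ℕ} {R : K[X][X]} (hR : R ≠ 0)
    {L : List (K × ℕ)} : InfExp s (C u * R) L ↔ InfExp s R L := by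
  have hD := degX_C_mul hu hR
  have h1 : C u * R ∈ filt 1 (-1) ((degX (C u * R) : ℤ) - s) ↔
      R ∈ filt 1 (-1) ((degX R : ℤ) - s) := by
    rw [hD, ← C_mul_mem_filt_one hu (P := R) (q := -1) (k := (degX R : ℤ) - s)]; push_cast
    rw [add_sub_assoc]
  have h2 := coeff_coeff_C_mul (u := u) (mem_filt_self R) s
  have hu' := leadingCoeff_ne_zero.2 hu
  have h3 : ∀ (μ : K) (e : ℤ) (f : ℤ →₀ K), ev S' (D μ) (C u * R) f ∈ F (e + -(u.natDegree : ℤ)) ↔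
      ev S' (D μ) R f ∈ F e := by
    intro μ e f
    rw [ev_C_mul, Module.End.mul_apply]
    exact ⟨mem_F_of_leading hu' (aeval_S'_leading u), aeval_S'_mem u⟩
  have h4 : ∀ m : ℕ, (m : ℤ) + s - degX (C u * R) = ((m : ℤ) + s - degX R) + -(u.natDegree : ℤ) := by
    intro m; rw [hD]; push_cast; ring
  constructor
  · intro h
    refine ⟨h1.1 h.diag, ?_, fun b hb hpos f hf => ?_⟩
    · have := h.lead
      rw [hD, h2] at this
      exact right_ne_zero_of_mul this
    · have := h.blocks b hb hpos f hf
      rwa [h4, h3] at this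
  · intro h
    refine ⟨h1.2 h.diag, ?_, fun b hb hpos f hf => ?_⟩
    · rw [hD, h2]; exact mul_ne_zero hu' h.lead
    · rw [h4, h3]; exact h.blocks b hb hpos f hf

lemma InfExp.of_sim {s : ℕ} {R R' : K[X][X]} {L : List (K × ℕ)} (h : InfExp s R L)
    (hs : Sim R' R) : InfExp s R' L := by
  have hR := ne_zero_of_coeff h.lead
  have hR' := hs.ne_zero hR
  obtain ⟨u, v, hu, hv, e⟩ := hs
  rw [← infExp_C_mul_iff hu hR', e, infExp_C_mul_iff hv hR]
  exact h

lemma exists_coeff_ne {u : K[X]} (hu : u ≠ 0) : ∃ t, u.coeff t ≠ 0 ∧ ∀ i < t, u.coeff i = 0 :=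
  ⟨u.natTrailingDegree, by simpa using hu, fun _ hi => coeff_eq_zero_of_lt_natTrailingDegree hi⟩

lemma coeff_mul_leading {u p : K[X]} {t v : ℕ} (ht : ∀ i < t, u.coeff i = 0)
    (hv : ∀ i < v, p.coeff i = 0) : (u * p).coeff (t + v) = u.coeff t * p.coeff v := by
  rw [coeff_mul, Finset.sum_eq_single (t, v)]
  · rintro ⟨i, j⟩ hij hne
    have := Finset.HasAntidiagonal.mem_antidiagonal.1 hij
    simp only at this
    rcases lt_or_ge i t with h | h
    · rw [ht i h, zero_mul]
    · rcases lt_or_ge j v with h' | h'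
      · rw [hv j h', mul_zero]
      · exact absurd (by ext <;> simp <;> omega) hne
  · simp

lemma C_mul_mem_filt_neg_iff {u : K[X]} {t : ℕ} (h0 : u.coeff t ≠ 0) (ht : ∀ i < t, u.coeff i = 0)
    {k : ℤ} {P : K[X][X]} : C u * P ∈ filt (-1) 1 (k - t) ↔ P ∈ filt (-1) 1 k := by
  constructor
  · intro h a
    induction a using Nat.strong_induction_on with
    | _ a ih =>
      intro b hab
      have h1 := h (t + a) b (by push_cast; omega)
      rw [coeff_C_mul, coeff_mul_leading ht (fun i hi => ih i hi b (by omega))] at h1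
      exact (mul_eq_zero.1 h1).resolve_left h0
  · intro h
    obtain ⟨w, hw⟩ := X_pow_dvd_iff.2 ht
    rw [hw, mul_comm (X ^ t)]
    exact C_mul_X_pow_mem_filt_neg w t h

lemma finExp_C_mul_iff {u : K[X]} {t : ℕ} (h0 : u.coeff t ≠ 0) (ht : ∀ i < t, u.coeff i = 0)
    {v : ℕ} {P : K[X][X]} {L : List (K × ℕ)} :
    FinExp (t + v) (C u * P) L ↔ FinExp v P L := by
  have hu : u ≠ 0 := by rintro rfl; simp at h0
  have hn := natDegree_C_mul (p := P) hu
  have hk : ((C u * P).natDegree : ℤ) - ((t + v : ℕ) : ℤ) = ((P.natDegree : ℤ) - v) - t := by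
    rw [hn]; push_cast; ring
  have h1 : C u * P ∈ filt (-1) 1 (((C u * P).natDegree : ℤ) - ((t + v : ℕ) : ℤ)) ↔
      P ∈ filt (-1) 1 ((P.natDegree : ℤ) - v) := by
    rw [hk, C_mul_mem_filt_neg_iff h0 ht]
  have h2 : P ∈ filt (-1) 1 ((P.natDegree : ℤ) - v) →
      ((C u * P).coeff P.natDegree).coeff (t + v) =
        u.coeff t * (P.coeff P.natDegree).coeff v := fun h => by
    rw [coeff_C_mul, coeff_mul_leading ht fun i hi => h i _ (by omega)]
  have h3 : ∀ (ρ : K) (e : ℤ) (f : ℤ →₀ K), ev S (Y ρ) (C u * P) f ∈ F (e + t) ↔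
      ev S (Y ρ) P f ∈ F e := by
    intro ρ e f
    rw [ev_C_mul, Module.End.mul_apply]
    refine ⟨mem_F_of_leading h0 (aeval_S_leading ht), fun h => ?_⟩
    obtain ⟨w, hw⟩ := X_pow_dvd_iff.2 ht
    rw [hw, map_mul, map_pow, aeval_X, Module.End.mul_apply]
    exact S_pow_mem t (aeval_S_mem w h)
  have h4 : ∀ m : ℕ, (m : ℤ) + ((t + v : ℕ) : ℤ) - (C u * P).natDegree =
      ((m : ℤ) + v - P.natDegree) + t := by
    intro m; rw [hn]; push_cast; ring
  constructor
  · intro h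
    have hd := h1.1 h.diag
    refine ⟨hd, ?_, fun b hb hpos f hf => ?_⟩
    · have := h.lead
      rw [hn, h2 hd] at this
      exact right_ne_zero_of_mul this
    · have := h.blocks b hb hpos f hf
      rwa [h4, h3] at this
  · intro h
    refine ⟨h1.2 h.diag, ?_, fun b hb hpos f hf => ?_⟩
    · rw [hn, h2 h.diag]; exact mul_ne_zero h0 h.lead
    · rw [h4, h3]; exact h.blocks b hb hpos f hf

lemma FinExp.of_sim {v : ℕ} {P P' : K[X][X]} {L : List (K × ℕ)} (h : FinExp v P L)
    (hs : Sim P' P) : ∃ v', FinExp v' P' L := by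
  obtain ⟨u, w, hu, hw, e⟩ := hs
  obtain ⟨t, h0, ht⟩ := exists_coeff_ne hu
  obtain ⟨t', h0', ht'⟩ := exists_coeff_ne hw
  have hn : P'.natDegree = P.natDegree := by rw [← natDegree_C_mul hu, e, natDegree_C_mul hw]
  have h1 := (finExp_C_mul_iff h0' ht').2 h
  rw [← e] at h1
  have hle : t ≤ t' + v := by
    by_contra hlt
    have := h1.lead
    rw [coeff_C_mul, coeff_mul] at this
    refine this (Finset.sum_eq_zero fun ij hij => ?_)
    have := Finset.HasAntidiagonal.mem_antidiagonal.1 hij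
    rw [ht _ (by omega), zero_mul]
  obtain ⟨v', hv'⟩ := Nat.exists_eq_add_of_le hle
  rw [hv', finExp_C_mul_iff h0 ht] at h1
  exact ⟨v', h1⟩

end Exponents

end

/-! ### The semi-simple exponents in terms of the action on series -/

section

variable {K : Type*} [Field K]

lemma D_pow_single (μ : K) (b : ℕ) (n : ℤ) :
    (D μ ^ b) (Finsupp.single n (1 : K)) =
      Finsupp.single (n + b) ((descPochhammer K b).eval (-μ - n)) := by
  induction b with
  | zero => simp
  | succ b ih =>
    rw [pow_succ', Module.End.mul_apply, ih, D, wshift_single, descPochhammer_succ_eval]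
    congr 1
    · push_cast; ring
    · push_cast; ring

lemma Y_pow_single (ρ : K) (b : ℕ) (n : ℤ) :
    (Y ρ ^ b) (Finsupp.single n (1 : K)) =
      Finsupp.single (n - b) ((descPochhammer K b).eval (ρ + n)) := by
  induction b with
  | zero => simp
  | succ b ih =>
    rw [pow_succ', Module.End.mul_apply, ih, Y, wshift_single, descPochhammer_succ_eval]
    congr 1
    · push_cast; ring
    · push_cast; ring

lemma ev_expand_range {E : Type*} [Ring E] [Algebra K E] (x d : E) {P : K[X][X]} {M N : ℕ}
    (hN : P.natDegree < N) (hM : degX P < M) : ev x d P =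
      ∑ b ∈ Finset.range N, ∑ a ∈ Finset.range M, (P.coeff b).coeff a • (x ^ a * d ^ b) := by
  conv_lhs => rw [P.as_sum_range' N hN]
  rw [map_sum]
  refine Finset.sum_congr rfl fun b _ => ?_
  have hb : (P.coeff b).natDegree < M := by
    by_cases h : P.coeff b = 0
    · rw [h, natDegree_zero]; omega
    · exact (Finset.le_sup (f := fun i => (P.coeff i).natDegree) (mem_support_iff.2 h)).trans_lt hM
  rw [ev_monomial, aeval_eq_sum_range' hb, Finset.sum_mul]
  exact Finset.sum_congr rfl fun a _ => smul_mul_assoc _ _ _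

lemma ev_inf_single (μ : K) (P : K[X][X]) {M N : ℕ} (hN : P.natDegree < N) (hM : degX P < M)
    (n l : ℤ) : ev S' (D μ) P (Finsupp.single n 1) l =
      ∑ b ∈ Finset.range N, ∑ a ∈ Finset.range M,
        if l + a = n + b then (P.coeff b).coeff a * (descPochhammer K b).eval (-μ - n) else 0 := by
  rw [ev_expand_range _ _ hN hM, LinearMap.sum_apply, Finsupp.finsetSum_apply]
  refine Finset.sum_congr rfl fun b _ => ?_
  rw [LinearMap.sum_apply, Finsupp.finsetSum_apply]
  refine Finset.sum_congr rfl fun a _ => ?_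
  rw [LinearMap.smul_apply, Finsupp.smul_apply, Module.End.mul_apply, S'_pow_apply, D_pow_single,
    Finsupp.single_apply, smul_eq_mul, mul_ite, mul_zero]
  simp only [eq_comm]

lemma ev_fin_single (ρ : K) (P : K[X][X]) {M N : ℕ} (hN : P.natDegree < N) (hM : degX P < M)
    (n l : ℤ) : ev S (Y ρ) P (Finsupp.single n 1) l =
      ∑ b ∈ Finset.range N, ∑ a ∈ Finset.range M,
        if l + b = n + a then (P.coeff b).coeff a * (descPochhammer K b).eval (ρ + n) else 0 := by
  rw [ev_expand_range _ _ hN hM, LinearMap.sum_apply, Finsupp.finsetSum_apply]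
  refine Finset.sum_congr rfl fun b _ => ?_
  rw [LinearMap.sum_apply, Finsupp.finsetSum_apply]
  refine Finset.sum_congr rfl fun a _ => ?_
  rw [LinearMap.smul_apply, Finsupp.smul_apply, Module.End.mul_apply, S_pow_apply, Y_pow_single,
    Finsupp.single_apply, smul_eq_mul, mul_ite, mul_zero]
  have : n - b = l - a ↔ l + b = n + a := by omega
  simp only [this]

lemma coeff_xPart (P : K[X][X]) (i j : ℕ) :
    (xPart P i).coeff j = if i ≤ degX P then (P.coeff j).coeff (degX P - i) else 0 := by
  rw [xPart]
  split_ifs with h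
  · rw [Polynomial.sum_def, finsetSum_coeff]
    simp only [coeff_monomial]
    rw [Finset.sum_ite_eq']
    split_ifs with h'
    · rfl
    · rw [notMem_support_iff.1 h', coeff_zero]
  · simp

/-- The polynomials `p_k` of the definition of the exponents at infinity describe the action on
`x^(-μ-n)`. -/
lemma ev_inf_single_eq_inftyPoly (μ : K) (P : K[X][X]) (n : ℤ) (k : ℕ) :
    ev S' (D μ) P (Finsupp.single n 1) (n - degX P + k) = inftyPoly P k (-μ - n - k) := by
  rw [ev_inf_single μ P (M := degX P + 1) (N := P.natDegree + k + 1) (by omega) (by omega),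
    inftyPoly]
  conv_rhs => rw [← Finset.sum_range_reflect]
  rw [← Finset.sum_subset (Finset.range_mono (by omega : k + 1 ≤ P.natDegree + k + 1))]
  · refine Finset.sum_congr rfl fun b hb => ?_
    have hb' := Finset.mem_range.1 hb
    have e1 : k + 1 - 1 - b = k - b := by omega
    have e2 : k - (k - b) = b := by omega
    rw [e1, e2, coeff_xPart, descPochhammer_eval_eq_ascPochhammer]
    have e3 : (-μ - n - k + ((k - b : ℕ) : K) + 1) = -μ - n - b + 1 := by
      rw [Nat.cast_sub (by omega)]; ring
    rw [e3]
    split_ifs with h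
    · rw [Finset.sum_eq_single (degX P - (k - b))]
      · rw [if_pos (by omega), mul_comm]
      · intro a _ ha
        rw [if_neg (by omega)]
      · intro h'
        exact absurd (Finset.mem_range.2 (by omega)) h'
    · rw [mul_zero]
      refine Finset.sum_eq_zero fun a ha => ?_
      rw [if_neg (by omega)]
  · intro b _ hb
    refine Finset.sum_eq_zero fun a ha => ?_
    have := Finset.mem_range.1 ha
    rw [Finset.mem_range] at hb
    rw [if_neg (by omega)]

/-- The numbers `p_k(-μ - n)` are the coefficients of the image of `eₙ`, so their vanishing says
how far down the filtration the image lies. -/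
theorem hasExponentsAtInfty_iff {R : K[X][X]} {L : List (K × ℕ)} :
    HasExponentsAtInfty R L ↔ Nonresonant L ∧ InfExp (size L) R L := by
  have hdiag : (∀ i j : ℕ, i + j < size L → (xPart R i).coeff j = 0) ↔
      R ∈ filt 1 (-1) ((degX R : ℤ) - size L) := by
    constructor
    · intro h a b hab
      by_cases ha : a ≤ degX R
      · have := h (degX R - a) b (by omega)
        rwa [coeff_xPart, if_pos (by omega), Nat.sub_sub_self ha] at this
      · exact mem_filt_self R a b (by omega)
    · intro h i j hij
      rw [coeff_xPart]
      split_ifs with hi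
      · exact h _ _ (by omega)
      · rfl
  have hlead : (xPart R 0).coeff (size L) = (R.coeff (size L)).coeff (degX R) := by
    rw [coeff_xPart, if_pos (Nat.zero_le _), Nat.sub_zero]
  rw [HasExponentsAtInfty]
  constructor
  · rintro ⟨h1, h2, h3, h4⟩
    have hd := hdiag.1 h2
    refine ⟨h1, hd, by rwa [hlead] at h3, fun b hb hpos f hf => map_F_le (fun n hn => ?_) hf⟩
    have h5 := ev_inf_mem (μ := b.1) hd (single_mem_F (le_refl n) (1 : K))
    refine mem_F.2 fun l hl => ?_
    by_cases hl' : l < n - (degX R - size L)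
    · exact mem_F.1 h5 l hl'
    · obtain ⟨j, rfl⟩ := Int.eq_ofNat_of_zero_le hn
      obtain ⟨k, hk⟩ := Int.eq_ofNat_of_zero_le (show 0 ≤ l - j + degX R by omega)
      have e : l = j - degX R + k := by omega
      have := h4 b hb j (by omega) k (by omega) (by omega)
      rw [e]
      exact (ev_inf_single_eq_inftyPoly b.1 R j k).trans (by push_cast; exact this)
  · rintro ⟨h1, h2⟩
    refine ⟨h1, hdiag.2 h2.diag, by rw [hlead]; exact h2.lead, fun b hb j hj k hk hk' => ?_⟩
    have h3 := h2.blocks b hb (by omega) _ (single_mem_F (n := (j : ℤ)) (by omega) (1 : K))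
    have h4 := mem_F.1 h3 (j - degX R + k) (by omega)
    rw [ev_inf_single_eq_inftyPoly] at h4
    exact_mod_cast h4

/-! #### Finite points -/

/-- The operator `∑ xⁿ⁻ʲ aⱼ ∂ⁿ⁻ʲ`. -/
def localOp (n : ℕ) (a : ℕ → K[X]) : K[X][X] :=
  ∑ j ∈ Finset.range (n + 1), monomial (n - j) (X ^ (n - j) * a j)

lemma coeff_localOp (n : ℕ) (a : ℕ → K[X]) (i : ℕ) :
    (localOp n a).coeff i = if i ≤ n then X ^ i * a (n - i) else 0 := by
  rw [localOp, finsetSum_coeff]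
  simp only [coeff_monomial]
  split_ifs with h
  · rw [Finset.sum_eq_single (n - i)]
    · rw [if_pos (by omega), Nat.sub_sub_self h]
    · intro j hj hne
      have := Finset.mem_range.1 hj
      rw [if_neg (by omega)]
    · intro h'; exact absurd (Finset.mem_range.2 (by omega)) h'
  · refine Finset.sum_eq_zero fun j _ => ?_
    rw [if_neg (by omega)]

lemma natDegree_localOp {n : ℕ} {a : ℕ → K[X]} (h0 : a 0 ≠ 0) : (localOp n a).natDegree = n := by
  refine le_antisymm (natDegree_le_iff_coeff_eq_zero.2 fun i hi => ?_)
    (le_natDegree_of_ne_zero ?_)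
  · rw [coeff_localOp, if_neg (by omega)]
  · rw [coeff_localOp, if_pos le_rfl, Nat.sub_self]
    exact mul_ne_zero (pow_ne_zero _ X_ne_zero) h0

lemma ev_localOp_single (n : ℕ) (a : ℕ → K[X]) (ρ : K) (l : ℤ) (k : ℕ) :
    ev S (Y ρ) (localOp n a) (Finsupp.single l 1) (l + k) =
      (∑ j ∈ Finset.range (n + 1), C ((descPochhammer K (n - j)).eval (ρ + l)) * a j).coeff k := by
  rw [localOp, map_sum, LinearMap.sum_apply, Finsupp.finsetSum_apply, finsetSum_coeff]
  refine Finset.sum_congr rfl fun j _ => ?_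
  have h1 : ∀ i : ℕ, (S ^ i) ((Y ρ ^ i) (Finsupp.single l (1 : K))) =
      (descPochhammer K i).eval (ρ + l) • Finsupp.single l (1 : K) := by
    intro i
    ext m
    rw [S_pow_apply, Y_pow_single, Finsupp.single_apply, Finsupp.smul_apply, Finsupp.single_apply]
    have : l - (i : ℤ) = m - i ↔ l = m := by omega
    simp [this]
  rw [ev_monomial, mul_comm, map_mul, map_pow, aeval_X, Module.End.mul_apply, Module.End.mul_apply,
    h1, map_smul, Finsupp.smul_apply, smul_eq_mul, coeff_C_mul]
  congr 1
  rw [aeval_eq_sum_range' (n := (a j).natDegree + k + 1) (by omega), LinearMap.sum_apply,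
    Finsupp.finsetSum_apply, Finset.sum_eq_single k]
  · rw [LinearMap.smul_apply, Finsupp.smul_apply, S_pow_apply, add_sub_cancel_right]; simp
  · intro i _ hi
    rw [LinearMap.smul_apply, Finsupp.smul_apply, S_pow_apply, Finsupp.single_apply,
      if_neg (by omega), smul_zero]
  · intro h; exact absurd (Finset.mem_range.2 (by omega)) h

lemma localOp_mem_filt (n : ℕ) (a : ℕ → K[X]) : localOp n a ∈ filt (-1) 1 0 := by
  intro i b h
  rw [coeff_localOp]
  split_ifs
  · rw [coeff_X_pow_mul', if_neg (by omega)]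
  · rfl

lemma coeff_localOp_self {n : ℕ} (a : ℕ → K[X]) :
    ((localOp n a).coeff n).coeff n = (a 0).coeff 0 := by
  rw [coeff_localOp, if_pos le_rfl, Nat.sub_self, coeff_X_pow_mul', if_pos le_rfl, Nat.sub_self]

/-- The coefficients `f_k` of the definition of the exponents at `c` describe the action on
`(x - c)^ν`, up to division by `a₀`. -/
lemma charCoeff_eq_zero_iff {n : ℕ} {c : K} {a : ℕ → K[X]} (h0 : (a 0).eval c ≠ 0) (ν : K) (N : ℕ) :
    (∀ k < N, charCoeff n c a k ν = 0) ↔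
      ∀ k < N, (∑ j ∈ Finset.range (n + 1),
        C ((descPochhammer K (n - j)).eval ν) * taylor c (a j)).coeff k = 0 := by
  set p : K[X] := ∑ j ∈ Finset.range (n + 1), C ((descPochhammer K (n - j)).eval ν) * taylor c (a j)
  set q : PowerSeries K := ((taylor c (a 0) : K[X]) : PowerSeries K)
  have hq : PowerSeries.constantCoeff q ≠ 0 := by
    rw [← PowerSeries.coeff_zero_eq_constantCoeff_apply, Polynomial.coeff_coe, taylor_coeff_zero]
    exact h0
  have e : (∑ j ∈ Finset.range (n + 1), PowerSeries.C ((descPochhammer K (n - j)).eval ν) *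
      ((taylor c (a j) : K[X]) : PowerSeries K) * q⁻¹) = (p : PowerSeries K) * q⁻¹ := by
    rw [← Finset.sum_mul]
    congr 1
    rw [← Polynomial.coeToPowerSeries.ringHom_apply, map_sum]
    refine Finset.sum_congr rfl fun j _ => ?_
    rw [map_mul, Polynomial.coeToPowerSeries.ringHom_apply, Polynomial.coeToPowerSeries.ringHom_apply,
      Polynomial.coe_C]
  simp only [charCoeff]
  rw [e, ← PowerSeries.X_pow_dvd_iff]
  have e2 : (∀ k < N, p.coeff k = 0) ↔ PowerSeries.X ^ N ∣ (p : PowerSeries K) := by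
    rw [PowerSeries.X_pow_dvd_iff]; simp only [Polynomial.coeff_coe]
  rw [e2]
  constructor
  · intro h
    have := h.mul_right q
    rwa [mul_assoc, PowerSeries.inv_mul_cancel _ hq, mul_one] at this
  · intro h; exact h.mul_right _

lemma translate_sum_localForm (n : ℕ) (c : K) (a : ℕ → K[X]) :
    translate c (∑ j ∈ Finset.range (n + 1), monomial (n - j) ((X - C c) ^ (n - j) * a j)) =
      localOp n fun j => taylor c (a j) := by
  rw [translate, Polynomial.map_sum, localOp]
  refine Finset.sum_congr rfl fun j _ => ?_
  rw [map_monomial]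
  congr 1
  change taylor c _ = _
  rw [taylor_mul]
  congr 1
  rw [← taylorAlgHom_apply, map_pow, taylorAlgHom_apply]
  congr 1
  rw [map_sub, taylor_X, taylor_C, add_sub_cancel_right]

lemma translate_zero (P : K[X][X]) : translate 0 P = P := by
  ext1 i; rw [coeff_translate, taylor_zero]

lemma natDegree_translate (c : K) (P : K[X][X]) : (translate c P).natDegree = P.natDegree := by
  rw [translate]
  exact natDegree_map_eq_of_injective (taylorEquiv c).injective P

lemma Sim.translate {P Q : K[X][X]} (h : Sim P Q) (c : K) : Sim (translate c P) (translate c Q) := by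
  obtain ⟨u, v, hu, hv, h⟩ := h
  refine ⟨taylor c u, taylor c v, fun h0 => hu ?_, fun h0 => hv ?_, ?_⟩
  · exact (taylor_injective c) (by rw [h0, map_zero])
  · exact (taylor_injective c) (by rw [h0, map_zero])
  · rw [← translate_C_mul, h, translate_C_mul]

lemma finExp_localOp_iff {n : ℕ} {a : ℕ → K[X]} (h0 : (a 0).coeff 0 ≠ 0) {L : List (K × ℕ)} :
    FinExp n (localOp n a) L ↔ ∀ b ∈ L, ∀ j < b.2, ∀ k < b.2 - j,
      (∑ i ∈ Finset.range (n + 1), C ((descPochhammer K (n - i)).eval (b.1 + j)) * a i).coeff k = 0 := by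
  have ha : a 0 ≠ 0 := by intro h; rw [h] at h0; simp at h0
  have hn := natDegree_localOp (n := n) ha
  constructor
  · intro h b hb j hj k hk
    have h1 := h.blocks b hb (by omega) _ (single_mem_F (n := (j : ℤ)) (by omega) (1 : K))
    have h2 := mem_F.1 h1 (j + k) (by rw [hn]; omega)
    rw [ev_localOp_single] at h2
    exact_mod_cast h2
  · intro h
    have hd : localOp n a ∈ filt (-1) 1 (((localOp n a).natDegree : ℤ) - n) := by
      rw [hn, sub_self]; exact localOp_mem_filt n a
    refine ⟨hd, by rw [hn, coeff_localOp_self]; exact h0, fun b hb hpos f hf =>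
      map_F_le (fun l hl => mem_F.2 fun m hm => ?_) hf⟩
    rw [hn] at hm
    by_cases hml : m < l
    · refine mem_F.1 (ev_fin_mem hd (single_mem_F (le_refl l) (1 : K))) m ?_
      rw [hn]; omega
    · obtain ⟨j, rfl⟩ := Int.eq_ofNat_of_zero_le hl
      obtain ⟨k, hk⟩ := Int.eq_ofNat_of_zero_le (show 0 ≤ m - j by omega)
      have e : m = j + k := by omega
      rw [e]
      refine (ev_localOp_single n a b.1 j k).trans ?_
      push_cast
      exact h b hb j (by omega) k (by omega)

lemma eq_of_finExp_localOp {n v : ℕ} {a : ℕ → K[X]} (h0 : (a 0).coeff 0 ≠ 0) {L : List (K × ℕ)}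
    (h : FinExp v (localOp n a) L) : v = n := by
  have ha : a 0 ≠ 0 := by intro h; rw [h] at h0; simp at h0
  have hn := natDegree_localOp (n := n) ha
  have h1 := h.lead
  have h2 := h.diag
  rw [hn] at h1 h2
  refine le_antisymm ?_ ?_
  · by_contra hlt
    exact h0 ((coeff_localOp_self a).symm.trans (h2 n n (by omega)))
  · by_contra hlt
    exact h1 (localOp_mem_filt n a v n (by omega))

/-- The number `v` depends on the choice of `P` in its class up to `∼`; the exponents do not. -/
theorem hasExponentsAt_iff {P : K[X][X]} {c : K} {L : List (K × ℕ)} :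
    HasExponentsAt P c L ↔ Nonresonant L ∧ size L = P.natDegree ∧
      ∃ v, FinExp v (translate c P) L := by
  rw [HasExponentsAt]
  refine and_congr_right fun _ => and_congr_right fun _ => ?_
  constructor
  · rintro ⟨a, ⟨h0, g, hg, hP⟩, hc⟩
    set A : K[X][X] := ∑ j ∈ Finset.range (P.natDegree + 1),
      monomial (P.natDegree - j) ((X - C c) ^ (P.natDegree - j) * a j) with hA
    have hA' := translate_sum_localForm P.natDegree c a
    rw [← hA] at hA'
    have h0' : (taylor c (a 0)).coeff 0 ≠ 0 := by rwa [taylor_coeff_zero]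
    have hAF : FinExp P.natDegree (translate c A) L := by
      rw [hA', finExp_localOp_iff h0']
      intro b hb j hj
      exact (charCoeff_eq_zero_iff h0 _ _).1 fun k hk => hc b hb j hj k hk
    have hA0 : A ≠ 0 := by
      intro h
      have := ne_zero_of_coeff hAF.lead
      rw [h, translate, Polynomial.map_zero] at this
      exact this rfl
    have hP0 : P ≠ 0 := by
      rintro rfl
      rw [toRat, Polynomial.map_zero] at hP
      exact mul_ne_zero (C_ne_zero.2 hg) (toRat_ne_zero hA0) hP.symm
    exact hAF.of_sim ((sim_of_toRat hP0 hP).translate c)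
  · rintro ⟨v, h⟩
    have hn := natDegree_translate c P
    have hdvd : ∀ i, ∃ q : K[X], i ≤ P.natDegree →
        X ^ (P.natDegree - i) * (translate c P).coeff i = X ^ v * q := by
      intro i
      by_cases hi : i ≤ P.natDegree
      · have : (X : K[X]) ^ v ∣ X ^ (P.natDegree - i) * (translate c P).coeff i := by
          rw [X_pow_dvd_iff]
          intro m hm
          rw [coeff_X_pow_mul']
          split_ifs with hm'
          · refine h.diag _ _ ?_
            rw [hn]; omega
          · rfl
        exact ⟨this.choose, fun _ => this.choose_spec⟩
      · exact ⟨0, fun h => absurd h hi⟩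
    choose q hq using hdvd
    set a : ℕ → K[X] := fun j => taylor (-c) (q (P.natDegree - j)) with ha
    have hta : ∀ j, taylor c (a j) = q (P.natDegree - j) := by
      intro j; rw [ha]; simp only; rw [taylor_taylor, add_neg_cancel, taylor_zero]
    have h0 : (q P.natDegree).coeff 0 ≠ 0 := by
      have h1 := hq P.natDegree le_rfl
      rw [Nat.sub_self, pow_zero, one_mul] at h1
      have h2 := h.lead
      rw [hn, h1, coeff_X_pow_mul', if_pos le_rfl, Nat.sub_self] at h2
      exact h2
    have h0' : (a 0).eval c ≠ 0 := by
      rw [← taylor_coeff_zero, hta, Nat.sub_zero]; exact h0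
    set A : K[X][X] := ∑ j ∈ Finset.range (P.natDegree + 1),
      monomial (P.natDegree - j) ((X - C c) ^ (P.natDegree - j) * a j) with hA
    have hA' := translate_sum_localForm P.natDegree c a
    rw [← hA] at hA'
    have hX : ∀ k : ℕ, (X : K[X]) ^ k ≠ 0 := fun k => pow_ne_zero _ X_ne_zero
    have hsim : Sim (translate c A) (translate c P) := by
      refine ⟨X ^ v, X ^ P.natDegree, hX _, hX _, ?_⟩
      rw [hA']
      ext1 i
      rw [coeff_C_mul, coeff_C_mul, coeff_localOp]
      split_ifs with hi
      · rw [hta, Nat.sub_sub_self hi, mul_left_comm, ← hq i hi, ← mul_assoc, ← pow_add,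
          Nat.add_sub_cancel' hi]
      · rw [coeff_eq_zero_of_natDegree_lt (p := translate c P) (by omega), mul_zero, mul_zero]
    obtain ⟨v', hv'⟩ := h.of_sim hsim
    have h0'' : (taylor c (a 0)).coeff 0 ≠ 0 := by rwa [taylor_coeff_zero]
    rw [hA'] at hv'
    have e := eq_of_finExp_localOp h0'' hv'
    rw [e, finExp_localOp_iff h0''] at hv'
    have hP0 : P ≠ 0 := by
      rintro rfl
      have := h.lead
      rw [translate, Polynomial.map_zero] at this
      simp at this
    refine ⟨a, ⟨h0', (equivalent_iff_sim hP0).2 ?_⟩, fun b hb j hj k hk => ?_⟩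
    · have := (hsim.translate (-c)).symm
      rwa [translate_translate, translate_translate, add_neg_cancel, translate_zero,
        translate_zero] at this
    · exact (charCoeff_eq_zero_iff h0' _ _).2 (fun k hk => hv' b hb j hj k hk) k hk

end

/-! ### Counting exponents -/

section

variable {K : Type*} [Field K]

/-- The list of the exponents in the blocks `L`. -/
def exponents (L : List (K × ℕ)) : List K :=
  L.flatMap fun b => (List.range b.2).map fun j : ℕ => b.1 + j

lemma mem_exponents {L : List (K × ℕ)} {z : K} :
    z ∈ exponents L ↔ ∃ b ∈ L, ∃ j < b.2, b.1 + (j : K) = z := by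
  simp [exponents]

lemma length_exponents (L : List (K × ℕ)) : (exponents L).length = size L := by
  simp [exponents, size, List.length_flatMap]

lemma Nonresonant.nodup_exponents [CharZero K] {L : List (K × ℕ)} (h : Nonresonant L) :
    (exponents L).Nodup := by
  refine List.nodup_flatMap.2 ⟨fun b _ => ?_, ?_⟩
  · exact List.nodup_range.map fun i j hij => by
      simpa using hij
  · refine List.Pairwise.imp ?_ h
    intro a b hab x hxa hxb
    obtain ⟨i, hi, rfl⟩ := List.mem_map.1 hxa
    obtain ⟨j, hj, hij⟩ := List.mem_map.1 hxb
    rw [List.mem_range] at hi hj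
    refine hab (by omega) (by omega) ((j : ℤ) - i) ?_
    push_cast
    linear_combination -hij

lemma size_le_natDegree [CharZero K] {L : List (K × ℕ)} (hL : Nonresonant L) {p : K[X]} (hp : p ≠ 0)
    (h : ∀ b ∈ L, ∀ j < b.2, p.eval (b.1 + (j : K)) = 0) : size L ≤ p.natDegree := by
  classical
  rw [← length_exponents, ← List.toFinset_card_of_nodup hL.nodup_exponents]
  refine card_le_degree_of_subset_roots fun z hz => ?_
  obtain ⟨b, hb, j, hj, rfl⟩ := mem_exponents.1 (List.mem_toFinset.1 hz)
  exact (mem_roots hp).2 (h b hb j hj)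

lemma exists_exponent_of_root [CharZero K] {L : List (K × ℕ)} (hL : Nonresonant L) {p : K[X]}
    (hp : p ≠ 0) (h : ∀ b ∈ L, ∀ j < b.2, p.eval (b.1 + (j : K)) = 0) (hn : p.natDegree ≤ size L)
    {z : K} (hz : p.eval z = 0) : ∃ b ∈ L, ∃ j < b.2, b.1 + (j : K) = z := by
  classical
  by_contra hcon
  rw [← mem_exponents] at hcon
  have hs : (insert z (exponents L).toFinset).card ≤ p.natDegree := by
    refine card_le_degree_of_subset_roots fun w hw => (mem_roots hp).2 ?_
    have hw' : w ∈ insert z (exponents L).toFinset := hw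
    rcases Finset.mem_insert.1 hw' with rfl | hw'
    · exact hz
    · obtain ⟨b, hb, j, hj, rfl⟩ := mem_exponents.1 (List.mem_toFinset.1 hw')
      exact h b hb j hj
  rw [Finset.card_insert_of_notMem (by simpa using hcon),
    List.toFinset_card_of_nodup hL.nodup_exponents, length_exponents] at hs
  omega

lemma size_shift (f : K) (L : List (K × ℕ)) : size (shift f L) = size L := by
  simp [size, shift, Function.comp_def]

lemma shift_shift (f g : K) (L : List (K × ℕ)) : shift f (shift g L) = shift (g + f) L := by
  simp [shift, add_assoc]

lemma shift_zero (L : List (K × ℕ)) : shift 0 L = L := by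
  simp [shift]

lemma Nonresonant.shift {L : List (K × ℕ)} (h : Nonresonant L) (f : K) :
    Nonresonant (shift f L) := by
  refine List.pairwise_map.2 (List.Pairwise.imp ?_ h)
  intro a b hab ha hb
  simpa using hab ha hb

lemma NotInt.add_int {z : K} (h : NotInt z) (k : ℤ) : NotInt (z + k) := fun l hl =>
  h (l - k) (by push_cast; rw [← hl]; ring)

lemma NotInt.neg {z : K} (h : NotInt z) : NotInt (-z) := fun l hl =>
  h (-l) (by push_cast; rw [← hl]; ring)

lemma notInt_shift {L : List (K × ℕ)} {f : K} (h : ∀ b ∈ L, 0 < b.2 → NotInt (b.1 + f)) :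
    ∀ b ∈ shift f L, 0 < b.2 → NotInt b.1 := by
  intro b hb hpos
  obtain ⟨b, hb', rfl⟩ := List.mem_map.1 hb
  exact h b hb' hpos

lemma Nonresonant.zero_cons {L : List (K × ℕ)} (h : Nonresonant L)
    (hL : ∀ b ∈ L, 0 < b.2 → NotInt b.1) (m : ℕ) : Nonresonant ((0, m) :: L) := by
  refine List.pairwise_cons.2 ⟨fun b hb _ hpos => ?_, h⟩
  rw [zero_sub]; exact (hL b hb hpos).neg

/-- The indicial polynomial at the origin of an operator whose leading coefficient vanishes there to
the order `v`. -/
def indicial (v : ℕ) (P : K[X][X]) : K[X] :=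
  ∑ b ∈ Finset.range (P.natDegree + 1),
    C (if P.natDegree ≤ b + v then (P.coeff b).coeff (b + v - P.natDegree) else 0) *
      descPochhammer K b

lemma natDegree_indicial {v : ℕ} {P : K[X][X]} (h : (P.coeff P.natDegree).coeff v ≠ 0) :
    (indicial v P).natDegree = P.natDegree := by
  rw [indicial, Finset.sum_range_succ, if_pos (by omega), Nat.add_sub_cancel_left]
  have h1 : (C ((P.coeff P.natDegree).coeff v) * descPochhammer K P.natDegree).natDegree =
      P.natDegree := by
    rw [natDegree_C_mul h, descPochhammer_natDegree]
  rcases Nat.eq_zero_or_pos P.natDegree with h0 | h0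
  · rw [h0] at h1 ⊢
    rw [Finset.sum_range_zero, zero_add]; exact h1
  · rw [natDegree_add_eq_right_of_natDegree_lt]
    · exact h1
    · rw [h1]
      refine lt_of_le_of_lt (natDegree_sum_le_of_forall_le (n := P.natDegree - 1) _ _ fun b hb => ?_)
        (by omega)
      refine (natDegree_C_mul_le _ _).trans ?_
      rw [descPochhammer_natDegree]
      have := Finset.mem_range.1 hb
      omega

lemma ev_fin_eq_indicial (ρ : K) (v : ℕ) (P : K[X][X]) (l : ℤ) :
    ev S (Y ρ) P (Finsupp.single l 1) (l + v - P.natDegree) = (indicial v P).eval (ρ + l) := by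
  rw [ev_fin_single ρ P (M := degX P + v + 1) (N := P.natDegree + 1) (by omega) (by omega), indicial,
    eval_finsetSum]
  refine Finset.sum_congr rfl fun b hb => ?_
  have hb' := Finset.mem_range.1 hb
  rw [eval_mul, eval_C]
  split_ifs with h
  · rw [Finset.sum_eq_single (b + v - P.natDegree)]
    · rw [if_pos (by omega)]
    · intro a _ ha
      rw [if_neg (by omega)]
    · intro h'
      exact absurd (Finset.mem_range.2 (by omega)) h'
  · rw [zero_mul]
    refine Finset.sum_eq_zero fun a _ => ?_
    rw [if_neg (by omega)]

lemma FinExp.indicial_eval {v : ℕ} {P : K[X][X]} {L : List (K × ℕ)} (h : FinExp v P L) :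
    ∀ b ∈ L, ∀ j < b.2, (indicial v P).eval (b.1 + (j : K)) = 0 := by
  intro b hb j hj
  have h1 := h.blocks b hb (by omega) _ (single_mem_F (n := (j : ℤ)) (by omega) (1 : K))
  have h2 := mem_F.1 h1 (j + v - P.natDegree) (by omega)
  rw [ev_fin_eq_indicial] at h2
  exact_mod_cast h2

lemma FinExp.indicial_ne_zero {v : ℕ} {P : K[X][X]} {L : List (K × ℕ)} (h : FinExp v P L) :
    indicial v P ≠ 0 := by
  intro h0
  have h1 := natDegree_indicial h.lead
  rw [h0, natDegree_zero] at h1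
  have h2 := h.lead
  rw [indicial, ← h1, zero_add, Finset.sum_range_one, if_pos (by omega)] at h0
  rw [← h1] at h2
  simp [h2] at h0

lemma FinExp.size_le [CharZero K] {v : ℕ} {P : K[X][X]} {L : List (K × ℕ)} (h : FinExp v P L)
    (hL : Nonresonant L) : size L ≤ P.natDegree := by
  rw [← natDegree_indicial h.lead]
  exact size_le_natDegree hL h.indicial_ne_zero h.indicial_eval

lemma descPochhammer_eval_eq_zero {b n : ℕ} (h : n < b) : (descPochhammer K b).eval (n : K) = 0 := by
  rw [descPochhammer_eval_eq_descFactorial, Nat.descFactorial_eq_zero_iff_lt.2 h, Nat.cast_zero]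

/-- Polynomials are mapped to polynomials. -/
lemma ev_fin_zero_mem (P : K[X][X]) {f : ℤ →₀ K} (hf : f ∈ F 0) : ev S (Y 0) P f ∈ F 0 := by
  refine map_F_le (fun n hn => mem_F.2 fun l hl => ?_) hf
  obtain ⟨n, rfl⟩ := Int.eq_ofNat_of_zero_le hn
  rw [ev_fin_single 0 P (Nat.lt_succ_self _) (Nat.lt_succ_self _)]
  refine Finset.sum_eq_zero fun b _ => Finset.sum_eq_zero fun a _ => ?_
  split_ifs with h
  · rw [zero_add, Int.cast_natCast, descPochhammer_eval_eq_zero (by omega), mul_zero]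
  · rfl

lemma ev_fin_zero_single_apply (P : K[X][X]) (b : ℕ) :
    ev S (Y 0) P (Finsupp.single (b : ℤ) (1 : K)) 0 = (P.coeff b).coeff 0 * (b.factorial : K) := by
  rw [ev_fin_single 0 P (N := P.natDegree + b + 1) (by omega) (Nat.lt_succ_self _),
    Finset.sum_eq_single b, Finset.sum_eq_single 0]
  · rw [if_pos (by omega), zero_add, Int.cast_natCast, descPochhammer_eval_eq_descFactorial,
      Nat.descFactorial_self]
  · intro a _ ha
    rw [if_neg (by omega)]
  · intro h; exact absurd (Finset.mem_range.2 (by omega)) h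
  · intro b' _ hb
    refine Finset.sum_eq_zero fun a _ => ?_
    split_ifs with h
    · rw [zero_add, Int.cast_natCast, descPochhammer_eval_eq_zero (by omega), mul_zero]
    · rfl
  · intro h; exact absurd (Finset.mem_range.2 (by omega)) h

/-- If the coefficients do not all vanish at the origin, then the leading coefficient vanishes there
to the order given by the number of the nonintegral exponents. -/
lemma FinExp.order_eq [CharZero K] {v m₀ : ℕ} {P : K[X][X]} {L : List (K × ℕ)}
    (h : FinExp v P ((0, m₀) :: L)) (hL : Nonresonant ((0, m₀) :: L))
    (hs : size ((0, m₀) :: L) = P.natDegree) (hNI : ∀ b ∈ L, 0 < b.2 → NotInt b.1)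
    (hP : ∃ b, (P.coeff b).coeff 0 ≠ 0) : v = size L := by
  have hs' : m₀ + size L = P.natDegree := by rw [← hs]; simp [size]
  suffices m₀ + v = P.natDegree by omega
  obtain ⟨b, hb⟩ := hP
  refine le_antisymm (not_lt.1 fun hlt => hb ?_) (not_lt.1 fun hlt => ?_)
  · rcases Nat.eq_zero_or_pos m₀ with h0 | hpos
    · exact h.diag 0 b (by omega)
    · have h1 := h.blocks (0, m₀) List.mem_cons_self hpos _ (single_mem_F (n := (b : ℤ)) (by omega) (1 : K))
      have h2 := mem_F.1 h1 0 (by simp only; omega)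
      rw [ev_fin_zero_single_apply] at h2
      exact (mul_eq_zero.1 h2).resolve_right (Nat.cast_ne_zero.2 b.factorial_ne_zero)
  · have h1 := ev_fin_zero_mem P (single_mem_F (n := (m₀ : ℤ)) (by omega) (1 : K))
    have h2 := mem_F.1 h1 (m₀ + v - P.natDegree) (by omega)
    rw [ev_fin_eq_indicial, zero_add, Int.cast_natCast] at h2
    obtain ⟨b', hb', j, hj, e⟩ := exists_exponent_of_root hL h.indicial_ne_zero h.indicial_eval
      (by rw [natDegree_indicial h.lead, hs]) h2
    rcases List.mem_cons.1 hb' with rfl | hb'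
    · simp only [zero_add, Nat.cast_inj] at e hj
      omega
    · refine hNI b' hb' (by omega) ((m₀ : ℤ) - j) ?_
      push_cast; rw [← e]; ring

lemma rootMultiplicity_eq_of_finExp {v : ℕ} {P : K[X][X]} {c : K} {L : List (K × ℕ)}
    (h : FinExp v (translate c P) L) : P.leadingCoeff.rootMultiplicity c = v := by
  have h1 : ∀ i, ((translate c P).coeff (translate c P).natDegree).coeff i =
      (taylor c P.leadingCoeff).coeff i := fun i => by
    rw [natDegree_translate, coeff_translate]; rfl
  rw [rootMultiplicity_eq_natTrailingDegree, ← taylor_apply]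
  have h2 := h.lead
  rw [h1] at h2
  refine le_antisymm (natTrailingDegree_le_of_ne_zero h2) (le_natTrailingDegree ?_ fun i hi => ?_)
  · intro h0; rw [h0] at h2; simp at h2
  · rw [← h1]
    exact h.diag _ _ (by omega)

end

/-! ### Exponents under the elementary transformations -/

section

variable {K : Type*} [Field K]

lemma HasExponentsAt.of_sim {P P' : K[X][X]} {c : K} {L : List (K × ℕ)} (h : HasExponentsAt P c L)
    (hs : Sim P' P) : HasExponentsAt P' c L := by
  obtain ⟨h1, h2, v, h3⟩ := hasExponentsAt_iff.1 h
  exact hasExponentsAt_iff.2 ⟨h1, by rw [h2, hs.natDegree_eq], h3.of_sim (hs.translate c)⟩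

lemma HasExponentsAtInfty.of_sim {P P' : K[X][X]} {L : List (K × ℕ)} (h : HasExponentsAtInfty P L)
    (hs : Sim P' P) : HasExponentsAtInfty P' L := by
  obtain ⟨h1, h2⟩ := hasExponentsAtInfty_iff.1 h
  exact hasExponentsAtInfty_iff.2 ⟨h1, h2.of_sim hs⟩

lemma HasExponentsAt.perm {P : K[X][X]} {c : K} {L L' : List (K × ℕ)} (h : HasExponentsAt P c L)
    (hs : L.Perm L') : HasExponentsAt P c L' := by
  obtain ⟨h1, h2, v, h3⟩ := hasExponentsAt_iff.1 h
  refine hasExponentsAt_iff.2 ⟨?_, ?_, v, h3.diag, h3.lead, fun b hb => h3.blocks b (hs.mem_iff.2 hb)⟩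
  · refine (hs.pairwise_iff ?_).1 h1
    intro a b hab ha hb
    have := (hab hb ha).neg
    rwa [neg_sub] at this
  · rw [← h2]; exact ((hs.map Prod.snd).sum_eq).symm

lemma translate_hasseDeriv (c : K) (k : ℕ) (P : K[X][X]) :
    translate c (hasseDeriv k P) = hasseDeriv k (translate c P) := by
  ext1 i
  rw [coeff_translate, hasseDeriv_coeff, hasseDeriv_coeff, coeff_translate, ← nsmul_eq_mul, map_nsmul,
    nsmul_eq_mul]

lemma translate_sum (c : K) {ι : Type*} (s : Finset ι) (f : ι → K[X][X]) :
    translate c (∑ i ∈ s, f i) = ∑ i ∈ s, translate c (f i) := by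
  rw [translate, Polynomial.map_sum]; rfl

lemma HasExponentsAt.sum_hasseDeriv [CharZero K] {P : K[X][X]} {c : K} {L : List (K × ℕ)}
    (h : HasExponentsAt P c L) {φ : ℕ → K[X]} (h0 : (φ 0).eval c ≠ 0) :
    HasExponentsAt (∑ k ∈ Finset.range (P.natDegree + 1), C (φ k) * hasseDeriv k P) c L := by
  obtain ⟨h1, h2, v, h3⟩ := hasExponentsAt_iff.1 h
  obtain ⟨hle, hco⟩ := coeff_sum_hasseDeriv φ (le_refl P.natDegree)
  have hP : P.leadingCoeff ≠ 0 := by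
    rw [leadingCoeff_ne_zero]
    rintro rfl
    have := h3.lead
    simp [translate] at this
  have hn : (∑ k ∈ Finset.range (P.natDegree + 1), C (φ k) * hasseDeriv k P).natDegree =
      P.natDegree := by
    refine le_antisymm hle (le_natDegree_of_ne_zero ?_)
    rw [hco]
    refine mul_ne_zero ?_ hP
    intro h; rw [h, eval_zero] at h0; exact h0 rfl
  refine hasExponentsAt_iff.2 ⟨h1, by rw [h2, hn], v, ?_⟩
  have h4 := h3.sum_hasseDeriv (φ := fun k => taylor c (φ k)) (by rwa [taylor_coeff_zero])
  rw [natDegree_translate] at h4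
  rw [translate_sum]
  simpa only [translate_C_mul, translate_hasseDeriv] using h4

lemma HasExponentsAt.substD [CharZero K] {P : K[X][X]} {c : K} {L : List (K × ℕ)}
    (h : HasExponentsAt P c L) (p : K[X]) :
    HasExponentsAt (substD (fun b : K[X] => derivative b) p P) c L := by
  obtain ⟨φ, h0, hφ⟩ := exists_substD_eq_sum p
  rw [hφ (le_refl P.natDegree)]
  exact h.sum_hasseDeriv (by rw [h0, eval_one]; exact one_ne_zero)

/-- An addition at another point does not change the exponents. -/
lemma HasExponentsAt.additionOp_of_ne [CharZero K] {P : K[X][X]} {c c' : K} {L : List (K × ℕ)}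
    (h : HasExponentsAt P c L) (hc : c ≠ c') (f : K) : HasExponentsAt (additionOp c' f P) c L := by
  refine h.sum_hasseDeriv (φ := fun k => C ((descPochhammer K k).eval (-f)) *
    (X - C c') ^ (P.natDegree - k)) ?_
  simpa using pow_ne_zero _ (sub_ne_zero.2 hc)

lemma translate_additionOp (c f : K) (P : K[X][X]) :
    translate c (additionOp c f P) = additionOp 0 f (translate c P) := by
  rw [additionOp, additionOp, translate_sum, natDegree_translate]
  refine Finset.sum_congr rfl fun k _ => ?_
  rw [translate_C_mul, translate_hasseDeriv]
  congr 2
  rw [taylor_mul, taylor_C, ← taylorAlgHom_apply, map_pow, taylorAlgHom_apply, map_sub, taylor_X,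
    taylor_C, add_sub_cancel_right, C_0, sub_zero]

lemma HasExponentsAt.additionOp_self [CharZero K] {P : K[X][X]} {c : K} {L : List (K × ℕ)}
    (h : HasExponentsAt P c L) (f : K) : HasExponentsAt (additionOp c f P) c (shift f L) := by
  obtain ⟨h1, h2, v, h3⟩ := hasExponentsAt_iff.1 h
  refine hasExponentsAt_iff.2 ⟨h1.shift f, ?_, (translate c P).natDegree + v, ?_⟩
  · rw [size_shift, h2, natDegree_additionOp]
  · rw [translate_additionOp]; exact h3.additionOp f

lemma HasExponentsAtInfty.additionOp [CharZero K] {P : K[X][X]} {L : List (K × ℕ)}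
    (h : HasExponentsAtInfty P L) (c f : K) :
    HasExponentsAtInfty (additionOp c f P) (shift (-f) L) := by
  obtain ⟨h1, h2⟩ := hasExponentsAtInfty_iff.1 h
  refine hasExponentsAtInfty_iff.2 ⟨h1.shift _, ?_⟩
  rw [size_shift]; exact h2.additionOp c f

/-- After a linear substitution at infinity the transform carries exponents to exponents. -/
lemma HasExponentsAtInfty.twist_four [CharZero K] {P : K[X][X]} {α β ε : K} {L : List (K × ℕ)}
    (h : HasExponentsAtInfty (twist α β P) L) (hε : ε * ε = 1) (hα : α ≠ 0) :
    HasExponentsAtInfty (twist (-α⁻¹) (-(ε * β * α⁻¹)) (four ε P)) L := by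
  obtain ⟨h1, h2⟩ := hasExponentsAtInfty_iff.1 h
  refine hasExponentsAtInfty_iff.2 ⟨h1, ?_⟩
  rw [TwistedEuler.twist_four hε hα]
  exact h2.shear
    (neg_ne_zero.2 (mul_ne_zero (ne_zero_of_mul_self_eq_one hε) (inv_ne_zero hα))) _ _

lemma natDegree_twist (α β : K) (P : K[X][X]) : (twist α β P).natDegree = P.natDegree :=
  (natDegree_substD _ P).1

lemma leadingCoeff_twist (α β : K) (P : K[X][X]) : (twist α β P).leadingCoeff = P.leadingCoeff :=
  (natDegree_substD _ P).2

lemma twist_ne_zero (α β : K) {P : K[X][X]} (hP : P ≠ 0) : twist α β P ≠ 0 := by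
  rw [← leadingCoeff_ne_zero, leadingCoeff_twist]; exact leadingCoeff_ne_zero.2 hP

lemma taylor_eq_sum_hasseDeriv {R : Type*} [CommRing R] (r : R) (p : R[X]) {n : ℕ}
    (hn : p.natDegree ≤ n) :
    taylor r p = ∑ k ∈ Finset.range (n + 1), C (r ^ k) * hasseDeriv k p := by
  conv_lhs => rw [p.as_sum_range' (n + 1) (by omega)]
  conv_rhs => rw [p.as_sum_range' (n + 1) (by omega)]
  simp only [map_sum, Finset.mul_sum]
  rw [Finset.sum_comm]
  refine Finset.sum_congr rfl fun i hi => ?_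
  have hi' := Finset.mem_range.1 hi
  rw [taylor_monomial, add_comm, add_pow, Finset.mul_sum,
    ← Finset.sum_subset (Finset.range_mono (by omega : i + 1 ≤ n + 1))]
  · refine Finset.sum_congr rfl fun k _ => ?_
    rw [hasseDeriv_monomial, ← C_mul_X_pow_eq_monomial]
    simp only [map_mul, map_pow, map_natCast]
    ring
  · intro k _ hk
    rw [Finset.mem_range] at hk
    rw [hasseDeriv_monomial, Nat.choose_eq_zero_of_lt (by omega), Nat.cast_zero, zero_mul,
      monomial_zero_right, mul_zero]

/-- A constant twist is a Taylor shift in the variable `∂`. -/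
lemma twist_zero_left (β : K) (P : K[X][X]) : twist 0 β P = taylor (C β) P := by
  rw [twist, C_0, zero_mul, zero_add, taylor_eq_sum_hasseDeriv (C β) P le_rfl]
  refine substD_eq_sum (δ := (derivative (R := K)).toAddMonoidHom) (fun a b => derivative_mul)
    (φ := fun k => C β ^ k) (pow_zero _) (fun k => ?_) le_rfl
  have : derivative (C β ^ k) = 0 := by rw [← C_pow, derivative_C]
  change _ = derivative (C β ^ k) + _
  rw [this, zero_add, pow_succ']

lemma coeff_twist_zero (β : K) (P : K[X][X]) (a b : ℕ) : ((twist 0 β P).coeff b).coeff a =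
    ∑ k ∈ Finset.range (P.natDegree + 1), β ^ k * (((b + k).choose k : K) * (P.coeff (b + k)).coeff a) := by
  rw [twist_zero_left, taylor_eq_sum_hasseDeriv (C β) P le_rfl, finsetSum_coeff, finsetSum_coeff]
  refine Finset.sum_congr rfl fun k _ => ?_
  rw [coeff_C_mul, hasseDeriv_coeff, ← C_pow, coeff_C_mul, ← nsmul_eq_mul, coeff_smul, nsmul_eq_mul]

lemma degX_twist_zero_le (β : K) (P : K[X][X]) : degX (twist 0 β P) ≤ degX P := by
  refine mem_filt_degX.1 fun a b h => ?_
  rw [coeff_twist_zero]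
  refine Finset.sum_eq_zero fun k _ => ?_
  rw [mem_filt_self P a _ (by simpa using h), mul_zero, mul_zero]

lemma degX_twist_zero (β : K) (P : K[X][X]) : degX (twist 0 β P) = degX P := by
  refine le_antisymm (degX_twist_zero_le β P) ?_
  have := degX_twist_zero_le (-β) (twist 0 β P)
  rwa [twist_twist, zero_add, neg_add_cancel, twist_zero] at this

lemma natDegree_xPart_le (P : K[X][X]) (s : ℕ) : (xPart P s).natDegree ≤ P.natDegree := by
  refine natDegree_le_iff_coeff_eq_zero.2 fun i hi => ?_
  rw [coeff_xPart, coeff_eq_zero_of_natDegree_lt hi, coeff_zero, ite_self]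

lemma coeff_xPart_zero (P : K[X][X]) (b : ℕ) : (xPart P 0).coeff b = (P.coeff b).coeff (degX P) := by
  rw [coeff_xPart, if_pos (Nat.zero_le _), Nat.sub_zero]

lemma xPart_twist_zero (β : K) (P : K[X][X]) : xPart (twist 0 β P) 0 = taylor β (xPart P 0) := by
  ext b
  rw [coeff_xPart_zero, degX_twist_zero, coeff_twist_zero,
    taylor_eq_sum_hasseDeriv β _ (natDegree_xPart_le P 0), finsetSum_coeff]
  refine Finset.sum_congr rfl fun k _ => ?_
  rw [coeff_C_mul, hasseDeriv_coeff, coeff_xPart_zero]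

/-! ### The transform and the exponents -/

lemma HasExponentsAtInfty.size_le [CharZero K] {R : K[X][X]} {L : List (K × ℕ)}
    (h : HasExponentsAtInfty R L) (hL : ∀ b ∈ L, 0 < b.2 → NotInt b.1) : size L ≤ degX R := by
  obtain ⟨h1, h2⟩ := hasExponentsAtInfty_iff.1 h
  have hR := ne_zero_of_coeff h2.lead
  have h3 := ((infExp_iff_finExp (ε := (1 : K)) (one_mul 1) hR hL).1 h2).size_le (h1.shift _)
  rwa [size_shift, natDegree_four one_ne_zero hR] at h3

/-- The transform carries the exponents of slope `0` at infinity to the nonintegral exponents at a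
finite point. -/
lemma HasExponentsAtInfty.four [CharZero K] {ε c : K} (hε : ε * ε = 1) {R : K[X][X]}
    {L : List (K × ℕ)} (h : HasExponentsAtInfty (twist 0 (-(ε * c)) R) L)
    (hL : ∀ b ∈ L, NotInt b.1) :
    HasExponentsAt (four ε R) c ((0, degX R - size L) :: shift (-1) L) := by
  have hL' : ∀ b ∈ L, 0 < b.2 → NotInt b.1 := fun b hb _ => hL b hb
  have hs := h.size_le hL'
  rw [degX_twist_zero] at hs
  obtain ⟨h1, h2⟩ := hasExponentsAtInfty_iff.1 h
  have hR := ne_zero_of_coeff h2.lead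
  have hR0 : R ≠ 0 := by
    rintro rfl
    rw [twist_zero_left, map_zero] at hR
    exact hR rfl
  have hn := natDegree_four (ne_zero_of_mul_self_eq_one hε) hR
  rw [degX_twist_zero] at hn
  have h3 := (infExp_iff_finExp hε hR hL').1 h2
  refine hasExponentsAt_iff.2 ⟨(h1.shift _).zero_cons (notInt_shift fun b hb _ => ?_) _, ?_,
    size L, ?_⟩
  · exact_mod_cast (hL b hb).add_int (-1)
  · have e : size ((0, degX R - size L) :: TwistedEuler.shift (-1) L) =
        degX R - size L + size (TwistedEuler.shift (-1) L) := by simp [size]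
    rw [e, size_shift, natDegree_four (ne_zero_of_mul_self_eq_one hε) hR0, Nat.sub_add_cancel hs]
  · rw [translate_four hε]
    refine ⟨h3.diag, h3.lead, fun b hb hpos f hf => ?_⟩
    rcases List.mem_cons.1 hb with rfl | hb
    · refine F_anti ?_ (ev_fin_zero_mem _ hf)
      rw [hn]; push_cast [Nat.cast_sub hs]; omega
    · exact h3.blocks b hb hpos f hf

/-- For a primitive operator the transform carries the nonintegral exponents at a finite point back
to the exponents of slope `0` at infinity. -/
lemma HasExponentsAt.of_four [CharZero K] {ε c : K} (hε : ε * ε = 1) {R : K[X][X]}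
    {L : List (K × ℕ)} {m : ℕ} (h : HasExponentsAt (four ε R) c ((0, m) :: L))
    (hP : Primitive (four ε R)) (hL : ∀ b ∈ L, 0 < b.2 → NotInt b.1) :
    HasExponentsAtInfty (twist 0 (-(ε * c)) R) (shift 1 L) := by
  obtain ⟨h1, h2, v, h3⟩ := hasExponentsAt_iff.1 h
  have hv := h3.order_eq h1 (by rw [h2, natDegree_translate]) hL (by
    obtain ⟨b, hb⟩ := hP c
    exact ⟨b, by rwa [coeff_translate, taylor_coeff_zero]⟩)
  rw [translate_four hε] at h3
  have hR : twist 0 (-(ε * c)) R ≠ 0 := by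
    intro h0
    have := ne_zero_of_coeff h3.lead
    rw [h0, TwistedEuler.four, map_zero, LinearMap.zero_apply] at this
    exact this rfl
  refine hasExponentsAtInfty_iff.2 ⟨Nonresonant.shift (List.pairwise_cons.1 h1).2 1, ?_⟩
  rw [size_shift, infExp_iff_finExp hε hR (notInt_shift fun b hb hpos => ?_), shift_shift,
    add_neg_cancel, shift_zero, ← hv]
  · exact ⟨h3.diag, h3.lead, fun b hb => h3.blocks b (List.mem_cons_of_mem _ hb)⟩
  · exact_mod_cast (hL b hb hpos).add_int 1

lemma HasExponentsAt.rootMultiplicity_eq [CharZero K] {P : K[X][X]} {c : K} {L : List (K × ℕ)}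
    {m : ℕ} (h : HasExponentsAt P c ((0, m) :: L)) (hP : Primitive P)
    (hL : ∀ b ∈ L, 0 < b.2 → NotInt b.1) : P.leadingCoeff.rootMultiplicity c = size L := by
  obtain ⟨h1, h2, v, h3⟩ := hasExponentsAt_iff.1 h
  rw [rootMultiplicity_eq_of_finExp h3]
  refine h3.order_eq h1 (by rw [h2, natDegree_translate]) hL ?_
  obtain ⟨b, hb⟩ := hP c
  exact ⟨b, by rwa [coeff_translate, taylor_coeff_zero]⟩

/-! ### Ordinary points -/

lemma Sim.leadingCoeff {P Q : K[X][X]} (h : Sim P Q) :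
    ∃ u v : K[X], u ≠ 0 ∧ v ≠ 0 ∧ C u * P = C v * Q ∧ u * P.leadingCoeff = v * Q.leadingCoeff := by
  obtain ⟨u, v, hu, hv, e⟩ := h
  refine ⟨u, v, hu, hv, e, ?_⟩
  have := congrArg Polynomial.leadingCoeff e
  rwa [leadingCoeff_mul, leadingCoeff_mul, leadingCoeff_C, leadingCoeff_C] at this

lemma Primitive.leadingCoeff_eval_ne_zero {P Q : K[X][X]} (hP : Primitive P) (hs : Sim P Q) {z : K}
    (hQ : Q.leadingCoeff.eval z ≠ 0) : P.leadingCoeff.eval z ≠ 0 := by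
  obtain ⟨u, v, hu, hv, e, hl⟩ := hs.leadingCoeff
  have hQ0 : Q.leadingCoeff ≠ 0 := by intro h; rw [h, eval_zero] at hQ; exact hQ rfl
  have hP0 : P.leadingCoeff ≠ 0 := by
    intro h; rw [h, mul_zero] at hl; exact mul_ne_zero hv hQ0 hl.symm
  have h1 := congrArg (rootMultiplicity z) hl
  rw [rootMultiplicity_mul (mul_ne_zero hu hP0), rootMultiplicity_mul (mul_ne_zero hv hQ0),
    rootMultiplicity_eq_zero (p := Q.leadingCoeff) hQ, add_zero] at h1
  obtain ⟨b, hb⟩ := hP z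
  intro h0
  have hpos : 0 < P.leadingCoeff.rootMultiplicity z := (rootMultiplicity_pos hP0).2 h0
  have hPb : P.coeff b ≠ 0 := by intro h; rw [h, eval_zero] at hb; exact hb rfl
  have h2 : u * P.coeff b = v * Q.coeff b := by rw [← coeff_C_mul, e, coeff_C_mul]
  have h3 := congrArg (rootMultiplicity z) h2
  have hQb : v * Q.coeff b ≠ 0 := by rw [← h2]; exact mul_ne_zero hu hPb
  rw [rootMultiplicity_mul (mul_ne_zero hu hPb), rootMultiplicity_mul hQb,
    rootMultiplicity_eq_zero (p := P.coeff b) hb] at h3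
  omega

lemma IsOrdinaryAt.of_eval_ne_zero {P : K[X][X]} {z : K} (h : P.leadingCoeff.eval z ≠ 0) :
    IsOrdinaryAt P z := ⟨P, ⟨1, one_ne_zero, by rw [C_1, one_mul]⟩, h⟩

lemma isOrdinaryAt_iff {P : K[X][X]} {z : K} (hP : P ≠ 0) :
    IsOrdinaryAt P z ↔ ∃ Q, Sim P Q ∧ Q.leadingCoeff.eval z ≠ 0 := by
  rw [IsOrdinaryAt]
  exact exists_congr fun Q => and_congr_left fun _ => equivalent_iff_sim hP

lemma IsOrdinaryAt.leadingCoeff_eval_ne_zero {P P' : K[X][X]} {z : K} (h : IsOrdinaryAt P z)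
    (hP : P ≠ 0) (hs : Sim P' P) (hP' : Primitive P') : P'.leadingCoeff.eval z ≠ 0 := by
  obtain ⟨Q, hQ, h0⟩ := (isOrdinaryAt_iff hP).1 h
  exact hP'.leadingCoeff_eval_ne_zero (hs.trans hQ) h0

lemma IsOrdinaryAt.of_sim {P P' : K[X][X]} {z : K} (h : IsOrdinaryAt P z)
    (hP : P ≠ 0) (hs : Sim P' P) : IsOrdinaryAt P' z := by
  obtain ⟨Q, hQ, h0⟩ := (isOrdinaryAt_iff hP).1 h
  exact (isOrdinaryAt_iff (hs.ne_zero hP)).2 ⟨Q, hs.trans hQ, h0⟩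

lemma additionOp_C_mul (c f : K) {u : K[X]} (hu : u ≠ 0) (P : K[X][X]) :
    additionOp c f (C u * P) = C u * additionOp c f P := by
  have h : ∀ k, hasseDeriv k (C u * P) = C u * hasseDeriv k P := fun k => by
    rw [← smul_eq_C_mul, map_smul, smul_eq_C_mul]
  rw [additionOp, additionOp, natDegree_C_mul hu, Finset.mul_sum]
  exact Finset.sum_congr rfl fun k _ => by rw [h, mul_left_comm]

lemma Sim.additionOp {P Q : K[X][X]} (h : Sim P Q) (c f : K) :
    Sim (additionOp c f P) (additionOp c f Q) := by
  obtain ⟨u, v, hu, hv, e⟩ := h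
  exact ⟨u, v, hu, hv, by rw [← additionOp_C_mul c f hu, e, additionOp_C_mul c f hv]⟩

lemma IsOrdinaryAt.additionOp {P : K[X][X]} {z c : K} (h : IsOrdinaryAt P z) (hP : P ≠ 0)
    (hz : z ≠ c) (f : K) : IsOrdinaryAt (additionOp c f P) z := by
  obtain ⟨Q, hQ, h0⟩ := (isOrdinaryAt_iff hP).1 h
  refine (isOrdinaryAt_iff (additionOp_ne_zero c f hP)).2 ⟨_, hQ.additionOp c f, ?_⟩
  rw [TwistedEuler.leadingCoeff_additionOp, eval_mul]
  refine mul_ne_zero ?_ h0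
  simpa using pow_ne_zero _ (sub_ne_zero.2 hz)

lemma IsOrdinaryAt.twist {P : K[X][X]} {z : K} (h : IsOrdinaryAt P z) (hP : P ≠ 0) (α β : K) :
    IsOrdinaryAt (twist α β P) z := by
  obtain ⟨Q, hQ, h0⟩ := (isOrdinaryAt_iff hP).1 h
  refine (isOrdinaryAt_iff (twist_ne_zero α β hP)).2 ⟨_, hQ.substD _, ?_⟩
  rwa [(natDegree_substD _ Q).2]

end

/-! ### Newton polygons with slopes `0`, `1`, `2` -/

section

variable {K : Type*} [Field K]

/-- The half-plane `a x + b y ≥ c`. -/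
def halfPlane (a b c : ℝ) : Set (ℝ × ℝ) := {z | c ≤ a * z.1 + b * z.2}

lemma convex_halfPlane (a b c : ℝ) : Convex ℝ (halfPlane a b c) :=
  convex_halfSpace_ge (f := fun z : ℝ × ℝ => a * z.1 + b * z.2)
    ⟨fun x y => by simp; ring, fun r x => by simp; ring⟩ c

lemma quadrant_subset_halfPlane {a b c u v : ℝ} (ha : a ≤ 0) (hb : 0 ≤ b) :
    quadrant u v ⊆ halfPlane a b c ↔ c ≤ a * u + b * v := by
  constructor
  · intro h; exact h (show ((u, v) : ℝ × ℝ) ∈ quadrant u v from ⟨le_rfl, le_rfl⟩)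
  · rintro h ⟨x, y⟩ ⟨hx, hy⟩
    have h1 := mul_le_mul_of_nonpos_left hx ha
    have h2 := mul_le_mul_of_nonneg_left hy hb
    simp only [halfPlane, Set.mem_ofPred_eq]
    simp only at h1 h2
    linarith

lemma newtonPolygon_subset_halfPlane {P : K[X][X]} {a b c : ℝ} (ha : a ≤ 0) (hb : 0 ≤ b) :
    newtonPolygon P ⊆ halfPlane a b c ↔
      ∀ i ∈ P.support, c ≤ a * i + b * ((i : ℝ) - ((P.coeff i).natDegree : ℝ)) := by
  rw [newtonPolygon, (convex_halfPlane a b c).convexHull_subset_iff, Set.iUnion₂_subset_iff]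
  exact forall₂_congr fun i _ => quadrant_subset_halfPlane ha hb

/-- The region bounded from below by segments of slopes `0`, `1`, `2` and of lengths `l₀`, `l₁`,
`l₂`, starting at the height `v`. -/
def slopeRegion (v l₀ l₁ l₂ : ℝ) : Set (ℝ × ℝ) :=
  convexHull ℝ (quadrant l₀ v ∪ quadrant (l₀ + l₁) (v + l₁) ∪
    quadrant (l₀ + l₁ + l₂) (v + l₁ + 2 * l₂))

lemma slopeRegion_subset_halfPlane {v l₀ l₁ l₂ a b c : ℝ} (ha : a ≤ 0) (hb : 0 ≤ b) :
    slopeRegion v l₀ l₁ l₂ ⊆ halfPlane a b c ↔ c ≤ a * l₀ + b * v ∧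
      c ≤ a * (l₀ + l₁) + b * (v + l₁) ∧ c ≤ a * (l₀ + l₁ + l₂) + b * (v + l₁ + 2 * l₂) := by
  rw [slopeRegion, (convex_halfPlane a b c).convexHull_subset_iff, Set.union_subset_iff,
    Set.union_subset_iff, quadrant_subset_halfPlane ha hb, quadrant_subset_halfPlane ha hb,
    quadrant_subset_halfPlane ha hb, and_assoc]

/-- A quadrant whose corner lies above a segment is contained in the convex hull of the quadrants at
the ends of the segment. -/
lemma quadrant_subset_convexHull {u v w h x y t : ℝ} {A : Set (ℝ × ℝ)} (h1 : quadrant u v ⊆ A)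
    (h2 : quadrant (u + w) (v + h) ⊆ A) (ht0 : 0 ≤ t) (ht1 : t ≤ 1) (hx : x ≤ u + t * w)
    (hy : v + t * h ≤ y) : quadrant x y ⊆ convexHull ℝ A := by
  rintro ⟨p, q⟩ ⟨hp, hq⟩
  simp only at hp hq
  have e1 : ((p - t * w, q - t * h) : ℝ × ℝ) ∈ A := h1 ⟨by simp only; linarith, by simp only; linarith⟩
  have e2 : ((p - t * w + w, q - t * h + h) : ℝ × ℝ) ∈ A :=
    h2 ⟨by simp only; linarith, by simp only; linarith⟩
  have := (convex_convexHull ℝ A) (subset_convexHull ℝ A e1) (subset_convexHull ℝ A e2)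
    (a := 1 - t) (b := t) (by linarith) ht0 (by ring)
  have e : (1 - t) • ((p - t * w, q - t * h) : ℝ × ℝ) + t • ((p - t * w + w, q - t * h + h) : ℝ × ℝ) =
      (p, q) := by
    ext <;> simp <;> ring
  rwa [e] at this

lemma quadrant_subset_slopeRegion {v l₀ l₁ l₂ x y : ℝ} (h1 : 0 ≤ l₁) (h2 : 0 ≤ l₂)
    (hx : x ≤ l₀ + l₁ + l₂) (hy0 : v ≤ y) (hy1 : v - l₀ ≤ y - x)
    (hy2 : v + l₁ - 2 * (l₀ + l₁) ≤ y - 2 * x) : quadrant x y ⊆ slopeRegion v l₀ l₁ l₂ := by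
  set A := quadrant l₀ v ∪ quadrant (l₀ + l₁) (v + l₁) ∪ quadrant (l₀ + l₁ + l₂) (v + l₁ + 2 * l₂)
  have hA : quadrant l₀ v ⊆ A := fun z hz => Or.inl (Or.inl hz)
  have hB : quadrant (l₀ + l₁) (v + l₁) ⊆ A := fun z hz => Or.inl (Or.inr hz)
  have hC : quadrant (l₀ + l₁ + l₂) (v + l₁ + 2 * l₂) ⊆ A := fun z hz => Or.inr hz
  rcases le_or_gt x l₀ with h | h
  · exact quadrant_subset_convexHull hA hB le_rfl zero_le_one (by simpa using h) (by simpa using hy0)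
  rcases le_or_gt x (l₀ + l₁) with h' | h'
  · have hpos : 0 < l₁ := by linarith
    refine quadrant_subset_convexHull (t := (x - l₀) / l₁) hA hB (div_nonneg (by linarith) h1) ?_ ?_ ?_
    · rw [div_le_one hpos]; linarith
    · rw [div_mul_cancel₀ _ hpos.ne']; linarith
    · rw [div_mul_cancel₀ _ hpos.ne']; linarith
  · have hpos : 0 < l₂ := by linarith
    refine quadrant_subset_convexHull (t := (x - (l₀ + l₁)) / l₂) hB hC
      (div_nonneg (by linarith) h2) ?_ ?_ ?_
    · rw [div_le_one hpos]; linarith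
    · rw [div_mul_cancel₀ _ hpos.ne']; linarith
    · have : (x - (l₀ + l₁)) / l₂ * (2 * l₂) = 2 * (x - (l₀ + l₁)) := by field_simp
      rw [this]; linarith

/-- A strictly supporting line of the Newton polygon meets one of the defining corners. -/
lemma exists_corner {P : K[X][X]} {a b c : ℝ} (ha : a ≤ 0) (hb : 0 ≤ b)
    (hP : newtonPolygon P ⊆ halfPlane a b c) {z : ℝ × ℝ} (hz : z ∈ newtonPolygon P)
    (hzc : a * z.1 + b * z.2 = c) :
    ∃ i ∈ P.support, a * i + b * ((i : ℝ) - ((P.coeff i).natDegree : ℝ)) = c := by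
  by_contra! hne
  rw [newtonPolygon_subset_halfPlane ha hb] at hP
  have hlt : ∀ i ∈ P.support, c < a * i + b * ((i : ℝ) - ((P.coeff i).natDegree : ℝ)) :=
    fun i hi => lt_of_le_of_ne (hP i hi) (hne i hi).symm
  have hne' : P.support.Nonempty := by
    rw [Finset.nonempty_iff_ne_empty]
    intro h
    simp [newtonPolygon, h] at hz
  obtain ⟨i, hi, hmin⟩ := Finset.exists_min_image P.support
    (fun i => a * (i : ℝ) + b * ((i : ℝ) - ((P.coeff i).natDegree : ℝ))) hne'
  have := (newtonPolygon_subset_halfPlane ha hb).2 hmin hz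
  simp only [halfPlane, Set.mem_ofPred_eq, hzc] at this
  exact absurd (hlt i hi) (not_lt.2 this)

/-- The Newton polygon has slopes `0`, `1`, `2` of the given lengths if and only if its vertices, with the
abscissas `l₀`, `l₀ + l₁` and `l₀ + l₁ + l₂`, come from monomials of `P` and all monomials satisfy the
inequalities of the edges. -/
theorem hasSlopes_iff {P : K[X][X]} (hP : P ≠ 0) {l₀ l₁ l₂ : ℕ} : HasSlopes P l₀ l₁ l₂ ↔
    P.natDegree = l₀ + l₁ + l₂ ∧ P.leadingCoeff.natDegree + l₂ = degX P ∧
    (P.coeff l₀).coeff (degX P) ≠ 0 ∧ (P.coeff (l₀ + l₁)).coeff (degX P) ≠ 0 ∧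
    P ∈ filt 1 (-1) ((degX P : ℤ) - l₀) ∧ P ∈ filt 1 1 ((degX P : ℤ) + (l₀ + l₁ : ℕ)) := by
  have hl1 : (0 : ℝ) ≤ l₁ := Nat.cast_nonneg _
  have hl2 : (0 : ℝ) ≤ l₂ := Nat.cast_nonneg _
  have hsupp : ∀ {i}, i ∈ P.support → P.coeff i ≠ 0 := fun h => mem_support_iff.1 h
  have hDle : ∀ i, (P.coeff i).natDegree ≤ degX P := fun i => by
    by_cases h : P.coeff i = 0
    · rw [h, natDegree_zero]; exact Nat.zero_le _
    · exact Finset.le_sup (f := fun i => (P.coeff i).natDegree) (mem_support_iff.2 h)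
  have hcoef : ∀ {i}, i ∈ P.support → (P.coeff i).natDegree = degX P →
      (P.coeff i).coeff (degX P) ≠ 0 := fun hi h => by
    rw [← h]; exact leadingCoeff_ne_zero.2 (hsupp hi)
  constructor
  · rintro ⟨v, hv⟩
    change newtonPolygon P = slopeRegion v l₀ l₁ l₂ at hv
    have hH : ∀ {a b c : ℝ}, a ≤ 0 → 0 ≤ b → c ≤ a * l₀ + b * v →
        c ≤ a * (l₀ + l₁) + b * (v + l₁) → c ≤ a * (l₀ + l₁ + l₂) + b * (v + l₁ + 2 * l₂) →
        ∀ i ∈ P.support, c ≤ a * i + b * ((i : ℝ) - ((P.coeff i).natDegree : ℝ)) := by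
      intro a b c ha hb h1 h2 h3
      rw [← newtonPolygon_subset_halfPlane ha hb, hv, slopeRegion_subset_halfPlane ha hb]
      exact ⟨h1, h2, h3⟩
    have hH' : ∀ {a b c x y : ℝ}, a ≤ 0 → 0 ≤ b → c ≤ a * l₀ + b * v →
        c ≤ a * (l₀ + l₁) + b * (v + l₁) → c ≤ a * (l₀ + l₁ + l₂) + b * (v + l₁ + 2 * l₂) →
        ((x, y) : ℝ × ℝ) ∈ slopeRegion v l₀ l₁ l₂ → a * x + b * y = c →
        ∃ i ∈ P.support, a * i + b * ((i : ℝ) - ((P.coeff i).natDegree : ℝ)) = c := by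
      intro a b c x y ha hb h1 h2 h3 hz hzc
      rw [← hv] at hz
      refine exists_corner ha hb ?_ hz hzc
      rw [hv, slopeRegion_subset_halfPlane ha hb]
      exact ⟨h1, h2, h3⟩
    have hsub := subset_convexHull ℝ (quadrant (l₀ : ℝ) v ∪ quadrant ((l₀ : ℝ) + l₁) (v + l₁) ∪
      quadrant ((l₀ : ℝ) + l₁ + l₂) (v + l₁ + 2 * l₂))
    have mA : ((l₀ : ℝ), v) ∈ slopeRegion v l₀ l₁ l₂ := hsub (Or.inl (Or.inl ⟨le_rfl, le_rfl⟩))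
    have mB : ((l₀ : ℝ) + l₁, v + l₁) ∈ slopeRegion v l₀ l₁ l₂ :=
      hsub (Or.inl (Or.inr ⟨le_rfl, le_rfl⟩))
    have mC : ((l₀ : ℝ) + l₁ + l₂, v + l₁ + 2 * l₂) ∈ slopeRegion v l₀ l₁ l₂ :=
      hsub (Or.inr ⟨le_rfl, le_rfl⟩)
    have b0 := hH (a := 0) (b := 1) (c := v) le_rfl zero_le_one (by linarith) (by linarith)
      (by linarith)
    have b1 := hH (a := -1) (b := 1) (c := v - l₀) (by norm_num) zero_le_one (by linarith)
      (by linarith) (by linarith)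
    have b2 := hH (a := -2) (b := 1) (c := v + l₁ - 2 * (l₀ + l₁)) (by norm_num) zero_le_one
      (by linarith) (by linarith) (by linarith)
    have b3 := hH (a := -1) (b := 0) (c := -(l₀ + l₁ + l₂)) (by norm_num) le_rfl (by linarith)
      (by linarith) (by linarith)
    obtain ⟨iA, hA, eA⟩ := hH' (a := -(1 / 2)) (b := 1) (c := v - l₀ / 2) (by norm_num) zero_le_one
      (by linarith) (by linarith) (by linarith) mA (by ring)
    obtain ⟨iB, hB, eB⟩ := hH' (a := -(3 / 2)) (b := 1) (c := v + l₁ - 3 * (l₀ + l₁) / 2)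
      (by norm_num) zero_le_one (by linarith) (by linarith) (by linarith) mB (by ring)
    obtain ⟨iC, hC, eC⟩ := hH' (a := -3) (b := 1) (c := v + l₁ + 2 * l₂ - 3 * (l₀ + l₁ + l₂))
      (by norm_num) zero_le_one (by linarith) (by linarith) (by linarith) mC (by ring)
    have A0 := b0 _ hA
    have A1 := b1 _ hA
    have B1 := b1 _ hB
    have B2 := b2 _ hB
    have C2 := b2 _ hC
    have C3 := b3 _ hC
    have iA' : iA = l₀ := by
      have : (iA : ℝ) = l₀ := by linarith
      exact_mod_cast this
    have iB' : iB = l₀ + l₁ := by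
      have : (iB : ℝ) = l₀ + l₁ := by linarith
      exact_mod_cast this
    have iC' : iC = l₀ + l₁ + l₂ := by
      have : (iC : ℝ) = l₀ + l₁ + l₂ := by linarith
      exact_mod_cast this
    subst iA' iB' iC'
    push_cast at eB eC
    have dA : ((P.coeff iA).natDegree : ℝ) = iA - v := by linarith
    have dA' : (P.coeff iA).natDegree = degX P := by
      refine le_antisymm (hDle _) (Finset.sup_le fun i hi => ?_)
      have := b1 i hi
      have : ((P.coeff i).natDegree : ℝ) ≤ (P.coeff iA).natDegree := by linarith
      exact_mod_cast this
    have hv' : v = (iA : ℝ) - degX P := by rw [← dA', dA]; ring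
    have dB' : (P.coeff (iA + l₁)).natDegree = degX P := by
      have : ((P.coeff (iA + l₁)).natDegree : ℝ) = degX P := by rw [hv'] at eB; linarith
      exact_mod_cast this
    have hn : P.natDegree = iA + l₁ + l₂ := by
      refine le_antisymm ?_ (le_natDegree_of_mem_supp _ hC)
      have := b3 _ (natDegree_mem_support_of_nonzero hP)
      have : (P.natDegree : ℝ) ≤ iA + l₁ + l₂ := by linarith
      exact_mod_cast this
    refine ⟨hn, ?_, hcoef hA dA', hcoef hB dB', ?_, ?_⟩
    · rw [Polynomial.leadingCoeff, hn]
      have : ((P.coeff (iA + l₁ + l₂)).natDegree : ℝ) + l₂ = degX P := by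
        rw [hv'] at eC; linarith
      exact_mod_cast this
    · refine mem_filt_one.2 fun b hb => ?_
      have := b0 b (mem_support_iff.2 hb)
      have : ((P.coeff b).natDegree : ℝ) + -1 * b ≤ degX P - iA := by rw [hv'] at this; linarith
      exact_mod_cast this
    · refine mem_filt_one.2 fun b hb => ?_
      have := b2 b (mem_support_iff.2 hb)
      have : ((P.coeff b).natDegree : ℝ) + 1 * b ≤ degX P + (iA + l₁) := by rw [hv'] at this; linarith
      exact_mod_cast this
  · rintro ⟨hn, hl, hcA, hcB, hf0, hf1⟩
    have hdeg : ∀ {i}, (P.coeff i).coeff (degX P) ≠ 0 →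
        i ∈ P.support ∧ (P.coeff i).natDegree = degX P := by
      intro i hi
      refine ⟨mem_support_iff.2 fun h => hi (by rw [h, coeff_zero]), ?_⟩
      exact le_antisymm (hDle i) (le_natDegree_of_ne_zero hi)
    obtain ⟨sA, dA⟩ := hdeg hcA
    obtain ⟨sB, dB⟩ := hdeg hcB
    have sC := natDegree_mem_support_of_nonzero hP
    refine ⟨(l₀ : ℝ) - degX P, ?_⟩
    change newtonPolygon P = slopeRegion _ l₀ l₁ l₂
    refine Set.Subset.antisymm ?_ ?_
    · refine convexHull_min (Set.iUnion₂_subset fun i hi => ?_) (convex_convexHull ℝ _)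
      refine quadrant_subset_slopeRegion hl1 hl2 ?_ ?_ ?_ ?_
      · have := le_natDegree_of_mem_supp i hi
        rw [hn] at this
        exact_mod_cast this
      · have := mem_filt_one.1 hf0 i (hsupp hi)
        have : (((P.coeff i).natDegree : ℤ) : ℝ) + -1 * i ≤ degX P - l₀ := by exact_mod_cast this
        push_cast at this; linarith
      · have : ((P.coeff i).natDegree : ℝ) ≤ degX P := by exact_mod_cast hDle i
        linarith
      · have := mem_filt_one.1 hf1 i (hsupp hi)
        have : (((P.coeff i).natDegree : ℤ) : ℝ) + 1 * i ≤ degX P + (l₀ + l₁) := by exact_mod_cast this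
        push_cast at this; linarith
    · have key : ∀ {i : ℕ} {x y : ℝ}, i ∈ P.support → x = i → y = (i : ℝ) - (P.coeff i).natDegree →
          quadrant x y ⊆ ⋃ i ∈ P.support, quadrant (i : ℝ) ((i : ℝ) - ((P.coeff i).natDegree : ℝ)) := by
        rintro i _ _ hi rfl rfl
        exact Set.subset_iUnion₂ (s := fun (i : ℕ) (_ : i ∈ P.support) =>
          quadrant (i : ℝ) ((i : ℝ) - ((P.coeff i).natDegree : ℝ))) i hi
      refine convexHull_mono (Set.union_subset (Set.union_subset (key sA rfl (by rw [dA]))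
        (key sB (by push_cast; ring) (by rw [dB]; push_cast; ring))) (key sC ?_ ?_))
      · rw [hn]; push_cast; ring
      · have : (P.leadingCoeff.natDegree : ℝ) + l₂ = degX P := by exact_mod_cast hl
        rw [Polynomial.leadingCoeff] at this
        rw [← this, hn]; push_cast; ring

lemma rankAtInftyLE_iff {P : K[X][X]} : RankAtInftyLE P 2 ↔
    P ∈ filt 1 1 ((P.leadingCoeff.natDegree : ℤ) + P.natDegree) := by
  rw [mem_filt_one]
  constructor
  · intro h b hb
    have hle := le_natDegree_of_ne_zero hb
    rcases hle.eq_or_lt with rfl | hlt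
    · rw [one_mul]; rfl
    · have := h (P.natDegree - b) (by omega) (by omega) (by rwa [Nat.sub_sub_self hle])
      rw [Nat.sub_sub_self hle, Nat.cast_sub hle] at this
      have : ((P.coeff b).natDegree : ℚ) + 1 * b ≤ P.leadingCoeff.natDegree + P.natDegree := by
        linarith
      exact_mod_cast this
  · intro h i _ hi hne
    have h1 := h _ hne
    rw [Nat.cast_sub hi] at h1
    have h2 : ((P.coeff (P.natDegree - i)).natDegree : ℚ) + 1 * (P.natDegree - i) ≤
        P.leadingCoeff.natDegree + P.natDegree := by exact_mod_cast h1
    linarith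

end

/-! ### Terms of highest degree in `x` -/

section

variable {K : Type*} [Field K]

lemma xPart_zero_ne_zero {P : K[X][X]} (hP : P ≠ 0) : xPart P 0 ≠ 0 := by
  obtain ⟨b, hb⟩ := exists_coeff_degX hP
  intro h
  rw [← coeff_xPart_zero, h, coeff_zero] at hb
  exact hb rfl

lemma xPart_C_mul {u : K[X]} (hu : u ≠ 0) {P : K[X][X]} (hP : P ≠ 0) :
    xPart (C u * P) 0 = C u.leadingCoeff * xPart P 0 := by
  ext b
  rw [coeff_xPart_zero, degX_C_mul hu hP, coeff_coeff_C_mul (mem_filt_self P), coeff_C_mul,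
    coeff_xPart_zero]

lemma Sim.xPart {P Q : K[X][X]} (h : Sim P Q) (hQ : Q ≠ 0) :
    ∃ κ : K, κ ≠ 0 ∧ xPart P 0 = C κ * xPart Q 0 := by
  have hP := h.ne_zero hQ
  obtain ⟨u, v, hu, hv, e⟩ := h
  have h1 := congrArg (fun R => TwistedEuler.xPart R 0) e
  simp only [xPart_C_mul hu hP, xPart_C_mul hv hQ] at h1
  have hu' := leadingCoeff_ne_zero.2 hu
  refine ⟨u.leadingCoeff⁻¹ * v.leadingCoeff,
    mul_ne_zero (inv_ne_zero hu') (leadingCoeff_ne_zero.2 hv), ?_⟩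
  rw [C_mul, mul_assoc, ← h1, ← mul_assoc, ← C_mul, inv_mul_cancel₀ hu', C_1, one_mul]

lemma xPart_additionOp (c f : K) {P : K[X][X]} (hP : P ≠ 0) :
    xPart (additionOp c f P) 0 = xPart P 0 := by
  ext b
  rw [coeff_xPart_zero, degX_additionOp c f hP, coeff_additionOp_degX, coeff_xPart_zero]

lemma natDegree_eq_of_coeff_mul {p q : K[X]} {w : ℕ → K} (hw : ∀ i, w i ≠ 0)
    (h : ∀ i, p.coeff i = w i * q.coeff i) : p.natDegree = q.natDegree := by
  have : ∀ i, p.coeff i = 0 ↔ q.coeff i = 0 := fun i => by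
    rw [h, mul_eq_zero, or_iff_right (hw i)]
  refine le_antisymm (natDegree_le_iff_coeff_eq_zero.2 fun i hi => ?_)
    (natDegree_le_iff_coeff_eq_zero.2 fun i hi => ?_)
  · exact (this i).2 (coeff_eq_zero_of_natDegree_lt hi)
  · exact (this i).1 (coeff_eq_zero_of_natDegree_lt hi)

/-- The leading coefficient of the transform of `P` is `P₀(-ε x)`, up to a constant. -/
lemma leadingCoeff_four {ε : K} (hε : ε ≠ 0) {P : K[X][X]} (hP : P ≠ 0) :
    (four ε P).leadingCoeff = C (ε ^ degX P) * (xPart P 0).comp (C (-ε) * X) := by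
  ext b
  rw [Polynomial.leadingCoeff, natDegree_four hε hP, coeff_four ε (mem_filt_self P), coeff_C_mul,
    comp_C_mul_X_coeff, coeff_xPart_zero]
  ring

lemma natDegree_leadingCoeff_four {ε : K} (hε : ε ≠ 0) {P : K[X][X]} (hP : P ≠ 0) :
    (four ε P).leadingCoeff.natDegree = (xPart P 0).natDegree := by
  refine natDegree_eq_of_coeff_mul (w := fun b => ε ^ degX P * (-ε) ^ b)
    (fun b => mul_ne_zero (pow_ne_zero _ hε) (pow_ne_zero _ (neg_ne_zero.2 hε))) fun b => ?_
  rw [Polynomial.leadingCoeff, natDegree_four hε hP, coeff_four ε (mem_filt_self P),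
    coeff_xPart_zero]

lemma natDegree_xPart_four {ε : K} (hε : ε * ε = 1) {P : K[X][X]} (hP : P ≠ 0) :
    (xPart (four ε P) 0).natDegree = P.leadingCoeff.natDegree := by
  have hε0 := ne_zero_of_mul_self_eq_one hε
  refine natDegree_eq_of_coeff_mul (w := fun b => (-ε) ^ P.natDegree * ε ^ b)
    (fun b => mul_ne_zero (pow_ne_zero _ (neg_ne_zero.2 hε0)) (pow_ne_zero _ hε0)) fun b => ?_
  rw [coeff_xPart_zero, degX_four hε hP, coeff_four' hε]
  rfl

/-! ### Normality at infinity -/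

/-- The part of slope at most `1` of the Newton polygon at infinity of `P(x, ∂ + α x)` has length
`k`, provided that the rank of irregularity of `P` is at most `2`. -/
def NormalAt (α : K) (k : ℕ) (P : K[X][X]) : Prop :=
  (xPart (twist α 0 P) 0).natDegree = k ∧
    degX (twist α 0 P) + k = P.leadingCoeff.natDegree + P.natDegree

/-- The rank of irregularity at infinity of `P` is at most `2`. -/
def RankLETwo (P : K[X][X]) : Prop :=
  P ∈ filt 1 1 ((P.leadingCoeff.natDegree : ℤ) + P.natDegree)

lemma twist_C_mul (α β : K) (u : K[X]) (P : K[X][X]) : twist α β (C u * P) = C u * twist α β P :=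
  substD_C_mul _ _ _

lemma normalAt_C_mul_iff {u : K[X]} (hu : u ≠ 0) {P : K[X][X]} (hP : P ≠ 0) {α : K} {k : ℕ} :
    NormalAt α k (C u * P) ↔ NormalAt α k P := by
  have hT := twist_ne_zero α 0 hP
  rw [NormalAt, NormalAt, twist_C_mul, xPart_C_mul hu hT,
    natDegree_C_mul (leadingCoeff_ne_zero.2 hu), degX_C_mul hu hT, leadingCoeff_mul,
    leadingCoeff_C, natDegree_mul hu (leadingCoeff_ne_zero.2 hP), natDegree_C_mul hu]
  refine and_congr_right fun _ => ?_
  omega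

lemma NormalAt.of_sim {P P' : K[X][X]} {α : K} {k : ℕ} (h : NormalAt α k P) (hP : P ≠ 0)
    (hs : Sim P' P) : NormalAt α k P' := by
  have hP' := hs.ne_zero hP
  obtain ⟨u, v, hu, hv, e⟩ := hs
  rwa [← normalAt_C_mul_iff hu hP', e, normalAt_C_mul_iff hv hP]

lemma rankLETwo_C_mul_iff {u : K[X]} (hu : u ≠ 0) {P : K[X][X]} (hP : P ≠ 0) :
    RankLETwo (C u * P) ↔ RankLETwo P := by
  rw [RankLETwo, RankLETwo, leadingCoeff_mul, leadingCoeff_C,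
    natDegree_mul hu (leadingCoeff_ne_zero.2 hP), natDegree_C_mul hu,
    ← C_mul_mem_filt_one hu (P := P)]
  push_cast
  rw [add_assoc]

lemma RankLETwo.of_sim {P P' : K[X][X]} (h : RankLETwo P) (hP : P ≠ 0) (hs : Sim P' P) :
    RankLETwo P' := by
  have hP' := hs.ne_zero hP
  obtain ⟨u, v, hu, hv, e⟩ := hs
  rwa [← rankLETwo_C_mul_iff hu hP', e, rankLETwo_C_mul_iff hv hP]

lemma twist_additionOp (α β c f : K) (P : K[X][X]) :
    twist α β (additionOp c f P) = additionOp c f (twist α β P) := substD_additionOp _ _ _ _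

lemma NormalAt.additionOp {P : K[X][X]} {α : K} {k : ℕ} (h : NormalAt α k P) (hP : P ≠ 0)
    (c f : K) : NormalAt α k (additionOp c f P) := by
  have hT := twist_ne_zero α 0 hP
  obtain ⟨h1, h2⟩ := h
  rw [NormalAt, twist_additionOp, xPart_additionOp c f hT, degX_additionOp c f hT,
    leadingCoeff_additionOp, natDegree_additionOp, natDegree_mul
      (pow_ne_zero _ (X_sub_C_ne_zero c)) (leadingCoeff_ne_zero.2 hP), natDegree_pow,
    natDegree_X_sub_C, mul_one, natDegree_twist]
  exact ⟨h1, by omega⟩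

lemma RankLETwo.additionOp {P : K[X][X]} (h : RankLETwo P) (hP : P ≠ 0) (c f : K) :
    RankLETwo (additionOp c f P) := by
  rw [RankLETwo, leadingCoeff_additionOp, natDegree_additionOp, natDegree_mul
      (pow_ne_zero _ (X_sub_C_ne_zero c)) (leadingCoeff_ne_zero.2 hP), natDegree_pow,
    natDegree_X_sub_C, mul_one]
  push_cast
  rw [add_assoc]
  exact additionOp_mem_filt (by norm_num) c f h

lemma NormalAt.twist {P : K[X][X]} {α α' α₀ : K} {k : ℕ} (h : NormalAt α k P) (hα : α' + α₀ = α) :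
    NormalAt α' k (twist α₀ 0 P) := by
  rw [NormalAt, twist_twist, add_zero, hα, leadingCoeff_twist, natDegree_twist]
  exact h

lemma twist_mem_filt {q k : ℤ} (hq : 1 ≤ q) (α β : K) {P : K[X][X]} (h : P ∈ filt 1 q k) :
    twist α β P ∈ filt 1 q k := by
  have := ev_mem_of_filt (F := filt (K := K) 1 q) (filt_mono 1 q) (x := xOp)
    (d := dOp + (α • xOp + algebraMap K _ β)) (p := 1) (q := q) (fun j m hm => xOp_mem hm)
    (fun j m hm => ?_) h (one_mem_filt 1 q)
  · rw [← ev_twist isWeyl_op, ev_xOp_dOp_one, zero_add] at this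
    exact this
  · refine Submodule.add_mem _ (dOp_mem (by omega) hm) (Submodule.add_mem _
      (Submodule.smul_mem _ α (filt_mono 1 q (by omega) (xOp_mem hm))) ?_)
    exact show β • m ∈ filt 1 q (j + q) from
      Submodule.smul_mem _ β (filt_mono 1 q (by omega) hm)

lemma RankLETwo.twist {P : K[X][X]} (h : RankLETwo P) (α β : K) : RankLETwo (twist α β P) := by
  rw [RankLETwo, leadingCoeff_twist, natDegree_twist]
  exact twist_mem_filt le_rfl α β h

/-- The transform acts on the slopes `α` by inversion. -/
lemma NormalAt.four {P : K[X][X]} {ε α : K} {k k₀ : ℕ} (h : NormalAt α k P) (h0 : NormalAt 0 k₀ P)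
    (hP : P ≠ 0) (hε : ε * ε = 1) (hα : α ≠ 0) : NormalAt (-α⁻¹) k (four ε P) := by
  have hε0 := ne_zero_of_mul_self_eq_one hε
  have hT := twist_ne_zero α 0 hP
  have ha : -(ε * α⁻¹) ≠ 0 := neg_ne_zero.2 (mul_ne_zero hε0 (inv_ne_zero hα))
  have e := twist_four hε hα 0 P
  rw [mul_zero, zero_mul, neg_zero] at e
  obtain ⟨h1, h2⟩ := h
  obtain ⟨h3, h4⟩ := h0
  rw [NormalAt, e, degX_shear ha _ _ hT, natDegree_leadingCoeff_four hε0 hP, natDegree_four hε0 hP]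
  rw [twist_zero] at h3 h4
  refine ⟨?_, by omega⟩
  rw [← h1]
  refine natDegree_eq_of_coeff_mul
    (w := fun b => (-(ε * α⁻¹)) ^ degX (TwistedEuler.twist α 0 P) * (-(ε * α⁻¹))⁻¹ ^ b)
    (fun b => mul_ne_zero (pow_ne_zero _ ha) (pow_ne_zero _ (inv_ne_zero ha))) fun b => ?_
  rw [coeff_xPart_zero, degX_shear ha _ _ hT, coeff_shear _ _ _ (mem_filt_self _), coeff_xPart_zero]

/-- The transform interchanges the degrees of `P₀` and of the leading coefficient. -/
lemma NormalAt.four_zero {P : K[X][X]} {ε : K} {k : ℕ} (h : NormalAt 0 k P) (hP : P ≠ 0)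
    (hε : ε * ε = 1) : NormalAt 0 P.leadingCoeff.natDegree (TwistedEuler.four ε P) := by
  have hε0 := ne_zero_of_mul_self_eq_one hε
  obtain ⟨h3, h4⟩ := h
  rw [NormalAt, twist_zero, natDegree_xPart_four hε hP, degX_four hε hP,
    natDegree_leadingCoeff_four hε0 hP, natDegree_four hε0 hP]
  rw [twist_zero] at h3 h4
  exact ⟨rfl, by omega⟩

lemma RankLETwo.four {P : K[X][X]} {ε : K} {k : ℕ} (h : RankLETwo P) (h0 : NormalAt 0 k P)
    (hP : P ≠ 0) (hε : ε * ε = 1) : RankLETwo (TwistedEuler.four ε P) := by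
  have hε0 := ne_zero_of_mul_self_eq_one hε
  obtain ⟨h3, h4⟩ := h0
  rw [twist_zero] at h3 h4
  rw [RankLETwo, natDegree_leadingCoeff_four hε0 hP, natDegree_four hε0 hP]
  refine filt_mono 1 1 ?_ (four_mem (by norm_num) ε h)
  omega

/-! ### Roots -/

lemma natDegree_eq_sum_rootMultiplicity [IsAlgClosed K] {ι : Type*} [Fintype ι] {c : ι → K}
    (hc : Function.Injective c) {p : K[X]} (h : ∀ z, p.eval z = 0 → ∃ i, z = c i) :
    p.natDegree = ∑ i, p.rootMultiplicity (c i) := by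
  classical
  rcases eq_or_ne p 0 with rfl | hp
  · simp
  rw [← splits_iff_card_roots.1 (IsAlgClosed.splits p), ← Multiset.sum_count_eq_card
    (s := Finset.univ.image c), Finset.sum_image fun i _ j _ h => hc h]
  · simp only [count_roots]
  · intro z hz
    obtain ⟨i, rfl⟩ := h z ((mem_roots hp).1 hz)
    exact Finset.mem_image_of_mem c (Finset.mem_univ i)

lemma exists_eq_of_root {ι : Type*} [Fintype ι] {c : ι → K}
    (hc : Function.Injective c) {p : K[X]} (hp : p ≠ 0)
    (h : p.natDegree ≤ ∑ i, p.rootMultiplicity (c i)) {z : K} (hz : p.eval z = 0) :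
    ∃ i, z = c i := by
  classical
  by_contra! hne
  have h1 : ∑ w ∈ insert z (Finset.univ.image c), p.roots.count w ≤ p.roots.card := by
    rw [← Multiset.toFinset_sum_count_eq]
    refine Finset.sum_le_sum_of_ne_zero fun w _ hw => ?_
    exact Multiset.mem_toFinset.2 (Multiset.count_ne_zero.1 hw)
  rw [Finset.sum_insert (by simpa using fun i => (hne i).symm),
    Finset.sum_image fun i _ j _ h => hc h] at h1
  simp only [count_roots] at h1
  have h2 := (rootMultiplicity_pos hp).2 hz
  have h3 := p.card_roots'
  omega

end

/-! ### Tables of local data and normality -/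

section

variable {K : Type*} [Field K]

lemma xPart_four {ε : K} (hε : ε * ε = 1) {P : K[X][X]} (hP : P ≠ 0) :
    xPart (four ε P) 0 = C ((-ε) ^ P.natDegree) * P.leadingCoeff.comp (C ε * X) := by
  ext b
  rw [coeff_xPart_zero, degX_four hε hP, coeff_four' hε, coeff_C_mul, comp_C_mul_X_coeff]
  rw [Polynomial.leadingCoeff]
  ring

lemma HasExponentsAtInfty.rootMultiplicity_eq {β : K} {R : K[X][X]} {L : List (K × ℕ)}
    (h : HasExponentsAtInfty (twist 0 β R) L) : (xPart R 0).rootMultiplicity β = size L := by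
  obtain ⟨-, h1, h2, -⟩ := h
  rw [xPart_twist_zero] at h2
  rw [rootMultiplicity_eq_natTrailingDegree, ← taylor_apply]
  refine le_antisymm (natTrailingDegree_le_of_ne_zero h2) (le_natTrailingDegree ?_ fun i hi => ?_)
  · intro h0; rw [h0] at h2; simp at h2
  · rw [← xPart_twist_zero]; exact h1 0 i (by omega)

lemma NormalAt.twist_const {P : K[X][X]} {α : K} {k : ℕ} (h : NormalAt α k P) (β : K) :
    NormalAt 0 k (TwistedEuler.twist α β P) := by
  have e : TwistedEuler.twist α β P = TwistedEuler.twist 0 β (TwistedEuler.twist α 0 P) := by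
    rw [twist_twist, zero_add, add_zero]
  rw [NormalAt, twist_zero, leadingCoeff_twist, natDegree_twist, e, xPart_twist_zero,
    natDegree_taylor, degX_twist_zero]
  exact h

/-- The number `e` of exponents of slope `0` and the degrees in `NormalAt` determine the Newton
polygon. -/
lemma hasSlopes_of_normalAt {R : K[X][X]} (hR : R ≠ 0) {e k : ℕ} (hr : RankLETwo R)
    (hN : NormalAt 0 k R) (hk : k ≤ R.natDegree) (he : e ≤ k)
    (h1 : (R.coeff e).coeff (degX R) ≠ 0) (h2 : R ∈ filt 1 (-1) ((degX R : ℤ) - e)) :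
    HasSlopes R e (k - e) (R.natDegree - k) := by
  rw [NormalAt, twist_zero] at hN
  obtain ⟨h3, h4⟩ := hN
  rw [hasSlopes_iff hR, Nat.add_sub_cancel' he]
  refine ⟨by omega, by omega, h1, ?_, h2, ?_⟩
  · rw [← coeff_xPart_zero, ← h3]
    exact leadingCoeff_ne_zero.2 (xPart_zero_ne_zero hR)
  · exact filt_mono 1 1 (by omega) hr

namespace LocalTable

variable {T : LocalTable K} {P P' : K[X][X]}

lemma nn_le_n {K : Type*} (T : LocalTable K) (i : Fin T.r) (j : Fin (T.l i)) : T.nn i j ≤ T.n i :=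
  Finset.single_le_sum (f := fun j => T.nn i j) (fun _ _ => Nat.zero_le _) (Finset.mem_univ j)

lemma n_le_order {K : Type*} (T : LocalTable K) (i : Fin T.r) : T.n i ≤ T.order :=
  Finset.single_le_sum (f := fun i => T.n i) (fun _ _ => Nat.zero_le _) (Finset.mem_univ i)

/-- The content of `IsTableOf`, with normality at infinity expressed by degrees instead of Newton
polygons. -/
structure HasLocalData (T : LocalTable K) (P : K[X][X]) : Prop where
  c_injective : Function.Injective T.c
  α_injective : Function.Injective T.α
  β_injective : ∀ i, Function.Injective (T.β i)
  order_pos : 0 < P.natDegree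
  order_eq : T.order = P.natDegree
  ordinary : ∀ z, (∀ i, z ≠ T.c i) → IsOrdinaryAt P z
  finite_exponents : ∀ i, ∃ m₀ : ℕ, HasExponentsAt P (T.c i) ((0, m₀) :: T.μ i)
  rank_le : RankLETwo P
  normal : ∀ i, NormalAt (T.α i) (T.n i) P
  infinite_exponents : ∀ i j, HasExponentsAtInfty (twist (T.α i) (T.β i j) P) (T.ν i j)

lemma HasLocalData.ne_zero (h : T.HasLocalData P) : P ≠ 0 := by
  rintro rfl
  simpa using h.order_pos

/-- The only zeros of the polynomial `P₀` of `P(x, ∂ + αᵢ x)` are the `βⁱⱼ`. -/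
lemma HasLocalData.exists_eq_of_root (h : T.HasLocalData P) {i : Fin T.r} {z : K}
    (hz : (xPart (twist (T.α i) 0 P) 0).eval z = 0) : ∃ j, z = T.β i j := by
  refine TwistedEuler.exists_eq_of_root (h.β_injective i)
    (xPart_zero_ne_zero (twist_ne_zero _ _ h.ne_zero)) ?_ hz
  rw [(h.normal i).1]
  refine (Finset.sum_congr rfl fun j _ => ?_).le
  refine (HasExponentsAtInfty.rootMultiplicity_eq ?_).symm
  rw [twist_twist, zero_add, add_zero]
  exact h.infinite_exponents i j

theorem isTableOf_iff : T.IsTableOf P ↔ T.HasLocalData P := by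
  constructor
  · intro h
    have hP : P ≠ 0 := by rintro rfl; simpa using h.order_pos
    refine ⟨h.c_injective, h.α_injective, h.β_injective, h.order_pos, h.order_eq, h.ordinary,
      h.finite_exponents, rankAtInftyLE_iff.1 h.rank_le, fun i => ?_, h.infinite_exponents⟩
    have hR := twist_ne_zero (T.α i) 0 hP
    obtain ⟨e, he, hs⟩ := h.normal.1 i
    rw [hasSlopes_iff hR, Nat.add_sub_cancel' he, leadingCoeff_twist, natDegree_twist] at hs
    obtain ⟨-, h2, -, h4, -, h6⟩ := hs
    have hn := T.n_le_order i
    have ho := h.order_eq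
    refine ⟨le_antisymm (natDegree_le_iff_coeff_eq_zero.2 fun b hb => ?_)
      (le_natDegree_of_ne_zero (by rwa [coeff_xPart_zero])), by omega⟩
    rw [coeff_xPart_zero]
    exact h6 _ _ (by omega)
  · intro h
    have hn := fun i => T.n_le_order i
    have ho := h.order_eq
    rw [ho] at hn
    have key : ∀ i j, HasSlopes (twist (T.α i) (T.β i j) P) (T.nn i j) (T.n i - T.nn i j)
        (T.order - T.n i) := by
      intro i j
      have h1 := (hasExponentsAtInfty_iff.1 (h.infinite_exponents i j)).2
      have := hasSlopes_of_normalAt (R := TwistedEuler.twist (T.α i) (T.β i j) P)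
        (twist_ne_zero _ _ h.ne_zero) (h.rank_le.twist _ _)
        ((h.normal i).twist_const (T.β i j)) (by rw [natDegree_twist]; exact hn i) (T.nn_le_n i j)
        h1.lead h1.diag
      rwa [natDegree_twist, ← ho] at this
    refine ⟨h.c_injective, h.α_injective, h.β_injective, h.order_pos, h.order_eq, h.ordinary,
      h.finite_exponents, rankAtInftyLE_iff.2 h.rank_le, ⟨fun i => ?_, key⟩, h.infinite_exponents⟩
    by_cases h0 : (xPart (twist (T.α i) 0 P) 0).eval 0 = 0
    · obtain ⟨j, hj⟩ := h.exists_eq_of_root h0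
      refine ⟨T.nn i j, T.nn_le_n i j, ?_⟩
      have := key i j
      rwa [← hj] at this
    · refine ⟨0, Nat.zero_le _, ?_⟩
      have := hasSlopes_of_normalAt (R := TwistedEuler.twist (T.α i) 0 P) (e := 0)
        (twist_ne_zero _ _ h.ne_zero) (h.rank_le.twist _ _)
        ((h.normal i).twist_const 0) (by rw [natDegree_twist]; exact hn i) (Nat.zero_le _)
        (by rwa [← coeff_xPart_zero, coeff_zero_eq_eval_zero]) ?_
      · rwa [natDegree_twist, ← ho] at this
      · intro a b hab
        exact mem_filt_self _ a b (by push_cast at hab; omega)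

lemma HasLocalData.of_sim (h : T.HasLocalData P) (hs : Sim P' P) : T.HasLocalData P' where
  c_injective := h.c_injective
  α_injective := h.α_injective
  β_injective := h.β_injective
  order_pos := by rw [hs.natDegree_eq]; exact h.order_pos
  order_eq := by rw [hs.natDegree_eq]; exact h.order_eq
  ordinary z hz := (h.ordinary z hz).of_sim h.ne_zero hs
  finite_exponents i := by
    obtain ⟨m, hm⟩ := h.finite_exponents i
    exact ⟨m, hm.of_sim hs⟩
  rank_le := h.rank_le.of_sim h.ne_zero hs
  normal i := (h.normal i).of_sim h.ne_zero hs
  infinite_exponents i j := (h.infinite_exponents i j).of_sim (hs.substD _)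

/-- The table of `P(x, ∂ + a x)`. -/
def twistTable (a : K) (T : LocalTable K) : LocalTable K where
  p := T.p
  c := T.c
  μ := T.μ
  r := T.r
  α := fun i => T.α i - a
  l := T.l
  β := T.β
  ν := T.ν

lemma HasLocalData.twist [CharZero K] (h : T.HasLocalData P) (a : K) :
    (T.twistTable a).HasLocalData (twist a 0 P) where
  c_injective := h.c_injective
  α_injective := fun _ _ e => h.α_injective (sub_left_injective e)
  β_injective := h.β_injective
  order_pos := by rw [natDegree_twist]; exact h.order_pos
  order_eq := by rw [natDegree_twist]; exact h.order_eq
  ordinary z hz := (h.ordinary z hz).twist h.ne_zero _ _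
  finite_exponents i := by
    obtain ⟨m, hm⟩ := h.finite_exponents i
    exact ⟨m, hm.substD _⟩
  rank_le := h.rank_le.twist _ _
  normal i := (h.normal i).twist (sub_add_cancel _ _)
  infinite_exponents i j := by
    rw [twist_twist, add_zero]
    have e : (T.twistTable a).α i + a = T.α i := sub_add_cancel _ _
    rw [e]
    exact h.infinite_exponents i j

/-! ### The addition -/

theorem HasLocalData.rAd [CharZero K] (h : T.HasLocalData P) (f : K) (i : Fin T.p) :
    (T.addition i f).HasLocalData (RAd (T.c i) f P) := by
  have hn : ∀ x y, (T.addition i f).nn x y = T.nn x y := fun x y => size_shift _ _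
  have hn' : ∀ x, (T.addition i f).n x = T.n x := fun x => Finset.sum_congr rfl fun y _ => hn x y
  have ho : (T.addition i f).order = T.order := Finset.sum_congr rfl fun x _ => hn' x
  have hfin : ∀ x, ∃ m₀ : ℕ, HasExponentsAt (additionOp (T.c i) f P) (T.c x)
      ((0, m₀) :: (T.addition i f).μ x) := by
    intro x
    obtain ⟨m, hm⟩ := h.finite_exponents x
    rcases eq_or_ne x i with rfl | hx
    · refine ⟨0, ?_⟩
      have e : (T.addition x f).μ x = (f, T.order - size (T.μ x)) :: shift f (T.μ x) :=
        Function.update_self _ _ _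
      have hs := hm.2.1
      have hs' : m + size (T.μ x) = T.order := by rw [h.order_eq, ← hs]; simp [size]
      have hm' : T.order - size (T.μ x) = m := by omega
      have h1 := hasExponentsAt_iff.1 (hm.additionOp_self f)
      rw [e, hm']
      have e2 : shift f ((0, m) :: T.μ x) = (f, m) :: shift f (T.μ x) := by simp [shift]
      rw [e2] at h1
      obtain ⟨h1, h2, v, h3⟩ := h1
      refine hasExponentsAt_iff.2 ⟨List.pairwise_cons.2
        ⟨fun b _ h0 => absurd h0 (lt_irrefl _), h1⟩, ?_, v, h3.diag, h3.lead, ?_⟩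
      · rw [← h2]; simp [size]
      · intro b hb hpos
        rcases List.mem_cons.1 hb with rfl | hb
        · exact absurd hpos (lt_irrefl _)
        · exact h3.blocks b hb hpos
    · have e : (T.addition i f).μ x = T.μ x := Function.update_of_ne hx _ _
      refine ⟨m, ?_⟩
      rw [e]
      exact hm.additionOp_of_ne (h.c_injective.ne hx) f
  have hA : (T.addition i f).HasLocalData (additionOp (T.c i) f P) := {
    c_injective := h.c_injective
    α_injective := h.α_injective
    β_injective := h.β_injective
    order_pos := by rw [natDegree_additionOp]; exact h.order_pos
    order_eq := by rw [natDegree_additionOp, ho]; exact h.order_eq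
    ordinary := fun z hz => (h.ordinary z hz).additionOp h.ne_zero (hz i) f
    finite_exponents := hfin
    rank_le := h.rank_le.additionOp h.ne_zero _ _
    normal := fun x => by rw [hn']; exact (h.normal x).additionOp h.ne_zero _ _
    infinite_exponents := fun x y => by
      rw [twist_additionOp]
      exact (h.infinite_exponents x y).additionOp _ _ }
  exact hA.of_sim (rAd_spec (T.c i) f h.ne_zero).1

end LocalTable

end

section

variable {K : Type*} [Field K]

namespace LocalTable

variable {T : LocalTable K} {P : K[X][X]}

/-! ### The table of the Euler transform -/

lemma perm_get_cons_set {A : Type*} (l : List A) (k : Fin l.length) (a : A) :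
    (a :: l).Perm (l.get k :: l.set k a) := by
  have h1 := List.set_eq_take_append_cons_drop (l := l) (i := k) (a := a)
  rw [if_pos k.2] at h1
  have h2 : l = l.take k ++ l.get k :: l.drop (k + 1) := by
    rw [List.get_eq_getElem, List.getElem_cons_drop, List.take_append_drop]
  rw [h1]
  conv_lhs => rw [h2]
  refine ((List.perm_middle.cons a)).trans ((List.Perm.swap _ _ _).trans ?_)
  exact List.perm_middle.symm.cons _

lemma size_cons {K : Type*} (b : K × ℕ) (L : List (K × ℕ)) : size (b :: L) = b.2 + size L := by
  simp [size]

lemma size_set {K : Type*} (L : List (K × ℕ)) (k : Fin L.length) (b : K × ℕ) :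
    (L.get k).2 + size (L.set k b) = b.2 + size L := by
  have := ((perm_get_cons_set L k b).map Prod.snd).sum_eq
  rw [← size, ← size, size_cons, size_cons] at this
  exact this.symm

variable (i : Fin T.r) (j : Fin (T.l i)) (k : Fin (T.ν i j).length)

lemma euler_ν_self : (T.euler i j k).ν i j = (shift (-(T.exponent i j k - 1)) (T.ν i j)).set k
    (2 - T.exponent i j k, T.N i - T.nn i j) := if_pos rfl

lemma euler_ν_of_ne {y : Fin (T.l i)} (hy : y ≠ j) : (T.euler i j k).ν i y = T.ν i y := by
  refine (if_neg ?_).trans (if_pos rfl)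
  intro h
  exact hy (eq_of_heq (Sigma.mk.inj_iff.1 h).2)

lemma euler_ν_of_fst_ne {x : Fin T.r} (hx : x ≠ i) (y : Fin (T.l x)) :
    (T.euler i j k).ν x y = shift (T.exponent i j k - 1) (T.ν x y) := by
  refine (if_neg ?_).trans (if_neg hx)
  intro h
  exact hx (Sigma.mk.inj_iff.1 h).1

lemma nn_euler_self : T.mult i j k + (T.euler i j k).nn i j =
    (T.N i - T.nn i j) + T.nn i j := by
  have hlen : (k : ℕ) < (shift (-(T.exponent i j k - 1)) (T.ν i j)).length := by
    rw [shift, List.length_map]; exact k.2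
  have h := size_set (shift (-(T.exponent i j k - 1)) (T.ν i j)) ⟨k, hlen⟩
    (2 - T.exponent i j k, T.N i - T.nn i j)
  rw [size_shift] at h
  have e : ((shift (-(T.exponent i j k - 1)) (T.ν i j)).get ⟨k, hlen⟩).2 = T.mult i j k := by
    simp [shift, mult]
  rw [e] at h
  have e' : (T.euler i j k).nn i j = _ := congrArg size (euler_ν_self i j k)
  rw [e']
  exact h

lemma n_euler_self : T.mult i j k + (T.euler i j k).n i = (T.N i - T.nn i j) + T.n i := by
  have h1 := Finset.add_sum_erase Finset.univ (fun y => (T.euler i j k).nn i y) (Finset.mem_univ j)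
  have h2 := Finset.add_sum_erase Finset.univ (fun y => T.nn i y) (Finset.mem_univ j)
  have h3 : ∑ y ∈ Finset.univ.erase j, (T.euler i j k).nn i y =
      ∑ y ∈ Finset.univ.erase j, T.nn i y := by
    exact Finset.sum_congr rfl fun y hy =>
      congrArg size (euler_ν_of_ne i j k (Finset.ne_of_mem_erase hy))
  have h4 := nn_euler_self i j k
  have h5 : (T.euler i j k).n i = (T.euler i j k).nn i j +
      ∑ y ∈ Finset.univ.erase j, (T.euler i j k).nn i y := h1.symm
  have h6 : T.n i = T.nn i j + ∑ y ∈ Finset.univ.erase j, T.nn i y := h2.symm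
  omega

lemma n_euler_of_ne {x : Fin T.r} (hx : x ≠ i) : (T.euler i j k).n x = T.n x := by
  exact Finset.sum_congr rfl fun y _ =>
    (congrArg size (euler_ν_of_fst_ne i j k hx y)).trans (size_shift _ _)

lemma order_euler : T.n i + (T.euler i j k).order = T.order + (T.euler i j k).n i := by
  have h1 := Finset.add_sum_erase Finset.univ (fun x => (T.euler i j k).n x) (Finset.mem_univ i)
  have h2 := Finset.add_sum_erase Finset.univ (fun x => T.n x) (Finset.mem_univ i)
  have h3 : ∑ x ∈ Finset.univ.erase i, (T.euler i j k).n x = ∑ x ∈ Finset.univ.erase i, T.n x :=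
    Finset.sum_congr rfl fun x hx => n_euler_of_ne i j k (Finset.ne_of_mem_erase hx)
  have h5 : (T.euler i j k).order = (T.euler i j k).n i +
      ∑ x ∈ Finset.univ.erase i, (T.euler i j k).n x := h1.symm
  have h6 : T.order = T.n i + ∑ x ∈ Finset.univ.erase i, T.n x := h2.symm
  omega

lemma mult_le_nn {K : Type*} {T : LocalTable K} (i : Fin T.r) (j : Fin (T.l i))
    (k : Fin (T.ν i j).length) : T.mult i j k ≤ T.nn i j :=
  List.single_le_sum (fun _ _ => Nat.zero_le _) _ (List.mem_map_of_mem (List.get_mem _ k))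

variable {i j k}

/-- For a primitive operator without integral exponents `μ`, the leading coefficient vanishes at `cₓ`
to the order `∑ mˣₗ`. -/
lemma HasLocalData.natDegree_leadingCoeff [IsAlgClosed K] [CharZero K] (h : T.HasLocalData P)
    (hP : Primitive P) (hμ : ∀ x, ∀ b ∈ T.μ x, NotInt b.1) :
    P.leadingCoeff.natDegree = ∑ x, size (T.μ x) := by
  rw [natDegree_eq_sum_rootMultiplicity h.c_injective fun z hz => ?_]
  · refine Finset.sum_congr rfl fun x _ => ?_
    obtain ⟨m, hm⟩ := h.finite_exponents x
    exact hm.rootMultiplicity_eq hP fun b hb _ => hμ x b hb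
  · by_contra! hne
    exact (h.ordinary z hne).leadingCoeff_eval_ne_zero h.ne_zero (Sim.refl P) hP hz

lemma HasLocalData.degX_eq [IsAlgClosed K] [CharZero K] (h : T.HasLocalData P)
    (hP : Primitive P) (hμ : ∀ x, ∀ b ∈ T.μ x, NotInt b.1) (hi : T.α i = 0) :
    degX P = T.N i := by
  have h1 := (h.normal i).2
  rw [hi, twist_zero, h.natDegree_leadingCoeff hP hμ, ← h.order_eq] at h1
  have := T.n_le_order i
  rw [N]
  omega

/-- The exponents of `RAd ∘ L⁻¹` at the points `-βⁱ_y`: the block of the exponent `ν` at `-βⁱⱼ` is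
moved to `0` and thus exchanged with the block of `0`. -/
lemma HasLocalData.exists_hasExponentsAt [IsAlgClosed K] [CharZero K] (h : T.HasLocalData P)
    (hP : Primitive P) (hμ : ∀ x, ∀ b ∈ T.μ x, NotInt b.1) (hi : T.α i = 0)
    (hk : 0 < T.mult i j k) (hν : ∀ y, ∀ b ∈ T.ν i y, NotInt b.1) (y : Fin (T.l i)) :
    ∃ m, HasExponentsAt (additionOp (-T.β i j) (-(T.exponent i j k - 1)) (four 1 P)) (-T.β i y)
      ((0, m) :: shift (-1) ((T.euler i j k).ν i y)) ∧
      ∀ b ∈ shift (-1) ((T.euler i j k).ν i y), 0 < b.2 → NotInt b.1 := by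
  have h1 := h.infinite_exponents i y
  have e : T.β i y = -(1 * -T.β i y) := by ring
  rw [hi, e] at h1
  have h2 := h1.four (one_mul 1) (hν y)
  rcases eq_or_ne y j with rfl | hy
  · set f := -(T.exponent i y k - 1) with hf
    have h3 := h2.additionOp_self f
    have hD := h.degX_eq hP hμ hi
    have hlen : (k : ℕ) < (shift (-1 + f) (T.ν i y)).length := by
      rw [shift, List.length_map]; exact k.2
    have e1 : shift f ((0, degX P - size (T.ν i y)) :: shift (-1) (T.ν i y)) =
        (f, T.N i - T.nn i y) :: shift (-1 + f) (T.ν i y) := by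
      rw [hD, ← shift_shift]; simp [shift, nn]
    have e2 : (shift (-1 + f) (T.ν i y)).get ⟨k, hlen⟩ = (0, T.mult i y k) := by
      simp only [shift, List.get_eq_getElem, List.getElem_map, mult]
      refine Prod.ext ?_ rfl
      simp only [hf, exponent, List.get_eq_getElem]
      ring
    have e3 : (shift (-1 + f) (T.ν i y)).set k (f, T.N i - T.nn i y) =
        shift (-1) ((T.euler i y k).ν i y) := by
      rw [euler_ν_self, ← hf, shift, shift, shift, List.map_set, List.map_map]
      congr 1
      · refine List.map_congr_left fun b _ => ?_
        simp [add_comm, add_left_comm]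
      · refine Prod.ext ?_ rfl
        simp only [hf]; ring
    rw [e1] at h3
    have h4 := h3.perm (perm_get_cons_set _ ⟨k, hlen⟩ _)
    rw [e2] at h4
    have h5 : HasExponentsAt (additionOp (-T.β i y) f (four 1 P)) (-T.β i y)
        ((0, T.mult i y k) :: shift (-1) ((T.euler i y k).ν i y)) := by
      rw [← e3]; exact h4
    refine ⟨_, h5, fun b hb hpos => ?_⟩
    have := (List.pairwise_cons.1 h5.1).1 b hb hk hpos
    rw [zero_sub] at this
    simpa using this.neg
  · refine ⟨degX P - size (T.ν i y), ?_, ?_⟩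
    · rw [euler_ν_of_ne i j k hy]
      exact h2.additionOp_of_ne (fun e => hy (h.β_injective i (neg_injective e))) _
    · rw [euler_ν_of_ne i j k hy]
      exact notInt_shift fun b hb _ => by exact_mod_cast (hν y b hb).add_int (-1)

end LocalTable

end

section

variable {K : Type*} [Field K]

namespace LocalTable

variable {T : LocalTable K} {P : K[X][X]} {i : Fin T.r} {j : Fin (T.l i)}
  {k : Fin (T.ν i j).length}

/-! ### The Euler transform -/

/-- The Euler transform for the twist `αᵢ = 0`. The normality and the exponents of the inverse transform
`Q₁` of `P`, of its addition `Q₂` and of the transform `P₂` of `Q₂` are determined in turn. -/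
theorem HasLocalData.euler [IsAlgClosed K] [CharZero K] (h : T.HasLocalData P)
    (hP : Primitive P) (hi : T.α i = 0) (hk : 0 < T.mult i j k)
    (hμ : ∀ x, ∀ b ∈ T.μ x, NotInt b.1) (hν : ∀ y, ∀ b ∈ T.ν i y, NotInt b.1)
    (hμν : ∀ x, ∀ b ∈ T.μ x, NotInt (b.1 + T.exponent i j k)) :
    T.nn i j ≤ T.N i ∧
    (T.euler i j k).HasLocalData
      (four (-1) (RAd (-T.β i j) (-(T.exponent i j k - 1)) (four 1 P))) ∧
    (four (-1) (RAd (-T.β i j) (-(T.exponent i j k - 1)) (four 1 P))).natDegree =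
      (P.natDegree - T.mult i j k) + (T.N i - T.nn i j) := by
  have hP0 := h.ne_zero
  have h1 : (1 : K) * 1 = 1 := one_mul 1
  have hm : (-1 : K) * -1 = 1 := by ring
  have hm0 : (-1 : K) ≠ 0 := neg_ne_zero.2 one_ne_zero
  have hM := h.natDegree_leadingCoeff hP hμ
  have hD := h.degX_eq hP hμ hi
  have hN0 : NormalAt 0 (T.n i) P := hi ▸ h.normal i
  have hnn : T.nn i j ≤ T.N i := by
    have := (h.infinite_exponents i j).size_le fun b hb _ => hν j b hb
    rwa [hi, degX_twist_zero, hD] at this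
  have hroot : ∀ z, (xPart P 0).eval z = 0 → ∃ y, z = T.β i y := fun z hz => by
    refine h.exists_eq_of_root (i := i) ?_
    rwa [hi, twist_zero]
  set c₀ := -T.β i j with hc₀
  set f := -(T.exponent i j k - 1) with hf
  -- The inverse transform of `P`.
  set Q₁ := four 1 P with hQ₁
  have hQ₁0 : Q₁ ≠ 0 := four_ne_zero h1 hP0
  have hback : four (-1) Q₁ = P := four_four h1 P
  have hd₁ : Q₁.natDegree = T.N i := by rw [← hD]; exact natDegree_four one_ne_zero hP0
  have hr₁ : RankLETwo Q₁ := h.rank_le.four hN0 hP0 h1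
  have hN₁ : NormalAt 0 (∑ x, size (T.μ x)) Q₁ := hM ▸ hN0.four_zero hP0 h1
  have hinf₁ : ∀ x, HasExponentsAtInfty (TwistedEuler.twist 0 (T.c x) Q₁) (shift 1 (T.μ x)) := by
    intro x
    obtain ⟨m, hm'⟩ := h.finite_exponents x
    rw [← hback] at hm' hP
    have := hm'.of_four hm hP fun b hb _ => hμ x b hb
    rwa [neg_mul, one_mul, neg_neg] at this
  have hlc₁ : ∀ z, (∀ y, z ≠ -T.β i y) → Q₁.leadingCoeff.eval z ≠ 0 := by
    intro z hz h0
    rw [hQ₁, leadingCoeff_four one_ne_zero hP0, one_pow, C_1, one_mul, eval_comp] at h0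
    obtain ⟨y, hy⟩ := hroot _ h0
    refine hz y ?_
    rw [← hy]; simp
  -- The addition at `-β`.
  set A := additionOp c₀ f Q₁ with hA
  have hA0 : A ≠ 0 := additionOp_ne_zero c₀ f hQ₁0
  set Q₂ := RAd c₀ f Q₁ with hQ₂
  obtain ⟨hs, hprim⟩ := rAd_spec c₀ f hQ₁0
  rw [← hA, ← hQ₂] at hs
  rw [← hQ₂] at hprim
  have hQ₂0 : Q₂ ≠ 0 := hs.ne_zero hA0
  have hd₂ : Q₂.natDegree = T.N i := by rw [hs.natDegree_eq, hA, natDegree_additionOp, hd₁]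
  have hr₂ : RankLETwo Q₂ := (hr₁.additionOp hQ₁0 c₀ f).of_sim hA0 hs
  have hN₂ : NormalAt 0 (∑ x, size (T.μ x)) Q₂ := (hN₁.additionOp hQ₁0 c₀ f).of_sim hA0 hs
  have hinf₂ : ∀ x, HasExponentsAtInfty (TwistedEuler.twist 0 (T.c x) Q₂)
      (shift (T.exponent i j k) (T.μ x)) := by
    intro x
    have h2 := (hinf₁ x).additionOp c₀ f
    rw [← twist_additionOp, ← hA, shift_shift] at h2
    have e : 1 + -f = T.exponent i j k := by rw [hf]; ring
    rw [e] at h2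
    exact h2.of_sim (hs.substD _)
  have hfin₂ : ∀ y, ∃ m, HasExponentsAt Q₂ (-T.β i y)
      ((0, m) :: shift (-1) ((T.euler i j k).ν i y)) ∧
      ∀ b ∈ shift (-1) ((T.euler i j k).ν i y), 0 < b.2 → NotInt b.1 := by
    intro y
    obtain ⟨m, hm1, hm2⟩ := h.exists_hasExponentsAt hP hμ hi hk hν y
    exact ⟨m, hm1.of_sim hs, hm2⟩
  have hlc₂ : Q₂.leadingCoeff.natDegree = (T.euler i j k).n i := by
    rw [natDegree_eq_sum_rootMultiplicity (c := fun y => -T.β i y)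
      (fun y y' e => h.β_injective i (neg_injective e)) fun z hz => ?_]
    · refine Finset.sum_congr rfl fun y _ => ?_
      obtain ⟨m, hm1, hm2⟩ := hfin₂ y
      rw [hm1.rootMultiplicity_eq hprim hm2, size_shift]
      rfl
    · by_contra! hne
      refine hprim.leadingCoeff_eval_ne_zero hs ?_ hz
      rw [hA, leadingCoeff_additionOp, eval_mul]
      refine mul_ne_zero ?_ (hlc₁ z hne)
      simpa [hc₀] using pow_ne_zero Q₁.natDegree (sub_ne_zero.2 (hne j))
  -- The transform of the result.
  set P₂ := four (-1) Q₂ with hP₂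
  have hP₂0 : P₂ ≠ 0 := four_ne_zero hm hQ₂0
  have hback₂ : four 1 P₂ = Q₂ := by
    have := four_four hm Q₂
    rwa [neg_neg] at this
  have hd : P₂.natDegree = degX Q₂ := natDegree_four hm0 hQ₂0
  -- The order follows from the comparison of the two ways of computing the slopes at infinity.
  have hcount : degX Q₂ + ∑ x, size (T.μ x) = (T.euler i j k).n i + T.N i := by
    have := hN₂.2
    rwa [twist_zero, hlc₂, hd₂] at this
  have hNdef : T.N i = (∑ x, size (T.μ x)) + (T.order - T.n i) := rfl
  have hn1 := n_euler_self i j k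
  have hn2 := order_euler i j k
  have hn3 := mult_le_nn i j k
  have hn4 := T.nn_le_n i j
  have hn5 := T.n_le_order i
  have horder := h.order_eq
  have hpos := h.order_pos
  -- If `Q₂` had degree `0` in `x`, then some `mˣ_y` would be positive by the count above, but the
  -- exponents of `Q₂` at infinity with the twist `cₓ x` are at most as many as its degree in `x`.
  have hdpos : 0 < degX Q₂ := by
    by_contra h0
    have hM0 : ∑ x, size (T.μ x) ≠ 0 := by omega
    obtain ⟨x, -, hx⟩ := Finset.exists_ne_zero_of_sum_ne_zero hM0
    have := (hinf₂ x).size_le (notInt_shift fun b hb _ => hμν x b hb)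
    rw [size_shift, degX_twist_zero] at this
    omega
  refine ⟨hnn, ?_, by omega⟩
  have hord : ∀ z, (∀ x, z ≠ T.c x) → IsOrdinaryAt P₂ z := by
    intro z hz
    refine IsOrdinaryAt.of_eval_ne_zero ?_
    obtain ⟨κ, hκ, e⟩ := hs.xPart hA0
    rw [hP₂, leadingCoeff_four hm0 hQ₂0, e, hA, xPart_additionOp c₀ f hQ₁0, hQ₁, xPart_four h1 hP0]
    have h0 := (h.ordinary z hz).leadingCoeff_eval_ne_zero hP0 (Sim.refl P) hP
    simp [hκ, h0]
  have hfin : ∀ x, ∃ m, HasExponentsAt P₂ (T.c x) ((0, m) :: (T.euler i j k).μ x) := by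
    intro x
    have h2 := hinf₂ x
    have e : T.c x = -(-1 * T.c x) := by ring
    rw [e] at h2
    have h3 := h2.four hm fun b hb => by
      obtain ⟨b, hb', rfl⟩ := List.mem_map.1 hb
      exact hμν x b hb'
    rw [shift_shift, ← sub_eq_add_neg] at h3
    exact ⟨_, h3⟩
  have hinfty : ∀ x y, HasExponentsAtInfty (TwistedEuler.twist (T.α x) (T.β x y) P₂)
      ((T.euler i j k).ν x y) := by
    intro x y
    rcases eq_or_ne x i with rfl | hx
    · obtain ⟨m, hm1, hm2⟩ := hfin₂ y
      rw [← hback₂] at hm1 hprim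
      have := hm1.of_four h1 hprim hm2
      rwa [one_mul, neg_neg, shift_shift, neg_add_cancel, shift_zero, ← hi] at this
    · have hα : T.α x ≠ 0 := fun e => hx (h.α_injective (e.trans hi.symm))
      have h2 := ((h.infinite_exponents x y).twist_four h1 hα).additionOp c₀ f
      rw [← twist_additionOp] at h2
      have h3 := (h2.of_sim (hs.substD _)).twist_four hm (neg_ne_zero.2 (inv_ne_zero hα))
      have e1 : -(-(T.α x)⁻¹)⁻¹ = T.α x := by rw [inv_neg, neg_neg, inv_inv]
      have e2 : -(-1 * -(1 * T.β x y * (T.α x)⁻¹) * (-(T.α x)⁻¹)⁻¹) = T.β x y := by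
        field_simp
      have e3 : -f = T.exponent i j k - 1 := by rw [hf, neg_neg]
      rw [e1, e2, e3] at h3
      rw [euler_ν_of_fst_ne i j k hx]
      exact h3
  have hnormal : ∀ x, NormalAt (T.α x) ((T.euler i j k).n x) P₂ := by
    intro x
    rcases eq_or_ne x i with rfl | hx
    · rw [hi, ← hlc₂]
      exact hN₂.four_zero hQ₂0 hm
    · have hα : T.α x ≠ 0 := fun e => hx (h.α_injective (e.trans hi.symm))
      have h2 := (h.normal x).four hN0 hP0 h1 hα
      have h3 := ((h2.additionOp hQ₁0 c₀ f).of_sim hA0 hs).four hN₂ hQ₂0 hm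
        (neg_ne_zero.2 (inv_ne_zero hα))
      have e1 : -(-(T.α x)⁻¹)⁻¹ = T.α x := by rw [inv_neg, neg_neg, inv_inv]
      rw [e1] at h3
      rw [n_euler_of_ne i j k hx]
      exact h3
  exact {
    c_injective := h.c_injective
    α_injective := h.α_injective
    β_injective := h.β_injective
    order_pos := by rw [hd]; exact hdpos
    order_eq := by omega
    ordinary := hord
    finite_exponents := hfin
    rank_le := hr₂.four hN₂ hQ₂0 hm
    normal := hnormal
    infinite_exponents := hinfty }

/-- Twisting the table of `P(x, ∂ + a x)` after the transform back to the table of `P`. -/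
lemma twistTable_euler (a : K) (T : LocalTable K) (i : Fin T.r) (j : Fin (T.l i))
    (k : Fin (T.ν i j).length) :
    ((LocalTable.euler (T.twistTable a) i j k).twistTable (-a)) = T.euler i j k := by
  change (⟨T.p, T.c, (T.euler i j k).μ, T.r, fun x => T.α x - a - -a, T.l, T.β, (T.euler i j k).ν⟩ :
    LocalTable K) = _
  have : (fun x => T.α x - a - -a) = T.α := by funext x; ring
  rw [this]
  rfl

end LocalTable

end

end TwistedEuler

end

theorem mainTheorem3 {K : Type*} [Field K] [IsAlgClosed K] [CharZero K]
    (T : TwistedEuler.LocalTable K) (P : K[X][X]) (hP : T.IsTableOf P) :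
    (∀ (f : K) (i : Fin T.p), (T.addition i f).IsTableOf (TwistedEuler.RAd (T.c i) f P)) ∧
    ∀ (i : Fin T.r) (j : Fin (T.l i)) (k : Fin (T.ν i j).length),
      0 < T.mult i j k →
      (∀ x, ∀ b ∈ T.μ x, TwistedEuler.NotInt b.1) →
      (∀ y, ∀ b ∈ T.ν i y, TwistedEuler.NotInt b.1) →
      (∀ x, ∀ b ∈ T.μ x, TwistedEuler.NotInt (b.1 + T.exponent i j k)) →
      T.nn i j ≤ T.N i ∧
      (T.euler i j k).IsTableOf
        (TwistedEuler.twistedEuler (C (T.α i / 2) * X ^ 2) (T.β i j) (T.exponent i j k - 1) P) ∧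
      (TwistedEuler.twistedEuler (C (T.α i / 2) * X ^ 2) (T.β i j)
          (T.exponent i j k - 1) P).natDegree =
        (P.natDegree - T.mult i j k) + (T.N i - T.nn i j) := by
  open TwistedEuler LocalTable in
  have h := isTableOf_iff.1 hP
  refine ⟨fun f i => isTableOf_iff.2 (h.rAd f i), fun i j k hk hμ hν hμν => ?_⟩
  have hT := h.twist (T.α i)
  obtain ⟨hs, hprim⟩ := reduced_toRat hT.ne_zero
  -- The table of `P(x, ∂ + αᵢ x)` has `αᵢ = 0`.
  have key := (hT.of_sim hs).euler (T := T.twistTable (T.α i)) (i := i) (j := j) (k := k) hprim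
    (sub_self _) hk hμ hν hμν
  have hde : derivative (C (T.α i / 2) * X ^ 2 : K[X]) = C (T.α i) * X := by
    rw [derivative_C_mul, derivative_X_pow, ← mul_assoc]
    have : T.α i / 2 * 2 = T.α i := div_mul_cancel₀ _ two_ne_zero
    rw [← C_mul]
    norm_num [this]
  have e1 : Ade (-(C (T.α i / 2) * X ^ 2)) P = twist (T.α i) 0 P := by
    rw [Ade, derivative_neg, neg_neg, hde, twist, C_0, add_zero]
  have e2 : ∀ R : K[X][X], Ade (C (T.α i / 2) * X ^ 2) R = twist (-T.α i) 0 R := by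
    intro R
    rw [Ade, hde, twist, C_0, add_zero, C_neg, neg_mul]
  rw [twistedEuler, e1, e2, TwistedEuler.euler, fourier_eq, fourierInv_eq]
  obtain ⟨k1, k2, k3⟩ := key
  refine ⟨k1, isTableOf_iff.2 ?_, ?_⟩
  · have h3 := k2.twist (-T.α i)
    rwa [twistTable_euler] at h3
  · rw [natDegree_twist]
    refine k3.trans ?_
    rw [hs.natDegree_eq, natDegree_twist]
    rfl
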